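/- \textbf{Theorem (general two-sided law of the iterated logarithm under sub-linear expectations).} \emph{Setting.} Let $(\Omega,\mathcal F)$ be a measurable space and $\mathscr H$ a linear space of real measurable functions on it such that $\varphi(X_1,\dots,X_n)\in\mathscr H$ whenever $X_i\in\mathscr H$ and $\varphi\in C_{l,Lip}(\mathbb R^n)$, i.e. $|\varphi(x)-\varphi(y)|\le C(1+|x|^m+|y|^m)|x-y|$ for some $C>0$, $m\in\mathbb N$. Let $\widehat{\mathbb E}:\mathscr H\to[-\infty,\infty]$ be a sub-linear expectation: it is monotone, $\widehat{\mathbb E}[c]=c$ for constants $c$, $\widehat{\mathbb E}[X+Y]\le\widehat{\mathbb E}[X]+\widehat{\mathbb E}[Y]$ whenever the right-hand side is not of the form $\infty-\infty$, and $\widehat{\mathbb E}[\lambda X]=\lambda\widehat{\mathbb E}[X]$ for $\lambda\ge0$ ($0\cdot\infty=0$). Put $\widehat{\mathcal E}[X]=-\widehat{\mathbb E}[-X]$. Let $\mathbb V:\mathcal F\to[0,1]$ be monotone and sub-additive with $\mathbb V(\emptyset)=0$, $\mathbb V(\Omega)=1$ and $\widehat{\mathbb E}[f]\le\mathbb V(A)\le\widehat{\mathbb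 E}[g]$ whenever $f\le I_A\le g$, $f,g\in\mathscr H$, $A\in\mathcal F$. Put $$\widehat{\mathbb V}(A)=\inf\{\widehat{\mathbb E}[\xi]: I_A\le\xi\in\mathscr H\},\qquad \widehat{\mathbb V}^*(A)=\inf\Big\{\sum_{n=1}^\infty\widehat{\mathbb V}(A_n): A\subset\bigcup_{n=1}^\infty A_n,\ A_n\in\mathcal F\Big\},\qquad A\in\mathcal F.$$ Let $\{X_n;n\ge1\}\subset\mathscr H$ satisfy $\widehat{\mathbb E}[X_n^2]<\infty$ for all $n$ and be independent: for each $i\ge1$, with $\boldsymbol X=(X_1,\dots,X_i)$ and $Y=X_{i+1}$, one has $\widehat{\mathbb E}[\varphi(\boldsymbol X,Y)]=\widehat{\mathbb E}\big[\widehat{\mathbb E}[\varphi(x,Y)]|_{x=\boldsymbol X}\big]$ for every $\varphi\in C_{l,Lip}(\mathbb R^{i}\times\mathbb R)$ such that $\overline\varphi(x):=\widehat{\mathbb E}[|\varphi(x,Y)|]<\infty$ for all $x$ and $\widehat{\mathbb E}[|\overline\varphi(\boldsymbol X)|]<\infty$ (where the functions of $\boldsymbol X$ to which the outer expectations are applied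 belong to $\mathscr H$). Write $\log x=\ln\max(e,x)$, $S_n=\sum_{k=1}^nX_k$, $s_n^2=\sum_{k=1}^n\widehat{\mathbb E}[X_k^2]$, $t_n=\sqrt{2\log\log s_n^2}$, $a_n=s_nt_n$, and $$\Gamma_n(p,\alpha)=\widehat{\mathbb E}\big[\big((|X_n|-\alpha s_n/t_n)^+\big)^p\big],\qquad \Lambda_n(p,\alpha)=\sum_{j=1}^n\widehat{\mathbb E}\big[\big((|X_j|-\alpha s_n/t_n)^+\big)^p\big].$$ \emph{Assumptions.} (In the series in (ii) and (iii), terms with $s_n=0$ are omitted; in (ii), $\infty^0=0^0=1$ and $0\cdot\infty=0$.) (i) $\sum_{n=1}^\infty\mathbb V(|X_n|\ge\epsilon a_n)<\infty$ for all $\epsilon>0$. (ii) For every $\alpha>0$ there exist $p\ge2$ and $d\ge0$ such that $\displaystyle\sum_{n=1}^\infty\frac{\Gamma_n(p,\alpha)}{a_n^p}\Big(\frac{\Lambda_n(p,\alpha)}{a_n^p}\Big)^d<\infty$. (iii) $\sum_{n=1}^\infty s_n^{-2}(\log s_n^2)^{\delta-1}\widehat{\mathbb E}[X_n^2]=\infty$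 for all $\delta>0$. (iv) $\displaystyle\frac{\sum_{j=1}^n|\widehat{\mathbb E}[X_j]|+\sum_{j=1}^n|\widehat{\mathcal E}[X_j]|}{a_n}\to0$. \emph{Conclusion.} For every $\epsilon>0$, $$\lim_{n\to\infty}\sup_N\mathbb V\Big(\max_{n\le m\le N}\frac{|S_m|}{a_m}>1+\epsilon\Big)=0,$$ $$\lim_{n\to\infty}\sup_N\mathbb V\Big(\max_{n\le m\le N}\frac{-S_m}{a_m}\ge1-\epsilon\Big)=\lim_{n\to\infty}\sup_N\mathbb V\Big(\max_{n\le m\le N}\frac{S_m}{a_m}\ge1-\epsilon\Big)=1,$$ and $$\widehat{\mathbb V}^*\Big(\limsup_{n\to\infty}\frac{|S_n|}{a_n}>1\Big)=0.$$ -/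

import Mathlib

open Filter Topology
open scoped ENNReal

noncomputable section

/-- The class `C_{l,Lip}` of locally Lipschitz functions of polynomial growth. On a
finite-dimensional space it does not depend on the choice of the norm. -/
def IsLocLip {F : Type*} [SeminormedAddCommGroup F] (φ : F → ℝ) : Prop :=
  ∃ C : ℝ, 0 < C ∧ ∃ m : ℕ, ∀ x y : F,
    |φ x - φ y| ≤ C * (1 + ‖x‖ ^ m + ‖y‖ ^ m) * ‖x - y‖

/-- A sub-linear expectation space `(Ω, H, E)` over a measurable space `Ω`. The expectation is an
extended-real-valued functional on `H`; it is written as a function on all of `Ω → ℝ`, but it is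
constrained, and used, only on `H`. -/
structure SublinearExpectationSpace (Ω : Type*) [MeasurableSpace Ω] where
  /-- the linear space of random variables -/
  H : Submodule ℝ (Ω → ℝ)
  measurable_of_mem : ∀ X ∈ H, Measurable X
  comp_mem : ∀ (n : ℕ) (X : Fin n → Ω → ℝ), (∀ i, X i ∈ H) →
    ∀ φ : (Fin n → ℝ) → ℝ, IsLocLip φ → (fun ω => φ (fun i => X i ω)) ∈ H
  /-- the sub-linear expectation -/
  E : (Ω → ℝ) → EReal
  mono : ∀ X ∈ H, ∀ Y ∈ H, (∀ ω, Y ω ≤ X ω) → E Y ≤ E X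
  const : ∀ c : ℝ, E (fun _ => c) = (c : EReal)
  subadd : ∀ X ∈ H, ∀ Y ∈ H, ¬ (E X = ⊤ ∧ E Y = ⊥) → ¬ (E X = ⊥ ∧ E Y = ⊤) →
    E (fun ω => X ω + Y ω) ≤ E X + E Y
  pos_homog : ∀ X ∈ H, ∀ r : ℝ, 0 ≤ r → E (fun ω => r * X ω) = (r : EReal) * E X

namespace SublinearExpectationSpace

variable {Ω : Type*} [MeasurableSpace Ω] (𝓔 : SublinearExpectationSpace Ω)

/-- The conjugate expectation `X ↦ -E[-X]`. -/
def conjE (X : Ω → ℝ) : EReal := -𝓔.E (fun ω => -X ω)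

/-- The random vector `Y` is independent to the random vector `X`:
`E[φ(X, Y)] = E[E[φ(x, Y)]|_{x = X}]` for every `φ ∈ C_{l,Lip}` for which
`φ̄(x) = E[|φ(x, Y)|]` is finite for all `x` and `E[|φ̄(X)|]` is finite. The two membership
conditions say that the outer expectations are applied to elements of `H`. The inner expectations
are finite, so that `EReal.toReal` only changes their type. -/
def IndepTo {m n : ℕ} (Y : Fin n → Ω → ℝ) (X : Fin m → Ω → ℝ) : Prop :=
  ∀ φ : (Fin m → ℝ) × (Fin n → ℝ) → ℝ, IsLocLip φ →
    (∀ x : Fin m → ℝ, 𝓔.E (fun ω => |φ (x, fun j => Y j ω)|) < ⊤) →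
    (fun ω => |(𝓔.E (fun ω' => |φ (fun i => X i ω, fun j => Y j ω')|)).toReal|) ∈ 𝓔.H →
    𝓔.E (fun ω => |(𝓔.E (fun ω' => |φ (fun i => X i ω, fun j => Y j ω')|)).toReal|) < ⊤ →
    (fun ω => (𝓔.E (fun ω' => φ (fun i => X i ω, fun j => Y j ω'))).toReal) ∈ 𝓔.H →
    𝓔.E (fun ω => φ (fun i => X i ω, fun j => Y j ω)) =
      𝓔.E (fun ω => (𝓔.E (fun ω' => φ (fun i => X i ω, fun j => Y j ω'))).toReal)

/-- A sequence `X 1, X 2, …` in `H` (the entry `X 0` is not used) is independent: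
`X (i + 1)` is independent to `(X 1, …, X i)` for each `i ≥ 1`. -/
def IndepSeq (X : ℕ → Ω → ℝ) : Prop :=
  ∀ i : ℕ, 1 ≤ i →
    𝓔.IndepTo (fun _ : Fin 1 => X (i + 1)) (fun k : Fin i => X ((k : ℕ) + 1))

/-- `V` is a sub-additive capacity on the measurable sets (its values at other sets play no role)
such that `E[f] ≤ V(A) ≤ E[g]` whenever `f ≤ 1_A ≤ g` and `f, g ∈ H`. Monotonicity puts its values
into `[0, 1]`. -/
structure IsUpperCapacity (V : Set Ω → ℝ) : Prop where
  empty : V ∅ = 0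
  univ : V Set.univ = 1
  mono : ∀ A B : Set Ω, MeasurableSet A → MeasurableSet B → A ⊆ B → V A ≤ V B
  subadd : ∀ A B : Set Ω, MeasurableSet A → MeasurableSet B → V (A ∪ B) ≤ V A + V B
  le_of_le_indicator : ∀ A : Set Ω, MeasurableSet A → ∀ f ∈ 𝓔.H,
    (∀ ω, f ω ≤ A.indicator (fun _ => (1 : ℝ)) ω) → 𝓔.E f ≤ (V A : EReal)
  le_of_indicator_le : ∀ A : Set Ω, MeasurableSet A → ∀ g ∈ 𝓔.H,
    (∀ ω, A.indicator (fun _ => (1 : ℝ)) ω ≤ g ω) → (V A : EReal) ≤ 𝓔.E g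

/-- The largest upper capacity, `inf {E[ξ] : 1_A ≤ ξ, ξ ∈ H}`. The expectations occurring here are
nonnegative, so that `EReal.toENNReal` only changes their type. -/
def upCap (A : Set Ω) : ℝ≥0∞ :=
  ⨅ (ξ : Ω → ℝ) (_ : ξ ∈ 𝓔.H) (_ : ∀ ω, A.indicator (fun _ => (1 : ℝ)) ω ≤ ξ ω),
    (𝓔.E ξ).toENNReal

/-- The countably sub-additive extension of `upCap`:
`inf {∑ₙ upCap(Aₙ) : A ⊆ ⋃ₙ Aₙ, Aₙ measurable}`. -/
def outCap (A : Set Ω) : ℝ≥0∞ :=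
  ⨅ (B : ℕ → Set Ω) (_ : ∀ n, MeasurableSet (B n)) (_ : A ⊆ ⋃ n, B n), ∑' n, 𝓔.upCap (B n)

end SublinearExpectationSpace

/-- The truncated logarithm `log x = ln (max e x)`. -/
def tlog (x : ℝ) : ℝ := Real.log (max (Real.exp 1) x)

/-- The partial sums `S_n = X_1 + ⋯ + X_n`. -/
def partialSum {Ω : Type*} (X : ℕ → Ω → ℝ) (n : ℕ) (ω : Ω) : ℝ :=
  ∑ k ∈ Finset.Icc 1 n, X k ω

namespace SublinearExpectationSpace

variable {Ω : Type*} [MeasurableSpace Ω] (𝓔 : SublinearExpectationSpace Ω) (X : ℕ → Ω → ℝ)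

/-- `s_n² = ∑_{k=1}^n E[X_k²]`, for variables with finite `E[X_k²]`. -/
def sSq (n : ℕ) : ℝ := ∑ k ∈ Finset.Icc 1 n, (𝓔.E (fun ω => X k ω ^ 2)).toReal

/-- `s_n`. -/
def sd (n : ℕ) : ℝ := Real.sqrt (𝓔.sSq X n)

/-- `t_n = √(2 log log s_n²)`. -/
def tn (n : ℕ) : ℝ := Real.sqrt (2 * tlog (tlog (𝓔.sSq X n)))

/-- `a_n = s_n t_n`. -/
def an (n : ℕ) : ℝ := 𝓔.sd X n * 𝓔.tn X n

/-- `E[((|X_j| - α s_n / t_n)⁺)^p]`, possibly infinite. -/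
def excess (p α : ℝ) (n j : ℕ) : ℝ≥0∞ :=
  (𝓔.E (fun ω => (max (|X j ω| - α * 𝓔.sd X n / 𝓔.tn X n) 0) ^ p)).toENNReal

/-- `Γ_n(p, α)`. -/
def Gam (p α : ℝ) (n : ℕ) : ℝ≥0∞ := 𝓔.excess X p α n n

/-- `Λ_n(p, α)`. -/
def Lam (p α : ℝ) (n : ℕ) : ℝ≥0∞ := ∑ j ∈ Finset.Icc 1 n, 𝓔.excess X p α n j

end SublinearExpectationSpace

end

/-! The only probabilistic tool is peeling: a bounded Lipschitz function of `X 1, …, X (n + 1)` is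
integrated by first freezing the past and taking the upper expectation of the last variable
(`IndepSeq.step_le`, `IndepSeq.step_ge`). No measure is available, so stopping times are replaced by
Lipschitz ramps and changes of measure by linear combinations of exponentials.

Time is cut where the variance `s_n²` crosses the powers `D ^ k`. Variables are truncated from above
at a small multiple of `amp (D ^ k)`, and a second order expansion gives exponential moments `1 + h
E[X] + h² E[X²] / 2` up to an error governed by the excess moments in (ii). Over block `k` these
errors add up to a multiple of a number `q k`, and (ii) says exactly that `∑ q k ^ (d + 1)`
converges (`tsum_excess_lt_top`, `exists_expMoment`). The means are negligible by (iv).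

Upper half: a maximal inequality for products (`IndepSeq.upCap_max_prod_le`) gives a Chernoff bound
for the maximum over a block. With the exponent as large as `q k` permits, the bound is at most a
constant times `k ^ (-(1 + ε)) + q k ^ (d + 1)`, hence summable (`exists_summable_block_bound`).
Condition (i) pays for removing the truncation, which yields a countable cover of the deviations by
sets of small total capacity (`exists_cover`). The finite-horizon statement and the limsup statement
both follow from this cover.

Lower half: with `s` the tilted truncated block sum and `T = h² v`, where `v` is the variance at the
end of the block, the indicator of `s` lying near `T` dominates a multiple of `e ^ s` minus
multiples of `e ^ ((1 - γ) s)` and `e ^ ((1 + γ) s)`. Each exponential is a product, so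
sub-linearity bounds the upper expectation from below by about `e ^ (-T / 2)` (`exists_blockLower`).
Success bounds of successive blocks combine into `1 - ∏ (1 - e i)` (`BlockLower.prod`). Condition
(iii) forces `∑ e i = ∞` (`not_summable_nonempty_blocks`, `exists_blocks`), so the upper capacity of
some success tends to one. Blocks are spaced so that the sum preceding each is negligible, by the
upper half. The hypotheses are invariant under `X ↦ -X`, which gives the other sign. -/

noncomputable section

/-! ### Real-valued calculus of the sub-linear expectation and of the capacity `upCap`. -/

namespace SublinearExpectationSpace

variable {Ω : Type*} [MeasurableSpace Ω] (𝓔 : SublinearExpectationSpace Ω)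

/-- The random variables with finite absolute expectation. -/
def IsL1 (f : Ω → ℝ) : Prop := f ∈ 𝓔.H ∧ 𝓔.E (fun ω => |f ω|) < ⊤

/-- The real value of the sub-linear expectation. -/
def ex (f : Ω → ℝ) : ℝ := (𝓔.E f).toReal

variable {𝓔}

theorem comp_mem_one {X : Ω → ℝ} (hX : X ∈ 𝓔.H) {φ : ℝ → ℝ} (hφ : IsLocLip φ) :
    (fun ω => φ (X ω)) ∈ 𝓔.H := by
  obtain ⟨C, hC, m, h⟩ := hφ
  refine 𝓔.comp_mem 1 (fun _ => X) (fun _ => hX) (fun z => φ (z 0)) ⟨C, hC, m, fun x y => ?_⟩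
  refine (h _ _).trans ?_
  have h1 : ‖x 0‖ ≤ ‖x‖ := norm_le_pi_norm x 0
  have h2 : ‖y 0‖ ≤ ‖y‖ := norm_le_pi_norm y 0
  have h3 : ‖x 0 - y 0‖ ≤ ‖x - y‖ := norm_le_pi_norm (x - y) 0
  gcongr

theorem isLocLip_of_lipschitz {F : Type*} [SeminormedAddCommGroup F] {φ : F → ℝ} {C : ℝ}
    (hC : 0 ≤ C) (h : ∀ x y, |φ x - φ y| ≤ C * ‖x - y‖) : IsLocLip φ := by
  refine ⟨C + 1, by positivity, 0, fun x y => (h x y).trans ?_⟩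
  have := norm_nonneg (x - y)
  simp only [pow_zero]
  nlinarith

theorem isLocLip_abs : IsLocLip (fun x : ℝ => |x|) :=
  isLocLip_of_lipschitz zero_le_one fun x y => by simpa using abs_abs_sub_abs_le_abs_sub x y

theorem isLocLip_sq : IsLocLip (fun x : ℝ => x ^ 2) := by
  refine ⟨1, one_pos, 1, fun x y => ?_⟩
  have : x ^ 2 - y ^ 2 = (x + y) * (x - y) := by ring
  rw [this, abs_mul, Real.norm_eq_abs, Real.norm_eq_abs, Real.norm_eq_abs]
  gcongr
  have := abs_add_le x y
  simp only [pow_one]; linarith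

/-- Bernoulli's inequality gives `u ^ p - v ^ p ≤ p u ^ (p - 1) (u - v)` for `0 ≤ v ≤ u`, and
rounding `p - 1` up to a natural number makes the growth polynomial. This puts the excess variables
into `H`. -/
theorem isLocLip_excess_rpow {p : ℝ} (hp : 1 ≤ p) (b : ℝ) :
    IsLocLip (fun x : ℝ => (max (|x| - b) 0) ^ p) := by
  have key : ∀ u v : ℝ, 0 ≤ v → v ≤ u → |u ^ p - v ^ p| ≤ p * u ^ (p - 1) * (u - v) := by
    intro u v hv huv
    rw [abs_of_nonneg (sub_nonneg.2 (Real.rpow_le_rpow hv huv (by linarith)))]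
    rcases hv.eq_or_lt with rfl | hv'
    · rcases huv.eq_or_lt with rfl | hu
      · simp
      rw [Real.zero_rpow (by linarith), mul_assoc, sub_zero, sub_zero, ← Real.rpow_add_one hu.ne']
      have := Real.rpow_nonneg hu.le p
      simp; nlinarith
    have hu : 0 < u := hv'.trans_le huv
    have hb := one_add_mul_self_le_rpow_one_add (s := v / u - 1)
      (by have : 0 ≤ v / u := by positivity
          linarith) hp
    rw [add_sub_cancel, Real.div_rpow hv hu.le, le_div_iff₀ (Real.rpow_pos_of_pos hu p)] at hb
    have h1 : u ^ p = u ^ (p - 1) * u := by rw [← Real.rpow_add_one hu.ne']; simp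
    have h2 : (1 + p * (v / u - 1)) * u ^ p = u ^ p - p * u ^ (p - 1) * (u - v) := by
      rw [h1]; field_simp; ring
    linarith
  have key2 : ∀ u v : ℝ, 0 ≤ u → 0 ≤ v →
      |u ^ p - v ^ p| ≤ p * (max u v) ^ (p - 1) * |u - v| := by
    intro u v hu hv
    rcases le_total v u with h | h
    · rw [max_eq_left h, abs_of_nonneg (sub_nonneg.2 h)]; exact key u v hv h
    · rw [max_eq_right h, abs_sub_comm, abs_sub_comm u v, abs_of_nonneg (sub_nonneg.2 h)]
      exact key v u hu h
  obtain ⟨m, hm⟩ := exists_nat_ge (p - 1)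
  refine ⟨p * (2 ^ m * (1 + |b|) ^ m), by positivity, m, fun x y => ?_⟩
  refine (key2 _ _ (le_max_right _ _) (le_max_right _ _)).trans ?_
  rw [Real.norm_eq_abs, Real.norm_eq_abs, Real.norm_eq_abs]
  have hw : ∀ z : ℝ, max (|z| - b) 0 ≤ |b| + |z| := fun z =>
    max_le (by have := neg_abs_le b; linarith) (by positivity)
  have hl : |max (|x| - b) 0 - max (|y| - b) 0| ≤ |x - y| :=
    (abs_max_sub_max_le_abs _ _ _).trans (by simpa using abs_abs_sub_abs_le_abs_sub x y)
  refine mul_le_mul ?_ hl (abs_nonneg _) (by positivity)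
  rw [mul_assoc p]
  refine mul_le_mul_of_nonneg_left ?_ (by linarith)
  have h1 : max (max (|x| - b) 0) (max (|y| - b) 0) ≤ (1 + |b|) * (1 + max |x| |y|) := by
    have hM : 0 ≤ max |x| |y| := (abs_nonneg x).trans (le_max_left _ _)
    have h0 := mul_nonneg (abs_nonneg b) hM
    refine max_le ((hw x).trans ?_) ((hw y).trans ?_)
    · nlinarith [le_max_left |x| |y|]
    · nlinarith [le_max_right |x| |y|]
  set M := max |x| |y| with hMdef
  have hM : 0 ≤ M := (abs_nonneg x).trans (le_max_left _ _)
  have h1' : (1:ℝ) ≤ (1 + |b|) * (1 + M) := by nlinarith [abs_nonneg b, mul_nonneg (abs_nonneg b) hM]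
  calc (max (max (|x| - b) 0) (max (|y| - b) 0)) ^ (p - 1)
      ≤ ((1 + |b|) * (1 + M)) ^ (p - 1) := by
        apply Real.rpow_le_rpow _ h1 (by linarith)
        exact (le_max_right (|x| - b) 0).trans (le_max_left _ _)
    _ ≤ ((1 + |b|) * (1 + M)) ^ (m : ℝ) := Real.rpow_le_rpow_of_exponent_le h1' hm
    _ = (1 + |b|) ^ m * (1 + M) ^ m := by rw [Real.rpow_natCast, mul_pow]
    _ ≤ (1 + |b|) ^ m * (2 ^ m * (1 + |x| ^ m + |y| ^ m)) := by
        gcongr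
        have h3 : M ^ m ≤ |x| ^ m + |y| ^ m := by
          rcases max_choice |x| |y| with h | h <;> rw [hMdef, h]
          · have : 0 ≤ |y| ^ m := by positivity
            linarith
          · have : 0 ≤ |x| ^ m := by positivity
            linarith
        rcases le_total M 1 with h | h
        · calc (1 + M) ^ m ≤ 2 ^ m := by gcongr; linarith
            _ ≤ 2 ^ m * (1 + |x| ^ m + |y| ^ m) := by
              apply le_mul_of_one_le_right (by positivity)
              have : 0 ≤ |x| ^ m := by positivity
              have : 0 ≤ |y| ^ m := by positivity
              linarith
        · calc (1 + M) ^ m ≤ (2 * M) ^ m := by gcongr; linarith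
            _ = 2 ^ m * M ^ m := mul_pow _ _ _
            _ ≤ _ := by gcongr; linarith
    _ = _ := by ring

theorem abs_mem {f : Ω → ℝ} (hf : f ∈ 𝓔.H) : (fun ω => |f ω|) ∈ 𝓔.H :=
  comp_mem_one hf isLocLip_abs

theorem const_mem (c : ℝ) : (fun _ : Ω => c) ∈ 𝓔.H :=
  𝓔.comp_mem 0 (fun i => i.elim0) (fun i => i.elim0) (fun _ => c)
    (isLocLip_of_lipschitz zero_le_one (by simp))

theorem E_nonneg {f : Ω → ℝ} (hf : f ∈ 𝓔.H) (h : ∀ ω, 0 ≤ f ω) : 0 ≤ 𝓔.E f := by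
  simpa [𝓔.const] using 𝓔.mono f hf _ (const_mem 0) h

namespace IsL1

variable {f g : Ω → ℝ}

theorem mem (hf : 𝓔.IsL1 f) : f ∈ 𝓔.H := hf.1

theorem of_le (hf : f ∈ 𝓔.H) (hg : g ∈ 𝓔.H) (hgt : 𝓔.E g < ⊤) (h : ∀ ω, |f ω| ≤ g ω) :
    𝓔.IsL1 f :=
  ⟨hf, (𝓔.mono g hg _ (abs_mem hf) h).trans_lt hgt⟩

theorem const (c : ℝ) : 𝓔.IsL1 (fun _ => c) :=
  ⟨const_mem c, by rw [𝓔.const]; exact EReal.coe_lt_top _⟩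

theorem of_bdd (hf : f ∈ 𝓔.H) {C : ℝ} (h : ∀ ω, |f ω| ≤ C) : 𝓔.IsL1 f :=
  of_le hf (const_mem C) (by rw [𝓔.const]; exact EReal.coe_lt_top _) h

theorem abs (hf : 𝓔.IsL1 f) : 𝓔.IsL1 (fun ω => |f ω|) :=
  of_le (abs_mem hf.1) (abs_mem hf.1) hf.2 (by simp)

theorem neg (hf : 𝓔.IsL1 f) : 𝓔.IsL1 (fun ω => -f ω) :=
  of_le (𝓔.H.neg_mem hf.1) (abs_mem hf.1) hf.2 (by simp)

theorem add (hf : 𝓔.IsL1 f) (hg : 𝓔.IsL1 g) : 𝓔.IsL1 (fun ω => f ω + g ω) := by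
  have hf' := E_nonneg (abs_mem hf.1) (fun _ => abs_nonneg _)
  have hg' := E_nonneg (abs_mem hg.1) (fun _ => abs_nonneg _)
  refine of_le (𝓔.H.add_mem hf.1 hg.1) (𝓔.H.add_mem (abs_mem hf.1) (abs_mem hg.1)) ?_
    (fun _ => abs_add_le _ _)
  refine (𝓔.subadd _ (abs_mem hf.1) _ (abs_mem hg.1) (fun h => ?_) (fun h => ?_)).trans_lt
    (EReal.add_lt_top hf.2.ne hg.2.ne)
  · rw [h.2] at hg'; simp at hg'
  · rw [h.1] at hf'; simp at hf'

theorem const_mul (hf : 𝓔.IsL1 f) (r : ℝ) : 𝓔.IsL1 (fun ω => r * f ω) := by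
  refine of_le (g := fun ω => |r| * |f ω|) (𝓔.H.smul_mem r hf.1)
    (𝓔.H.smul_mem |r| (abs_mem hf.1)) ?_ (fun _ => (abs_mul _ _).le)
  rw [𝓔.pos_homog _ (abs_mem hf.1) _ (abs_nonneg r)]
  have hf' := E_nonneg (abs_mem hf.1) (fun _ => abs_nonneg _)
  lift 𝓔.E (fun ω => |f ω|) to ℝ using ⟨hf.2.ne, fun h => by rw [h] at hf'; simp at hf'⟩ with z
  rw [← EReal.coe_mul]; exact EReal.coe_lt_top _

theorem sub (hf : 𝓔.IsL1 f) (hg : 𝓔.IsL1 g) : 𝓔.IsL1 (fun ω => f ω - g ω) := by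
  simpa only [sub_eq_add_neg] using hf.add hg.neg

theorem lt_top (hf : 𝓔.IsL1 f) : 𝓔.E f < ⊤ :=
  (𝓔.mono _ (abs_mem hf.1) f hf.1 (fun _ => le_abs_self _)).trans_lt hf.2

/-- Otherwise `0 = E[f + (-f)] ≤ E[f] + E[-f] = -∞`, because `E[-f]` is not `+∞`. -/
theorem ne_bot (hf : 𝓔.IsL1 f) : 𝓔.E f ≠ ⊥ := by
  intro h
  have h1 := 𝓔.subadd f hf.1 _ hf.neg.1 (fun h' => by simp [h] at h')
    (fun h' => hf.neg.lt_top.ne h'.2)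
  have h2 := 𝓔.const 0
  simp only [add_neg_cancel, h, EReal.bot_add] at h1
  rw [h2] at h1
  simp at h1

theorem coe_ex (hf : 𝓔.IsL1 f) : (𝓔.ex f : EReal) = 𝓔.E f :=
  EReal.coe_toReal hf.lt_top.ne hf.ne_bot

theorem ex_mono (hf : 𝓔.IsL1 f) (hg : 𝓔.IsL1 g) (h : ∀ ω, f ω ≤ g ω) : 𝓔.ex f ≤ 𝓔.ex g := by
  have := 𝓔.mono g hg.1 f hf.1 h
  rwa [← hf.coe_ex, ← hg.coe_ex, EReal.coe_le_coe_iff] at this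

theorem ex_add_le (hf : 𝓔.IsL1 f) (hg : 𝓔.IsL1 g) :
    𝓔.ex (fun ω => f ω + g ω) ≤ 𝓔.ex f + 𝓔.ex g := by
  have := 𝓔.subadd f hf.1 g hg.1 (fun h => hf.lt_top.ne h.1) (fun h => hg.lt_top.ne h.2)
  rwa [← hf.coe_ex, ← hg.coe_ex, ← (hf.add hg).coe_ex, ← EReal.coe_add, EReal.coe_le_coe_iff]
    at this

theorem ex_const_mul (hf : 𝓔.IsL1 f) {r : ℝ} (hr : 0 ≤ r) :
    𝓔.ex (fun ω => r * f ω) = r * 𝓔.ex f := by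
  have := 𝓔.pos_homog f hf.1 r hr
  rwa [← hf.coe_ex, ← (hf.const_mul r).coe_ex, ← EReal.coe_mul, EReal.coe_eq_coe_iff] at this

theorem ex_sub_le (hf : 𝓔.IsL1 f) (hg : 𝓔.IsL1 g) :
    𝓔.ex f - 𝓔.ex g ≤ 𝓔.ex (fun ω => f ω - g ω) := by
  have := (hf.sub hg).ex_add_le hg
  simp only [sub_add_cancel] at this
  linarith

end IsL1

theorem ex_const (c : ℝ) : 𝓔.ex (fun _ => c) = c := by
  simp [ex, 𝓔.const]

theorem ex_nonneg {f : Ω → ℝ} (hf : 𝓔.IsL1 f) (h : ∀ ω, 0 ≤ f ω) : 0 ≤ 𝓔.ex f := by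
  simpa [ex_const] using (IsL1.const 0).ex_mono hf h

/-- Sub-additivity is an equality for constants, since adding `c` can be undone by adding `-c`. -/
theorem ex_const_add {f : Ω → ℝ} (hf : 𝓔.IsL1 f) (c : ℝ) :
    𝓔.ex (fun ω => c + f ω) = c + 𝓔.ex f := by
  apply le_antisymm
  · simpa [ex_const] using (IsL1.const c).ex_add_le hf
  · have := ((IsL1.const c).add hf).ex_add_le (IsL1.const (-c))
    simp only [ex_const, add_neg_cancel_comm] at this
    change 𝓔.ex f ≤ _ at this
    linarith

/-- Contraction in the uniform norm, from monotonicity and translation by `C`. It keeps functions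
Lipschitz after a variable has been integrated out. -/
theorem abs_ex_sub_le {f g : Ω → ℝ} (hf : 𝓔.IsL1 f) (hg : 𝓔.IsL1 g) {C : ℝ}
    (h : ∀ ω, |f ω - g ω| ≤ C) : |𝓔.ex f - 𝓔.ex g| ≤ C := by
  have h1 : 𝓔.ex f ≤ 𝓔.ex (fun ω => C + g ω) := hf.ex_mono ((IsL1.const C).add hg)
    (fun ω => by linarith [(abs_le.1 (h ω)).2])
  have h2 : 𝓔.ex g ≤ 𝓔.ex (fun ω => C + f ω) := hg.ex_mono ((IsL1.const C).add hf)
    (fun ω => by linarith [(abs_le.1 (h ω)).1])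
  rw [ex_const_add hg] at h1
  rw [ex_const_add hf] at h2
  rw [abs_le]; constructor <;> linarith

theorem sq_isL1 {X : Ω → ℝ} (hX : X ∈ 𝓔.H) (h : 𝓔.E (fun ω => X ω ^ 2) < ⊤) :
    𝓔.IsL1 (fun ω => X ω ^ 2) :=
  IsL1.of_le (comp_mem_one hX isLocLip_sq) (comp_mem_one hX isLocLip_sq) h (by simp)

theorem isL1_of_sq {X : Ω → ℝ} (hX : X ∈ 𝓔.H) (h : 𝓔.E (fun ω => X ω ^ 2) < ⊤) :
    𝓔.IsL1 X := by
  have := (IsL1.const 1).add (sq_isL1 hX h)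
  refine IsL1.of_le hX this.1 this.lt_top fun ω => ?_
  rw [abs_le]; constructor <;> nlinarith [sq_nonneg (X ω - 1), sq_nonneg (X ω + 1)]

theorem upCap_mono {A B : Set Ω} (h : A ⊆ B) : 𝓔.upCap A ≤ 𝓔.upCap B := by
  refine le_iInf₂ fun ξ hξ => le_iInf fun h' => ?_
  refine iInf₂_le_of_le ξ hξ (iInf_le_of_le (fun ω => le_trans ?_ (h' ω)) le_rfl)
  exact Set.indicator_le_indicator_of_subset h (fun _ => zero_le_one) ω

theorem upCap_le_ofReal {A : Set Ω} {ξ : Ω → ℝ} (hξ : 𝓔.IsL1 ξ) (h0 : ∀ ω, 0 ≤ ξ ω)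
    (h : ∀ ω ∈ A, 1 ≤ ξ ω) : 𝓔.upCap A ≤ ENNReal.ofReal (𝓔.ex ξ) := by
  refine iInf₂_le_of_le ξ hξ.1 (iInf_le_of_le (fun ω => ?_) ?_)
  · by_cases hω : ω ∈ A
    · simpa [hω] using h ω hω
    · simpa [hω] using h0 ω
  · rw [← hξ.coe_ex]; simp

theorem upCap_le_one (A : Set Ω) : 𝓔.upCap A ≤ 1 := by
  simpa [ex_const] using upCap_le_ofReal (A := A) (𝓔 := 𝓔) (IsL1.const 1) (by simp) (by simp)

theorem upCap_empty : 𝓔.upCap ∅ = 0 := by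
  simpa [ex_const] using upCap_le_ofReal (A := ∅) (𝓔 := 𝓔) (IsL1.const 0) (by simp) (by simp)

theorem upCap_union_le (A B : Set Ω) : 𝓔.upCap (A ∪ B) ≤ 𝓔.upCap A + 𝓔.upCap B := by
  conv_rhs => rw [upCap, upCap]
  simp only [ENNReal.iInf_add, ENNReal.add_iInf, le_iInf_iff]
  intro ζ hζ h2 ξ hξ h1
  have p1 : ∀ ω, 0 ≤ ξ ω := fun ω => (Set.indicator_nonneg (by simp) ω).trans (h1 ω)
  have p2 : ∀ ω, 0 ≤ ζ ω := fun ω => (Set.indicator_nonneg (by simp) ω).trans (h2 ω)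
  have e1 := E_nonneg hξ p1
  have e2 := E_nonneg hζ p2
  refine iInf₂_le_of_le (fun ω => ξ ω + ζ ω) (𝓔.H.add_mem hξ hζ) (iInf_le_of_le (fun ω => ?_) ?_)
  · have a1 := h1 ω
    have a2 := h2 ω
    have b1 := p1 ω
    have b2 := p2 ω
    by_cases hA : ω ∈ A <;> by_cases hB : ω ∈ B <;> simp [hA, hB] at a1 a2 ⊢ <;> linarith
  · rw [← EReal.toENNReal_add e1 e2]
    refine EReal.toENNReal_le_toENNReal (𝓔.subadd _ hξ _ hζ (fun h => ?_) (fun h => ?_))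
    · rw [h.2] at e2; simp at e2
    · rw [h.1] at e1; simp at e1

theorem upCap_biUnion_le {ι : Type*} (s : Finset ι) (A : ι → Set Ω) :
    𝓔.upCap (⋃ i ∈ s, A i) ≤ ∑ i ∈ s, 𝓔.upCap (A i) := by
  classical
  induction s using Finset.induction_on with
  | empty => simp [upCap_empty]
  | insert a s ha ih =>
    rw [Finset.set_biUnion_insert, Finset.sum_insert ha]
    exact (upCap_union_le _ _).trans (by gcongr)

theorem IsUpperCapacity.le_upCap {V : Set Ω → ℝ} (hV : 𝓔.IsUpperCapacity V) {A : Set Ω}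
    (hA : MeasurableSet A) : ENNReal.ofReal (V A) ≤ 𝓔.upCap A := by
  refine le_iInf₂ fun ξ hξ => le_iInf fun h => ?_
  have := EReal.toENNReal_le_toENNReal (hV.le_of_indicator_le A hA ξ hξ h)
  simpa using this

end SublinearExpectationSpace

/-! ### Bounded Lipschitz cylinder functions and peeling off the last variable. -/

/-- Bounded functions of a sequence that are Lipschitz in the coordinates `1, …, n` and do not
depend on the others. -/
def CylBL (n : ℕ) (F : (ℕ → ℝ) → ℝ) : Prop :=
  ∃ C : ℝ, 0 ≤ C ∧ (∀ x, |F x| ≤ C) ∧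
    ∀ x y, |F x - F y| ≤ C * ∑ j ∈ Finset.Icc 1 n, |x j - y j|

/-- Bounded Lipschitz functions on the line. -/
def BddLip (f : ℝ → ℝ) : Prop := ∃ C : ℝ, 0 ≤ C ∧ (∀ x, |f x| ≤ C) ∧ ∀ x y, |f x - f y| ≤ C * |x - y|

namespace CylBL

variable {n m : ℕ} {F G : (ℕ → ℝ) → ℝ}

theorem const (n : ℕ) (c : ℝ) : CylBL n (fun _ => c) :=
  ⟨|c|, abs_nonneg c, fun _ => le_rfl, fun x y => by
    rw [sub_self, abs_zero]; positivity⟩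

theorem mono (hF : CylBL n F) (h : n ≤ m) : CylBL m F := by
  obtain ⟨C, hC, hb, hl⟩ := hF
  refine ⟨C, hC, hb, fun x y => (hl x y).trans ?_⟩
  gcongr

theorem add (hF : CylBL n F) (hG : CylBL n G) : CylBL n (fun x => F x + G x) := by
  obtain ⟨C, hC, hb, hl⟩ := hF
  obtain ⟨D, hD, hb', hl'⟩ := hG
  refine ⟨C + D, by positivity, fun x => (abs_add_le _ _).trans (add_le_add (hb x) (hb' x)),
    fun x y => ?_⟩
  have : F x + G x - (F y + G y) = (F x - F y) + (G x - G y) := by ring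
  rw [this, add_mul]
  exact (abs_add_le _ _).trans (add_le_add (hl x y) (hl' x y))

theorem mul (hF : CylBL n F) (hG : CylBL n G) : CylBL n (fun x => F x * G x) := by
  obtain ⟨C, hC, hb, hl⟩ := hF
  obtain ⟨D, hD, hb', hl'⟩ := hG
  refine ⟨C * D + C * D, by positivity, fun x => ?_, fun x y => ?_⟩
  · rw [abs_mul]
    have := mul_le_mul (hb x) (hb' x) (abs_nonneg _) hC
    have := mul_nonneg hC hD
    linarith
  · have : F x * G x - F y * G y = F x * (G x - G y) + (F x - F y) * G y := by ring
    rw [this]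
    refine (abs_add_le _ _).trans ?_
    rw [abs_mul, abs_mul]
    have h1 := mul_le_mul (hb x) (hl' x y) (abs_nonneg _) hC
    have h2 := mul_le_mul (hl x y) (hb' y) (abs_nonneg _) (by positivity)
    linarith

theorem const_mul (hF : CylBL n F) (c : ℝ) : CylBL n (fun x => c * F x) := (const n c).mul hF

theorem sub (hF : CylBL n F) (hG : CylBL n G) : CylBL n (fun x => F x - G x) := by
  have := hF.add (hG.const_mul (-1))
  simpa only [neg_one_mul, ← sub_eq_add_neg] using this

theorem one_sub (hF : CylBL n F) : CylBL n (fun x => 1 - F x) := (const n 1).sub hF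

theorem prod {ι : Type*} (s : Finset ι) {F : ι → (ℕ → ℝ) → ℝ} (h : ∀ i ∈ s, CylBL n (F i)) :
    CylBL n (fun x => ∏ i ∈ s, F i x) := by
  classical
  induction s using Finset.induction_on with
  | empty => simpa using const n 1
  | insert a s ha ih =>
    simp only [Finset.prod_insert ha]
    exact (h a (by simp)).mul (ih fun i hi => h i (by simp [hi]))

theorem comp {f : ℝ → ℝ} (hf : BddLip f) (hF : CylBL n F) : CylBL n (fun x => f (F x)) := by
  obtain ⟨C, hC, hb, hl⟩ := hF
  obtain ⟨D, hD, hb', hl'⟩ := hf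
  refine ⟨D + D * C, by positivity, fun x => (hb' _).trans ?_, fun x y => (hl' _ _).trans ?_⟩
  · have := mul_nonneg hD hC
    linarith
  · have h1 := mul_le_mul_of_nonneg_left (hl x y) hD
    have h2 : 0 ≤ D * ∑ j ∈ Finset.Icc 1 n, |x j - y j| := by positivity
    linarith

theorem coord {f : ℝ → ℝ} (hf : BddLip f) {j : ℕ} (hj : j ∈ Finset.Icc 1 n) :
    CylBL n (fun x => f (x j)) := by
  obtain ⟨D, hD, hb', hl'⟩ := hf
  refine ⟨D, hD, fun x => hb' _, fun x y => (hl' _ _).trans ?_⟩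
  gcongr
  exact Finset.single_le_sum (f := fun j => |x j - y j|) (fun _ _ => abs_nonneg _) hj

theorem congr (hF : CylBL n F) {x y : ℕ → ℝ} (h : ∀ j, 1 ≤ j → j ≤ n → x j = y j) :
    F x = F y := by
  obtain ⟨C, hC, hb, hl⟩ := hF
  have := hl x y
  rw [Finset.sum_eq_zero, mul_zero] at this
  · exact sub_eq_zero.1 (abs_eq_zero.1 (le_antisymm this (abs_nonneg _)))
  · intro j hj
    rw [Finset.mem_Icc] at hj
    rw [h j hj.1 hj.2, sub_self, abs_zero]

end CylBL

/-- A vector of length `n`, as a sequence with entries at `1, …, n`. -/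
def seqOfFin {n : ℕ} (z : Fin n → ℝ) (j : ℕ) : ℝ :=
  if h : 1 ≤ j ∧ j ≤ n then z ⟨j - 1, by omega⟩ else 0

theorem abs_seqOfFin_sub_le {n : ℕ} (z w : Fin n → ℝ) (j : ℕ) :
    |seqOfFin z j - seqOfFin w j| ≤ ‖z - w‖ := by
  unfold seqOfFin
  split_ifs with h
  · exact norm_le_pi_norm (z - w) _
  · simp

theorem seqOfFin_apply {Ω : Type*} {n : ℕ} (X : ℕ → Ω → ℝ) (ω : Ω) {j : ℕ} (h1 : 1 ≤ j) (h2 : j ≤ n) :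
    seqOfFin (fun i : Fin n => X (i + 1) ω) j = X j ω := by
  simp [seqOfFin, h1, h2]

theorem CylBL.comp_seq {Ω : Type*} {n : ℕ} {F : (ℕ → ℝ) → ℝ} (hF : CylBL n F) (X : ℕ → Ω → ℝ) (ω : Ω) :
    F (seqOfFin (fun i : Fin n => X (i + 1) ω)) = F (fun j => X j ω) :=
  hF.congr fun _ h1 h2 => seqOfFin_apply X ω h1 h2

theorem CylBL.isLocLip {n : ℕ} {F : (ℕ → ℝ) → ℝ} (hF : CylBL n F) :
    IsLocLip (fun z : Fin n → ℝ => F (seqOfFin z)) := by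
  obtain ⟨C, hC, hb, hl⟩ := hF
  refine SublinearExpectationSpace.isLocLip_of_lipschitz (C := C * n) (by positivity) fun x y => ?_
  refine (hl _ _).trans ?_
  rw [mul_assoc]
  gcongr
  refine (Finset.sum_le_card_nsmul _ _ _ fun j _ => abs_seqOfFin_sub_le x y j).trans ?_
  simp

theorem CylBL.isLocLip_prod {n : ℕ} {F : (ℕ → ℝ) → ℝ} (hF : CylBL (n + 1) F) :
    IsLocLip (fun z : (Fin n → ℝ) × (Fin 1 → ℝ) =>
      F (Function.update (seqOfFin z.1) (n + 1) (z.2 0))) := by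
  obtain ⟨C, hC, hb, hl⟩ := hF
  refine SublinearExpectationSpace.isLocLip_of_lipschitz (C := C * (n + 1)) (by positivity)
    fun x y => ?_
  refine (hl _ _).trans ?_
  rw [mul_assoc]
  gcongr
  refine (Finset.sum_le_card_nsmul _ _ ‖x - y‖ fun j _ => ?_).trans ?_
  · by_cases h : j = n + 1
    · subst h
      simp only [Function.update_self]
      exact (norm_le_pi_norm (x.2 - y.2) 0).trans (norm_snd_le (x - y))
    · simp only [Function.update_of_ne h]
      exact (abs_seqOfFin_sub_le _ _ _).trans (norm_fst_le (x - y))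
  · simp

namespace SublinearExpectationSpace

variable {Ω : Type*} [MeasurableSpace Ω] {𝓔 : SublinearExpectationSpace Ω} {X : ℕ → Ω → ℝ}
  {n : ℕ} {F G : (ℕ → ℝ) → ℝ}

theorem _root_.CylBL.isL1 (hF : CylBL n F) (hX : ∀ n, 1 ≤ n → X n ∈ 𝓔.H) :
    𝓔.IsL1 (fun ω => F (fun j => X j ω)) := by
  have h := 𝓔.comp_mem n (fun i => X (i + 1)) (fun i => hX _ (by omega)) _ hF.isLocLip
  simp only [hF.comp_seq X] at h
  obtain ⟨C, -, hb, -⟩ := hF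
  exact IsL1.of_bdd h (fun ω => hb _)

theorem _root_.BddLip.isL1 {f : ℝ → ℝ} (hf : BddLip f) {Y : Ω → ℝ} (hY : Y ∈ 𝓔.H) :
    𝓔.IsL1 (fun ω => f (Y ω)) := by
  obtain ⟨C, hC, hb, hl⟩ := hf
  exact IsL1.of_bdd (comp_mem_one hY (isLocLip_of_lipschitz hC hl)) (fun ω => hb _)

theorem bddLip_update (hF : CylBL n F) (x : ℕ → ℝ) {m : ℕ} :
    BddLip (fun u => F (Function.update x m u)) := by
  obtain ⟨C, hC, hb, hl⟩ := hF
  refine ⟨C, hC, fun u => hb _, fun u v => (hl _ _).trans ?_⟩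
  gcongr
  refine (Finset.sum_le_sum (g := fun j => if j = m then |u - v| else 0) fun j _ => ?_).trans ?_
  · by_cases h : j = m
    · subst h; simp
    · simp [h]
  · rw [Finset.sum_ite_eq']
    split_ifs <;> simp

/-- Integrating out the last variable. -/
theorem IndepSeq.ex_eq (hind : 𝓔.IndepSeq X) (hX : ∀ n, 1 ≤ n → X n ∈ 𝓔.H) (hn : 1 ≤ n)
    (hF : CylBL (n + 1) F) :
    CylBL n (fun x => 𝓔.ex (fun ω => F (Function.update x (n + 1) (X (n + 1) ω)))) ∧
    𝓔.ex (fun ω => F (fun j => X j ω)) = 𝓔.ex (fun ω =>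
      𝓔.ex (fun ω' => F (Function.update (fun j => X j ω) (n + 1) (X (n + 1) ω')))) := by
  have hmem := hX (n + 1) (by omega)
  have gen : ∀ {K : (ℕ → ℝ) → ℝ}, CylBL (n + 1) K →
      CylBL n (fun x => 𝓔.ex (fun ω => K (Function.update x (n + 1) (X (n + 1) ω)))) := by
    intro K hK
    have hL := fun x => (bddLip_update hK x (m := n + 1)).isL1 hmem
    obtain ⟨C, hC, hb, hl⟩ := hK
    refine ⟨C, hC, fun x => ?_, fun x y => ?_⟩
    · simpa [ex_const] using abs_ex_sub_le (hL x) (IsL1.const 0) (C := C)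
        (fun ω => by simpa using hb _)
    · refine abs_ex_sub_le (hL x) (hL y) fun ω => (hl _ _).trans ?_
      gcongr
      rw [Finset.sum_Icc_succ_top (by omega)]
      simp only [Function.update_self, sub_self, abs_zero, add_zero]
      refine (Finset.sum_congr rfl fun j hj => ?_).le
      rw [Finset.mem_Icc] at hj
      rw [Function.update_of_ne (by omega), Function.update_of_ne (by omega)]
  have hA : CylBL (n + 1) (fun x => |F x|) := by
    obtain ⟨C, hC, hb, hl⟩ := hF
    exact ⟨C, hC, fun x => by simpa using hb x,
      fun x y => (abs_abs_sub_abs_le_abs_sub _ _).trans (hl x y)⟩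
  refine ⟨gen hF, ?_⟩
  have gF := gen hF
  have gA := gen hA
  have gAA : CylBL n (fun x =>
      |𝓔.ex (fun ω => |F (Function.update x (n + 1) (X (n + 1) ω))|)|) := by
    obtain ⟨C, hC, hb, hl⟩ := gA
    exact ⟨C, hC, fun x => by simpa using hb x,
      fun x y => (abs_abs_sub_abs_le_abs_sub _ _).trans (hl x y)⟩
  -- The test function reads coordinates `1, …, n` from the first vector and `n + 1` from the
  -- second. The side goals are the finiteness and membership conditions; they hold because
  -- integrating out `F` or `|F|` leaves a bounded Lipschitz cylinder function.
  have key := hind n hn _ hF.isLocLip_prod (fun x => ?_) ?_ ?_ ?_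
  · have h1 : ∀ ω, F (Function.update (seqOfFin fun i : Fin n => X (i + 1) ω) (n + 1)
        (X (n + 1) ω)) = F (fun j => X j ω) := fun ω => hF.congr fun j h1 h2 => by
      by_cases h : j = n + 1
      · subst h; simp
      · rw [Function.update_of_ne h, seqOfFin_apply X ω h1 (by omega)]
    simp only [h1] at key
    unfold ex
    rw [key]
    congr 2
    funext ω
    exact gF.comp_seq X ω
  · exact ((bddLip_update hA (seqOfFin x) (m := n + 1)).isL1 hmem).lt_top
  · have := (gAA.isL1 hX).1
    simp only [← gAA.comp_seq X] at this
    exact this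
  · have := (gAA.isL1 hX).lt_top
    simp only [← gAA.comp_seq X] at this
    exact this
  · have := (gF.isL1 hX).1
    simp only [← gF.comp_seq X] at this
    exact this

/-- One-step comparison: a pointwise bound on the conditional expectation given the past passes to
the full expectation. For `n = 0` independence says nothing, but `F` then depends on `X 1` alone and
the inner expectation is already the full one. -/
theorem IndepSeq.step (hind : 𝓔.IndepSeq X) (hX : ∀ n, 1 ≤ n → X n ∈ 𝓔.H)
    (hF : CylBL (n + 1) F) (hG : CylBL n G) :
    ((∀ x, 𝓔.ex (fun ω => F (Function.update x (n + 1) (X (n + 1) ω))) ≤ G x) →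
      𝓔.ex (fun ω => F (fun j => X j ω)) ≤ 𝓔.ex (fun ω => G (fun j => X j ω))) ∧
    ((∀ x, G x ≤ 𝓔.ex (fun ω => F (Function.update x (n + 1) (X (n + 1) ω)))) →
      𝓔.ex (fun ω => G (fun j => X j ω)) ≤ 𝓔.ex (fun ω => F (fun j => X j ω))) := by
  rcases Nat.eq_zero_or_pos n with rfl | hn
  · have h1 : ∀ x ω, F (fun j => X j ω) = F (Function.update x (0 + 1) (X (0 + 1) ω)) :=
      fun x ω => hF.congr fun j h1 h2 => by
        obtain rfl : j = 1 := by omega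
        simp
    have h2 : ∀ ω, G (fun j => X j ω) = G 0 := fun ω => hG.congr fun j h1 h2 => by omega
    simp only [h2, ex_const]
    simp only [h1 0]
    exact ⟨fun h => h 0, fun h => h 0⟩
  · obtain ⟨h1, h2⟩ := hind.ex_eq hX hn hF
    rw [h2]
    exact ⟨fun h => (h1.isL1 hX).ex_mono (hG.isL1 hX) fun ω => h _,
      fun h => (hG.isL1 hX).ex_mono (h1.isL1 hX) fun ω => h _⟩

theorem IndepSeq.step_le (hind : 𝓔.IndepSeq X) (hX : ∀ n, 1 ≤ n → X n ∈ 𝓔.H)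
    (hF : CylBL (n + 1) F) (hG : CylBL n G)
    (h : ∀ x, 𝓔.ex (fun ω => F (Function.update x (n + 1) (X (n + 1) ω))) ≤ G x) :
    𝓔.ex (fun ω => F (fun j => X j ω)) ≤ 𝓔.ex (fun ω => G (fun j => X j ω)) :=
  (hind.step hX hF hG).1 h

theorem IndepSeq.step_ge (hind : 𝓔.IndepSeq X) (hX : ∀ n, 1 ≤ n → X n ∈ 𝓔.H)
    (hF : CylBL (n + 1) F) (hG : CylBL n G)
    (h : ∀ x, G x ≤ 𝓔.ex (fun ω => F (Function.update x (n + 1) (X (n + 1) ω)))) :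
    𝓔.ex (fun ω => G (fun j => X j ω)) ≤ 𝓔.ex (fun ω => F (fun j => X j ω)) :=
  (hind.step hX hF hG).2 h

end SublinearExpectationSpace

/-! ### A maximal inequality for products, and lower bounds for success in successive blocks. -/

/-- The piecewise linear function that is `0` below `l / 2` and `1` above `l`. -/
def ramp (l z : ℝ) : ℝ := max 0 (min 1 (2 * z / l - 1))

theorem ramp_nonneg (l z : ℝ) : 0 ≤ ramp l z := le_max_left _ _

theorem ramp_le_one (l z : ℝ) : ramp l z ≤ 1 := max_le zero_le_one (min_le_left _ _)

theorem ramp_eq_one {l z : ℝ} (hl : 0 < l) (h : l ≤ z) : ramp l z = 1 := by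
  have : 1 ≤ z / l := (one_le_div hl).2 h
  have h2 : 1 ≤ 2 * z / l - 1 := by rw [mul_div_assoc]; linarith
  simp [ramp, min_eq_left h2]

theorem ramp_eq_zero {l z : ℝ} (h : 2 * z / l ≤ 1) : ramp l z = 0 :=
  max_eq_left ((min_le_right _ _).trans (by linarith))

theorem bddLip_ramp {l : ℝ} (hl : 0 < l) : BddLip (ramp l) := by
  refine ⟨1 + 2 / l, by positivity, fun x => ?_, fun x y => ?_⟩
  · rw [abs_of_nonneg (ramp_nonneg _ _)]
    have : 0 < 2 / l := by positivity
    linarith [ramp_le_one l x]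
  · unfold ramp
    rw [max_comm, max_comm 0, min_comm, min_comm 1]
    refine (abs_max_sub_max_le_abs _ _ _).trans ((abs_inf_sub_inf_le_abs _ _ _).trans ?_)
    have : 2 * x / l - 1 - (2 * y / l - 1) = 2 / l * (x - y) := by ring
    rw [this, abs_mul, abs_of_pos (by positivity)]
    gcongr
    linarith

theorem prod_Ioc_update {m : ℕ} (ξ : ℕ → ℝ → ℝ) (x : ℕ → ℝ) (u : ℝ) {j : ℕ} (h : m ≤ j) :
    ∏ i ∈ Finset.Ioc m (j + 1), ξ i (Function.update x (j + 1) u i) =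
      (∏ i ∈ Finset.Ioc m j, ξ i (x i)) * ξ (j + 1) u := by
  rw [← Finset.insert_Ioc_right_eq_Ioc_add_one h, Finset.prod_insert (by simp), Function.update_self, mul_comm]
  congr 1
  refine Finset.prod_congr rfl fun i hi => ?_
  rw [Finset.mem_Ioc] at hi
  rw [Function.update_of_ne (by omega)]

namespace SublinearExpectationSpace

variable {Ω : Type*} [MeasurableSpace Ω] {𝓔 : SublinearExpectationSpace Ω} {X : ℕ → Ω → ℝ}
  {m n : ℕ} {F G : (ℕ → ℝ) → ℝ}

/-- Doob's maximal inequality for products of independent variables. -/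
theorem IndepSeq.upCap_max_prod_le (hind : 𝓔.IndepSeq X) (hX : ∀ n, 1 ≤ n → X n ∈ 𝓔.H)
    {ξ : ℕ → ℝ → ℝ} (hξ : ∀ j ∈ Finset.Icc 1 n, BddLip (ξ j))
    (h0 : ∀ j ∈ Finset.Icc 1 n, ∀ u, 0 ≤ ξ j u)
    (h1 : ∀ j ∈ Finset.Icc 1 n, 𝓔.ex (fun ω => ξ j (X j ω)) ≤ 1) {l : ℝ} (hl : 0 < l) :
    𝓔.upCap {ω | ∃ m, 1 ≤ m ∧ m ≤ n ∧ l ≤ ∏ j ∈ Finset.Icc 1 m, ξ j (X j ω)} ≤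
      ENNReal.ofReal (2 / l) := by
  set Z : ℕ → (ℕ → ℝ) → ℝ := fun m x => ∏ j ∈ Finset.Icc 1 m, ξ j (x j) with hZ
  set P : ℕ → (ℕ → ℝ) → ℝ := fun m x => ∏ i ∈ Finset.Icc 1 m, (1 - ramp l (Z i x)) with hP
  have hZcyl : ∀ m ≤ n, CylBL m (Z m) := fun m hm => CylBL.prod _ fun j hj =>
    CylBL.coord (hξ j (Finset.Icc_subset_Icc_right hm hj)) hj
  have hPcyl : ∀ m ≤ n, CylBL m (P m) := fun m hm => CylBL.prod _ fun j hj => by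
    rw [Finset.mem_Icc] at hj
    exact (((hZcyl j (by omega)).comp (bddLip_ramp hl)).one_sub).mono hj.2
  have hZ0 : ∀ m ≤ n, ∀ x, 0 ≤ Z m x := fun m hm x =>
    Finset.prod_nonneg fun j hj => h0 j (Finset.Icc_subset_Icc_right hm hj) _
  have hP0 : ∀ m x, 0 ≤ P m x := fun m x =>
    Finset.prod_nonneg fun j _ => sub_nonneg.2 (ramp_le_one _ _)
  -- `P m` is a Lipschitz substitute for the indicator that no product up to `m` has reached `l`.
  -- The process `1 - P m (1 - 2 Z m / l)` plays the stopped supermartingale: it starts at `2 / l`,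
  -- is nonnegative, and equals `1` once `l` has been reached.
  have hQ : ∀ m ≤ n, CylBL m (fun x => 1 - P m x * (1 - 2 / l * Z m x)) := fun m hm =>
    ((hPcyl m hm).mul ((hZcyl m hm).const_mul _).one_sub).one_sub
  have main : ∀ m ≤ n, 𝓔.ex (fun ω => 1 - P m (fun j => X j ω) *
      (1 - 2 / l * Z m (fun j => X j ω))) ≤ 2 / l := by
    intro m
    induction m with
    | zero =>
      intro _
      simp [hZ, hP, ex_const]
    | succ m ih =>
      intro hm
      refine le_trans (hind.step_le hX (hQ (m + 1) hm) (hQ m (by omega)) fun x => ?_)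
        (ih (by omega))
      have hmem : m + 1 ∈ Finset.Icc 1 n := by simp; omega
      have hZs : ∀ u, Z (m + 1) (Function.update x (m + 1) u) = Z m x * ξ (m + 1) u := by
        intro u
        simp only [hZ]
        rw [Finset.prod_Icc_succ_top (by omega), Function.update_self]
        congr 1
        refine Finset.prod_congr rfl fun j hj => ?_
        rw [Finset.mem_Icc] at hj
        rw [Function.update_of_ne (by omega)]
      have hPs : ∀ u, P (m + 1) (Function.update x (m + 1) u) =
          P m x * (1 - ramp l (Z m x * ξ (m + 1) u)) := by
        intro u
        have : P (m + 1) (Function.update x (m + 1) u) = P m (Function.update x (m + 1) u) *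
          (1 - ramp l (Z (m + 1) (Function.update x (m + 1) u))) := by
          simp only [hP]
          rw [Finset.prod_Icc_succ_top (by omega)]
        rw [this, hZs]
        congr 1
        exact (hPcyl m (by omega)).congr fun j _ hj => Function.update_of_ne (by omega) _ _
      have hL : 𝓔.IsL1 (fun ω => ξ (m + 1) (X (m + 1) ω)) :=
        (hξ _ hmem).isL1 (hX _ (by omega))
      have hL2 := hL.const_mul (P m x * (2 / l * Z m x))
      have hPm := hP0 m x
      have hZm := hZ0 m (by omega) x
      refine (((bddLip_update (hQ (m + 1) hm) x).isL1 (hX (m + 1) (by omega))).ex_mono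
        ((IsL1.const (1 - P m x)).add hL2) fun ω => ?_).trans ?_
      · simp only [hZs, hPs]
        set z := Z m x * ξ (m + 1) (X (m + 1) ω)
        -- The ramp is nonzero only for `z > l / 2`, where `1 - 2 z / l` is negative. Soft stopping
        -- therefore only lowers the process, at the price of the factor `2` in the bound.
        have hr : ramp l z * (1 - 2 / l * z) ≤ 0 := by
          by_cases h : 2 * z / l ≤ 1
          · rw [ramp_eq_zero h, zero_mul]
          · have : 2 / l * z = 2 * z / l := by ring
            exact mul_nonpos_of_nonneg_of_nonpos (ramp_nonneg _ _) (by rw [this]; linarith)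
        have := mul_nonneg hPm (neg_nonneg.2 hr)
        have e : P m x * (2 / l * Z m x) * ξ (m + 1) (X (m + 1) ω) = P m x * (2 / l * z) := by
          simp only [z]; ring
        rw [e]
        nlinarith
      · rw [ex_const_add hL2, hL.ex_const_mul (by positivity)]
        have := mul_le_mul_of_nonneg_left (h1 _ hmem)
          (show 0 ≤ P m x * (2 / l * Z m x) by positivity)
        linarith
  have hZn := hZ0 n le_rfl
  refine (upCap_le_ofReal (ξ := fun ω => 1 - P n (fun j => X j ω) *
      (1 - 2 / l * Z n (fun j => X j ω))) ((hQ n le_rfl).isL1 hX) (fun ω => ?_) ?_).trans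
    (ENNReal.ofReal_le_ofReal (main n le_rfl))
  · have h2 : P n (fun j => X j ω) ≤ 1 := Finset.prod_le_one
      (fun j _ => sub_nonneg.2 (ramp_le_one _ _)) fun j _ => by linarith [ramp_nonneg l (Z j fun j => X j ω)]
    have h3 := hP0 n (fun j => X j ω)
    have h4 : 0 ≤ 2 / l * Z n (fun j => X j ω) := mul_nonneg (by positivity) (hZn _)
    nlinarith [mul_nonneg h3 h4]
  · rintro ω ⟨m, hm1, hmn, hm⟩
    have : P n (fun j => X j ω) = 0 := Finset.prod_eq_zero (i := m) (by simp; omega)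
      (by rw [ramp_eq_one hl hm, sub_self])
    simp [this]

/-- The block `(m, n]` has success function `f` with expectation at least `e`, whatever happened
before the block. -/
def BlockLower (𝓔 : SublinearExpectationSpace Ω) (X : ℕ → Ω → ℝ) (m : ℕ) (f : (ℕ → ℝ) → ℝ)
    (e : ℝ) : Prop :=
  ∀ P : (ℕ → ℝ) → ℝ, CylBL m P → (∀ x, 0 ≤ P x) →
    𝓔.ex (fun ω => 1 - (1 - e) * P (fun j => X j ω)) ≤
      𝓔.ex (fun ω => 1 - (1 - f (fun j => X j ω)) * P (fun j => X j ω))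

/-- If `f` dominates a combination of products with one positive term, integrating the variables
from the last backwards only needs `E[A - B - C] ≥ E[A] - E[B] - E[C]`. The coefficients stay
nonnegative throughout, so each product turns into the product of its expectations. -/
theorem IndepSeq.blockLower (hind : 𝓔.IndepSeq X) (hX : ∀ n, 1 ≤ n → X n ∈ 𝓔.H) (hmn : m ≤ n)
    {f : (ℕ → ℝ) → ℝ} (hf : CylBL n f) {ξ ζ χ : ℕ → ℝ → ℝ}
    (hξ : ∀ j ∈ Finset.Ioc m n, BddLip (ξ j) ∧ ∀ u, 0 ≤ ξ j u)
    (hζ : ∀ j ∈ Finset.Ioc m n, BddLip (ζ j) ∧ ∀ u, 0 ≤ ζ j u)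
    (hχ : ∀ j ∈ Finset.Ioc m n, BddLip (χ j) ∧ ∀ u, 0 ≤ χ j u) {κ c₁ c₂ e : ℝ}
    (hκ : 0 ≤ κ) (hc₁ : 0 ≤ c₁) (hc₂ : 0 ≤ c₂)
    (hfle : ∀ x : ℕ → ℝ, κ * (∏ j ∈ Finset.Ioc m n, ξ j (x j) - c₁ * ∏ j ∈ Finset.Ioc m n, ζ j (x j)
      - c₂ * ∏ j ∈ Finset.Ioc m n, χ j (x j)) ≤ f x)
    (he : e ≤ κ * (∏ j ∈ Finset.Ioc m n, 𝓔.ex (fun ω => ξ j (X j ω))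
      - c₁ * ∏ j ∈ Finset.Ioc m n, 𝓔.ex (fun ω => ζ j (X j ω))
      - c₂ * ∏ j ∈ Finset.Ioc m n, 𝓔.ex (fun ω => χ j (X j ω)))) :
    𝓔.BlockLower X m f e := by
  intro P hP hP0
  -- In `Φ j` the factors with index above `j` are already replaced by their expectations. `Φ n`
  -- lies below the target by `hfle`, and `Φ m` lies above `1 - (1 - e) P` by `he`.
  set Φ : ℕ → (ℕ → ℝ) → ℝ := fun j x => 1 - P x + P x * (κ *
    ((∏ i ∈ Finset.Ioc j n, 𝓔.ex (fun ω => ξ i (X i ω))) * ∏ i ∈ Finset.Ioc m j, ξ i (x i)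
    - c₁ * ((∏ i ∈ Finset.Ioc j n, 𝓔.ex (fun ω => ζ i (X i ω))) * ∏ i ∈ Finset.Ioc m j, ζ i (x i))
    - c₂ * ((∏ i ∈ Finset.Ioc j n, 𝓔.ex (fun ω => χ i (X i ω))) * ∏ i ∈ Finset.Ioc m j, χ i (x i))))
    with hΦ
  have aux : ∀ {η : ℕ → ℝ → ℝ}, (∀ j ∈ Finset.Ioc m n, BddLip (η j) ∧ ∀ u, 0 ≤ η j u) →
      ∀ j ≤ n, CylBL j (fun x => (∏ i ∈ Finset.Ioc j n, 𝓔.ex (fun ω => η i (X i ω))) *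
        ∏ i ∈ Finset.Ioc m j, η i (x i)) := by
    intro η hη j hj
    refine CylBL.const_mul (CylBL.prod _ fun i hi => ?_) _
    rw [Finset.mem_Ioc] at hi
    exact CylBL.coord (hη i (by simp; omega)).1 (by simp; omega)
  have hcyl : ∀ j, m ≤ j → j ≤ n → CylBL j (Φ j) := fun j h1 h2 =>
    (hP.mono h1).one_sub.add ((hP.mono h1).mul ((((aux hξ j h2).sub
      ((aux hζ j h2).const_mul c₁)).sub ((aux hχ j h2).const_mul c₂)).const_mul κ))
  have main : ∀ j, m ≤ j → j ≤ n →
      𝓔.ex (fun ω => Φ m (fun j => X j ω)) ≤ 𝓔.ex (fun ω => Φ j (fun j => X j ω)) := by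
    intro j hj
    induction j, hj using Nat.le_induction with
    | base => exact fun _ => le_rfl
    | succ j hj ih =>
      intro hjn
      refine (ih (by omega)).trans
        (hind.step_ge hX (hcyl (j + 1) (by omega) hjn) (hcyl j hj (by omega)) fun x => ?_)
      have hmem : j + 1 ∈ Finset.Ioc m n := by simp; omega
      have hXj := hX (j + 1) (by omega)
      have hPu : ∀ u, P (Function.update x (j + 1) u) = P x := fun u =>
        hP.congr fun i _ hi => Function.update_of_ne (by omega) _ _
      have hsplit : ∀ η : ℕ → ℝ → ℝ, ∏ i ∈ Finset.Ioc j n, 𝓔.ex (fun ω => η i (X i ω)) =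
          𝓔.ex (fun ω => η (j + 1) (X (j + 1) ω)) *
            ∏ i ∈ Finset.Ioc (j + 1) n, 𝓔.ex (fun ω => η i (X i ω)) := by
        intro η
        rw [← Finset.insert_Ioc_add_one_left_eq_Ioc (by omega : j < n),
          Finset.prod_insert (by simp)]
      have hpos : ∀ {η : ℕ → ℝ → ℝ}, (∀ j ∈ Finset.Ioc m n, BddLip (η j) ∧ ∀ u, 0 ≤ η j u) →
          0 ≤ (∏ i ∈ Finset.Ioc (j + 1) n, 𝓔.ex (fun ω => η i (X i ω))) *
            ∏ i ∈ Finset.Ioc m j, η i (x i) := by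
        intro η hη
        refine mul_nonneg (Finset.prod_nonneg fun i hi => ?_) (Finset.prod_nonneg fun i hi => ?_)
        · rw [Finset.mem_Ioc] at hi
          have h := hη i (by simp; omega)
          exact ex_nonneg (h.1.isL1 (hX i (by omega))) fun ω => h.2 _
        · rw [Finset.mem_Ioc] at hi
          exact (hη i (by simp; omega)).2 _
      have hL : ∀ {η : ℕ → ℝ → ℝ}, (∀ j ∈ Finset.Ioc m n, BddLip (η j) ∧ ∀ u, 0 ≤ η j u) →
          𝓔.IsL1 (fun ω => η (j + 1) (X (j + 1) ω)) := fun hη => (hη _ hmem).1.isL1 hXj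
      set a := (∏ i ∈ Finset.Ioc (j + 1) n, 𝓔.ex (fun ω => ξ i (X i ω))) *
        ∏ i ∈ Finset.Ioc m j, ξ i (x i) with ha
      set b := (∏ i ∈ Finset.Ioc (j + 1) n, 𝓔.ex (fun ω => ζ i (X i ω))) *
        ∏ i ∈ Finset.Ioc m j, ζ i (x i) with hb
      set c := (∏ i ∈ Finset.Ioc (j + 1) n, 𝓔.ex (fun ω => χ i (X i ω))) *
        ∏ i ∈ Finset.Ioc m j, χ i (x i) with hc
      have ha0 : 0 ≤ a := hpos hξ
      have hb0 : 0 ≤ b := hpos hζ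
      have hc0 : 0 ≤ c := hpos hχ
      have hPx := hP0 x
      have L1 := (hL hξ).const_mul (P x * κ * a)
      have L2 := (hL hζ).const_mul (P x * κ * c₁ * b)
      have L3 := (hL hχ).const_mul (P x * κ * c₂ * c)
      have e1 : ∀ ω, Φ (j + 1) (Function.update x (j + 1) (X (j + 1) ω)) = (1 - P x) +
          (P x * κ * a * ξ (j + 1) (X (j + 1) ω) - P x * κ * c₁ * b * ζ (j + 1) (X (j + 1) ω)
            - P x * κ * c₂ * c * χ (j + 1) (X (j + 1) ω)) := by
        intro ω
        simp only [hΦ, hPu]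
        rw [prod_Ioc_update ξ x _ hj, prod_Ioc_update ζ x _ hj,
          prod_Ioc_update χ x _ hj, ha, hb, hc]
        ring
      have e2 : Φ j x = (1 - P x) + (P x * κ * a * 𝓔.ex (fun ω => ξ (j + 1) (X (j + 1) ω))
          - P x * κ * c₁ * b * 𝓔.ex (fun ω => ζ (j + 1) (X (j + 1) ω))
          - P x * κ * c₂ * c * 𝓔.ex (fun ω => χ (j + 1) (X (j + 1) ω))) := by
        simp only [hΦ]
        rw [hsplit ξ, hsplit ζ, hsplit χ, ha, hb, hc]
        ring
      simp only [e1]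
      rw [e2, ex_const_add ((L1.sub L2).sub L3)]
      have i1 := (L1.sub L2).ex_sub_le L3
      have i2 := L1.ex_sub_le L2
      rw [(hL hξ).ex_const_mul (by positivity)] at i2
      rw [(hL hζ).ex_const_mul (by positivity)] at i2
      rw [(hL hχ).ex_const_mul (by positivity)] at i1
      linarith
  have h1 := main n hmn le_rfl
  refine le_trans ?_ (h1.trans ?_)
  · refine (((hP.const_mul _).one_sub).isL1 hX).ex_mono ((hcyl m le_rfl hmn).isL1 hX) fun ω => ?_
    simp only [hΦ, Finset.Ioc_self, Finset.prod_empty, mul_one]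
    have := mul_le_mul_of_nonneg_left he (hP0 (fun j => X j ω))
    linarith
  · refine ((hcyl n hmn le_rfl).isL1 hX).ex_mono
      (((hf.one_sub.mul (hP.mono hmn)).one_sub).isL1 hX) fun ω => ?_
    simp only [hΦ, Finset.Ioc_self, Finset.prod_empty, one_mul]
    have := mul_le_mul_of_nonneg_left (hfle (fun j => X j ω)) (hP0 (fun j => X j ω))
    linarith

theorem blockLower_zero : 𝓔.BlockLower X m (fun _ => 0) 0 := fun _ _ _ => le_rfl

theorem BlockLower.mono {f : (ℕ → ℝ) → ℝ} {e e' : ℝ} (h : 𝓔.BlockLower X m f e)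
    (hX : ∀ n, 1 ≤ n → X n ∈ 𝓔.H) (he : e' ≤ e) : 𝓔.BlockLower X m f e' := fun P hP hP0 =>
  (((hP.const_mul _).one_sub.isL1 hX).ex_mono ((hP.const_mul _).one_sub.isL1 hX) fun ω => by
    have := mul_le_mul_of_nonneg_right he (hP0 (fun j => X j ω))
    linarith).trans (h P hP hP0)

/-- Success probabilities of successive blocks multiply. -/
theorem BlockLower.prod {N : ℕ → ℕ} (hN : Monotone N)
    {f : ℕ → (ℕ → ℝ) → ℝ} {e : ℕ → ℝ} (hf : ∀ i, CylBL (N (i + 1)) (f i))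
    (hf1 : ∀ i x, f i x ≤ 1) (he1 : ∀ i, e i ≤ 1)
    (h : ∀ i, 𝓔.BlockLower X (N i) (f i) (e i)) (I : ℕ) :
    1 - ∏ i ∈ Finset.range I, (1 - e i) ≤
      𝓔.ex (fun ω => 1 - ∏ i ∈ Finset.range I, (1 - f i (fun j => X j ω))) := by
  have hP : ∀ I, CylBL (N I) (fun x => ∏ i ∈ Finset.range I, (1 - f i x)) := fun I =>
    CylBL.prod _ fun i hi => ((hf i).one_sub).mono (hN (by rw [Finset.mem_range] at hi; omega))
  -- The free weight `ρ` lets the induction absorb the constant `1 - e I` left by the last block.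
  suffices ∀ ρ : ℝ, 0 ≤ ρ → 1 - ρ * ∏ i ∈ Finset.range I, (1 - e i) ≤
      𝓔.ex (fun ω => 1 - ρ * ∏ i ∈ Finset.range I, (1 - f i (fun j => X j ω))) by
    simpa using this 1 zero_le_one
  induction I with
  | zero => intro ρ _; simp [ex_const]
  | succ I ih =>
    intro ρ hρ
    have h1 := h I (fun x => ρ * ∏ i ∈ Finset.range I, (1 - f i x)) ((hP I).const_mul ρ)
      (fun x => mul_nonneg hρ (Finset.prod_nonneg fun i _ => sub_nonneg.2 (hf1 i x)))
    have h2 := ih ((1 - e I) * ρ) (mul_nonneg (sub_nonneg.2 (he1 I)) hρ)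
    simp only [Finset.prod_range_succ]
    calc _ = 1 - (1 - e I) * ρ * ∏ i ∈ Finset.range I, (1 - e i) := by ring
      _ ≤ _ := h2
      _ ≤ _ := by simpa only [mul_assoc] using h1
      _ = _ := by congr 1; funext ω; ring

end SublinearExpectationSpace

/-! ### Truncated and iterated logarithms, the normalizer `amp` and the ratio `tilt`. -/

theorem one_le_tlog (x : ℝ) : 1 ≤ tlog x := by
  rw [tlog, Real.le_log_iff_exp_le (lt_of_lt_of_le (Real.exp_pos 1) (le_max_left _ _))]
  exact le_max_left _ _

theorem tlog_pos (x : ℝ) : 0 < tlog x := zero_lt_one.trans_le (one_le_tlog x)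

theorem tlog_mono {x y : ℝ} (h : x ≤ y) : tlog x ≤ tlog y :=
  Real.log_le_log (lt_of_lt_of_le (Real.exp_pos 1) (le_max_left _ _)) (max_le_max_left _ h)

theorem log_le_tlog {x : ℝ} (h : 0 < x) : Real.log x ≤ tlog x :=
  Real.log_le_log h (le_max_right _ _)

theorem exp_tlog (x : ℝ) : Real.exp (tlog x) = max (Real.exp 1) x :=
  Real.exp_log (lt_of_lt_of_le (Real.exp_pos 1) (le_max_left _ _))

theorem tlog_mul_le {c : ℝ} (hc : 1 ≤ c) (x : ℝ) : tlog (c * x) ≤ c * tlog x := by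
  have h1 : max (Real.exp 1) (c * x) ≤ c * max (Real.exp 1) x := by
    refine max_le ?_ (mul_le_mul_of_nonneg_left (le_max_right _ _) (by linarith))
    calc Real.exp 1 ≤ max (Real.exp 1) x := le_max_left _ _
      _ ≤ _ := le_mul_of_one_le_left (le_trans (Real.exp_pos 1).le (le_max_left _ _)) hc
  have h2 : tlog (c * x) ≤ Real.log (c * max (Real.exp 1) x) :=
    Real.log_le_log (lt_of_lt_of_le (Real.exp_pos 1) (le_max_left _ _)) h1
  rw [Real.log_mul (by positivity)
    (lt_of_lt_of_le (Real.exp_pos 1) (le_max_left _ _)).ne'] at h2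
  have h3 : Real.log c ≤ c - 1 := Real.log_le_sub_one_of_pos (by linarith)
  have h4 := one_le_tlog x
  change _ ≤ _ + tlog x at h2
  nlinarith

/-- The iterated logarithm. -/
def llog (v : ℝ) : ℝ := tlog (tlog v)

theorem one_le_llog (v : ℝ) : 1 ≤ llog v := one_le_tlog _

theorem llog_pos (v : ℝ) : 0 < llog v := tlog_pos _

theorem llog_mono {x y : ℝ} (h : x ≤ y) : llog x ≤ llog y := tlog_mono (tlog_mono h)

theorem llog_mul_le {c : ℝ} (hc : 1 ≤ c) (x : ℝ) : llog (c * x) ≤ c * llog x :=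
  (tlog_mono (tlog_mul_le hc x)).trans (tlog_mul_le hc _)

theorem tlog_le_exp_llog (v : ℝ) : tlog v ≤ Real.exp (llog v) := by
  rw [llog, exp_tlog]; exact le_max_right _ _

theorem exp_llog_le (v : ℝ) : Real.exp (llog v) ≤ Real.exp 1 * tlog v := by
  rw [llog, exp_tlog]
  have h := one_le_tlog v
  have h2 := Real.add_one_le_exp 1
  exact max_le (by nlinarith) (by nlinarith)

/-- The normalizer `√(2 v log log v)`. -/
def amp (v : ℝ) : ℝ := √v * √(2 * llog v)

/-- The ratio `√(2 log log v) / √v`. -/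
def tilt (v : ℝ) : ℝ := √(2 * llog v) / √v

theorem amp_nonneg (v : ℝ) : 0 ≤ amp v := by unfold amp; positivity

theorem amp_pos {v : ℝ} (h : 0 < v) : 0 < amp v := by
  have := llog_pos v
  unfold amp; positivity

theorem tilt_pos {v : ℝ} (h : 0 < v) : 0 < tilt v := by
  have := llog_pos v
  unfold tilt; positivity

theorem amp_sq {v : ℝ} (h : 0 ≤ v) : amp v ^ 2 = v * (2 * llog v) := by
  have := llog_pos v
  rw [amp, mul_pow, Real.sq_sqrt h, Real.sq_sqrt (by positivity)]

theorem tilt_mul_amp {v : ℝ} (h : 0 < v) : tilt v * amp v = 2 * llog v := by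
  have := llog_pos v
  have h1 : 0 < √v := Real.sqrt_pos.2 h
  rw [tilt, amp]
  field_simp
  exact Real.sq_sqrt (by positivity)

theorem tilt_mul_self {v : ℝ} (h : 0 < v) : tilt v * v = amp v := by
  have h1 : 0 < √v := Real.sqrt_pos.2 h
  rw [tilt, amp]
  field_simp
  rw [Real.sq_sqrt h.le]

theorem amp_mono {x y : ℝ} (h : x ≤ y) : amp x ≤ amp y := by
  unfold amp
  gcongr
  exact llog_mono h

theorem amp_mul_le {c x : ℝ} (hc : 1 ≤ c) (hx : 0 ≤ x) : amp (c * x) ≤ c * amp x := by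
  apply le_of_sq_le_sq _ (mul_nonneg (by linarith) (amp_nonneg _))
  rw [amp_sq (by positivity), mul_pow, amp_sq hx]
  calc c * x * (2 * llog (c * x)) ≤ c * x * (2 * (c * llog x)) := by
        gcongr; exact llog_mul_le hc x
    _ = _ := by ring

theorem sqrt_mul_amp_le {c x : ℝ} (hc : 1 ≤ c) (hx : 0 ≤ x) : √c * amp x ≤ amp (c * x) := by
  rw [amp, amp, Real.sqrt_mul (by linarith : 0 ≤ c), ← mul_assoc]
  gcongr
  exact llog_mono (by nlinarith)

/-- `llog v / v` is nonincreasing because `llog (c x) ≤ c llog x` for `c ≥ 1`. -/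
theorem tilt_anti {x y : ℝ} (hx : 0 < x) (h : x ≤ y) : tilt y ≤ tilt x := by
  have hy := hx.trans_le h
  have := llog_pos x
  have := llog_pos y
  have h1 : llog y * x ≤ llog x * y := by
    have := llog_mul_le ((one_le_div hx).2 h) x
    rw [div_mul_cancel₀ _ hx.ne', div_mul_eq_mul_div, le_div_iff₀ hx] at this
    linarith
  rw [tilt, tilt, ← Real.sqrt_div (by positivity), ← Real.sqrt_div (by positivity)]
  apply Real.sqrt_le_sqrt
  rw [div_le_div_iff₀ hy hx]
  linarith

/-! ### Second order bounds for the exponential of a truncated variable. -/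

/-- No lower bound on `u` is needed. For `u ≤ 0` even `1 + u + u² / 2` suffices, because its product
with `1 - u + u² / 2 ≤ e ^ (-u)` is `1 + u⁴ / 4`. -/
theorem exp_le_quadratic {u η : ℝ} (hη : 0 < η) (hη1 : η ≤ 1) (h : u ≤ η) :
    Real.exp u ≤ 1 + u + (1 + η) * u ^ 2 / 2 := by
  rcases le_total 0 u with h0 | h0
  · have := Real.exp_bound' h0 (h.trans hη1) (n := 3) (by norm_num)
    simp [Finset.sum_range_succ, Nat.factorial] at this
    nlinarith [mul_nonneg (sq_nonneg u) (sub_nonneg.2 h)]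
  · have h1 : Real.exp u ≤ 1 + u + u ^ 2 / 2 := by
      have h2 := Real.quadratic_le_exp_of_nonneg (neg_nonneg.2 h0)
      have h3 : Real.exp u * Real.exp (-u) = 1 := by rw [← Real.exp_add]; simp
      have h4 : 0 < Real.exp u := Real.exp_pos u
      by_contra hc
      push Not at hc
      have h5 : 0 < 1 + -u + (-u) ^ 2 / 2 := by nlinarith
      have h6 : (1 + u + u ^ 2 / 2) * (1 + -u + (-u) ^ 2 / 2) < 1 := by
        calc _ < Real.exp u * (1 + -u + (-u) ^ 2 / 2) := mul_lt_mul_of_pos_right hc h5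
          _ ≤ Real.exp u * Real.exp (-u) := mul_le_mul_of_nonneg_left h2 h4.le
          _ = 1 := h3
      nlinarith [sq_nonneg (u ^ 2)]
    nlinarith [sq_nonneg u]

theorem quadratic_le_exp {u η : ℝ} (hη : 0 < η) (hη1 : η ≤ 1) (h : -η ≤ u) :
    1 + u + (1 - η) * u ^ 2 / 2 ≤ Real.exp u := by
  rcases le_total 0 u with h0 | h0
  · have h2 := Real.quadratic_le_exp_of_nonneg h0
    nlinarith [sq_nonneg u]
  · have h1 := Real.exp_bound (x := u) (by rw [abs_of_nonpos h0]; linarith) (n := 3) (by norm_num)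
    simp [Finset.sum_range_succ, Nat.factorial] at h1
    have h2 := (abs_le.1 h1).1
    rw [abs_of_nonpos h0] at h2
    nlinarith [mul_nonneg (sq_nonneg u) (by linarith : 0 ≤ η + u), mul_nonneg (sq_nonneg u) hη.le]

/-- Since `h b ≤ η / 2 < h |x| / 2`, the excess is at least half of `|x|`. Hence `z = (2 / η) h (|x|
- b)⁺` is at least `1` and at least `h |x|`, and `1`, `z`, `z²` are all at most `z ^ p`. -/
theorem excess_dominates {x h b η p : ℝ} (hη : 0 < η) (hη1 : η ≤ 1) (hh : 0 ≤ h) (hp : 2 ≤ p)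
    (hb : h * b ≤ η / 2) (hx : η < h * |x|) :
    1 ≤ (2 / η) ^ p * (h ^ p * max (|x| - b) 0 ^ p) ∧
    h * |x| ≤ (2 / η) ^ p * (h ^ p * max (|x| - b) 0 ^ p) ∧
    h ^ 2 * x ^ 2 ≤ (2 / η) ^ p * (h ^ p * max (|x| - b) 0 ^ p) := by
  set w := max (|x| - b) 0 with hw
  have hw0 : 0 ≤ w := le_max_right _ _
  have hw1 : h * |x| ≤ 2 * (h * w) := by
    have := mul_le_mul_of_nonneg_left (le_max_left (|x| - b) 0) hh
    rw [← hw] at this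
    nlinarith
  rw [← Real.mul_rpow hh hw0, ← Real.mul_rpow (by positivity) (by positivity)]
  set z := 2 / η * (h * w) with hz
  have hsz : h * |x| ≤ η * z := by
    have : η * z = 2 * (h * w) := by rw [hz]; field_simp
    linarith
  have hz1 : 1 ≤ z := by nlinarith
  have hzp : z ^ 2 ≤ z ^ p := by
    rw [← Real.rpow_two]; exact Real.rpow_le_rpow_of_exponent_le hz1 hp
  have hs : h * |x| ≤ z := by nlinarith
  have hs2 : h ^ 2 * x ^ 2 ≤ z ^ 2 := by
    rw [← sq_abs x, ← mul_pow]; exact pow_le_pow_left₀ (by positivity) hs 2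
  refine ⟨?_, ?_, ?_⟩ <;> nlinarith

/-- Second order bounds for `exp (h (x ∧ y))`, in which only the excess of `|x|` over a level of
order `1 / h` contributes to the error. -/
theorem exp_min_bounds {x y h b η p : ℝ} (hη : 0 < η) (hη1 : η ≤ 1) (hh : 0 ≤ h) (hy : 0 ≤ y)
    (hp : 2 ≤ p) (hb : h * b ≤ η / 2) :
    Real.exp (h * min x y) ≤ 1 + h * x + (1 + η) * (h ^ 2 * x ^ 2) / 2 +
      3 * (2 / η) ^ p * Real.exp (h * y) * h ^ p * max (|x| - b) 0 ^ p ∧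
    (η ≤ h * y → 1 + h * x + (1 - η) * (h ^ 2 * x ^ 2) / 2 -
      3 * (2 / η) ^ p * Real.exp (h * y) * h ^ p * max (|x| - b) 0 ^ p ≤
        Real.exp (h * min x y)) ∧
    h * |x| ≤ η + 3 * (2 / η) ^ p * Real.exp (h * y) * h ^ p * max (|x| - b) 0 ^ p ∧
    h ^ 2 * x ^ 2 ≤ η ^ 2 +
      3 * (2 / η) ^ p * Real.exp (h * y) * h ^ p * max (|x| - b) 0 ^ p := by
  have hR0 : 0 ≤ (2 / η) ^ p * (h ^ p * max (|x| - b) 0 ^ p) := by positivity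
  have hRe : 3 * (2 / η) ^ p * Real.exp (h * y) * h ^ p * max (|x| - b) 0 ^ p =
    3 * Real.exp (h * y) * ((2 / η) ^ p * (h ^ p * max (|x| - b) 0 ^ p)) := by ring
  have hdom := excess_dominates (x := x) hη hη1 hh hp hb
  rw [hRe]
  set R := (2 / η) ^ p * (h ^ p * max (|x| - b) 0 ^ p)
  have hey : 1 ≤ Real.exp (h * y) := Real.one_le_exp (by positivity)
  have hmin : h * min x y ≤ h * x := mul_le_mul_of_nonneg_left (min_le_left _ _) hh
  have hminy : h * min x y ≤ h * y := mul_le_mul_of_nonneg_left (min_le_right _ _) hh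
  have hsq : (h * x) ^ 2 = h ^ 2 * x ^ 2 := by ring
  -- The factor `3` pays for the terms of order zero, one and two, each dominated by `R` when `h |x|
  -- > η`. The factor `exp (h y)` is the largest value of the truncated exponential.
  have hRR : 3 * R ≤ 3 * Real.exp (h * y) * R := by nlinarith
  have habs : h * |x| = |h * x| := by rw [abs_mul, abs_of_nonneg hh]
  have hsq0 : 0 ≤ h ^ 2 * x ^ 2 := by positivity
  have hxle : -(h * |x|) ≤ h * x := by rw [habs]; exact neg_abs_le _
  refine ⟨?_, fun hηy => ?_, ?_, ?_⟩
  · by_cases hx : h * x ≤ η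
    · have := exp_le_quadratic hη hη1 hx
      have h1 := Real.exp_le_exp.2 hmin
      rw [hsq] at this
      linarith
    · push Not at hx
      obtain ⟨h1, -, -⟩ := hdom (by rw [habs]; exact hx.trans_le (le_abs_self _))
      have h2 := Real.exp_le_exp.2 hminy
      have h3 : Real.exp (h * y) ≤ 3 * Real.exp (h * y) * R := by nlinarith
      have : 0 ≤ (1 + η) * (h ^ 2 * x ^ 2) / 2 := by positivity
      linarith
  · by_cases hx : h * |x| ≤ η
    · have h1 : h * x ≤ h * y := by
        have := le_abs_self (h * x)
        linarith
      have h2 : h * min x y = h * x := by rw [mul_min_of_nonneg _ _ hh, min_eq_left h1]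
      have := quadratic_le_exp hη hη1 (u := h * x) (by linarith)
      rw [h2]
      rw [hsq] at this
      nlinarith
    · push Not at hx
      obtain ⟨h1, h2, h3⟩ := hdom hx
      have h4 := Real.exp_pos (h * min x y)
      have h5 : h * x ≤ h * |x| := mul_le_mul_of_nonneg_left (le_abs_self x) hh
      have h6 : 0 ≤ η * (h ^ 2 * x ^ 2) := by positivity
      linarith
  · by_cases hx : h * |x| ≤ η
    · linarith
    · push Not at hx
      obtain ⟨h1, h2, h3⟩ := hdom hx
      linarith
  · by_cases hx : h * |x| ≤ η
    · have : h ^ 2 * x ^ 2 ≤ η ^ 2 := by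
        rw [← sq_abs x, ← mul_pow]; exact pow_le_pow_left₀ (by positivity) hx 2
      linarith
    · push Not at hx
      obtain ⟨h1, h2, h3⟩ := hdom hx
      nlinarith

/-- Truncation from above alone suffices, since `h ≥ 0` makes the exponential bounded and flat on
the left. This admits it as a test function for peeling. -/
theorem bddLip_exp_min {h : ℝ} (hh : 0 ≤ h) (y : ℝ) :
    BddLip (fun x => Real.exp (h * min x y)) := by
  have hb : ∀ x, Real.exp (h * min x y) ≤ Real.exp (h * y) := fun x =>
    Real.exp_le_exp.2 (mul_le_mul_of_nonneg_left (min_le_right _ _) hh)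
  have key : ∀ u v : ℝ, u ≤ v →
      |Real.exp (h * min u y) - Real.exp (h * min v y)| ≤ Real.exp (h * y) * h * |u - v| := by
    intro u v huv
    have h1 : min u y ≤ min v y := min_le_min_right _ huv
    have h1' := mul_le_mul_of_nonneg_left h1 hh
    rw [abs_sub_comm, abs_sub_comm u v, abs_of_nonneg (sub_nonneg.2 (Real.exp_le_exp.2 h1')),
      abs_of_nonneg (sub_nonneg.2 huv)]
    have h2 : min v y - min u y ≤ v - u := by
      rcases le_total u y with h | h
      · rw [min_eq_left h]; linarith [min_le_left v y]
      · rw [min_eq_right h]; linarith [min_le_right v y]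
    have h3 : Real.exp (h * min v y) - Real.exp (h * min u y) ≤
        Real.exp (h * min v y) * (h * min v y - h * min u y) := by
      have := Real.add_one_le_exp (h * min u y - h * min v y)
      rw [Real.exp_sub, le_div_iff₀ (Real.exp_pos _)] at this
      linarith
    have h4 : h * min v y - h * min u y ≤ h * (v - u) := by
      rw [← mul_sub]; exact mul_le_mul_of_nonneg_left h2 hh
    calc _ ≤ _ := h3
      _ ≤ Real.exp (h * y) * (h * (v - u)) := mul_le_mul (hb v) h4 (by linarith) (Real.exp_pos _).le
      _ = _ := by ring
  refine ⟨Real.exp (h * y) * (1 + h), by positivity, fun x => ?_, fun u v => ?_⟩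
  · rw [abs_of_pos (Real.exp_pos _)]
    have := Real.exp_pos (h * y)
    nlinarith [hb x, mul_nonneg this.le hh]
  · have h5 : Real.exp (h * y) * h * |u - v| ≤ Real.exp (h * y) * (1 + h) * |u - v| := by
      gcongr; linarith
    rcases le_total u v with huv | huv
    · exact (key u v huv).trans h5
    · rw [abs_sub_comm, abs_sub_comm u v] at *
      exact (key v u huv).trans h5

/-! ### Summation lemmas and the geometry of the variance blocks. -/

/-- A power bound for increments, summed. -/
theorem ENNReal.add_rpow_succ_le (a g : ℝ≥0∞) {d : ℝ} (hd : 0 ≤ d) :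
    (a + g) ^ (d + 1) ≤ a ^ (d + 1) + ENNReal.ofReal (d + 1) * (g * (a + g) ^ d) := by
  have hd1 : 0 < d + 1 := by linarith
  rcases eq_or_ne a ⊤ with rfl | ha
  · simp [ENNReal.top_rpow_of_pos hd1]
  rcases eq_or_ne g ⊤ with rfl | hg
  · have : ENNReal.ofReal (d + 1) ≠ 0 := by simpa using hd1
    rcases hd.eq_or_lt with rfl | hd'
    · simp
    · simp [ENNReal.top_rpow_of_pos hd1, ENNReal.top_rpow_of_pos hd', ENNReal.mul_top this]
  lift a to NNReal using ha
  lift g to NNReal using hg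
  rw [← ENNReal.coe_add, ← ENNReal.coe_rpow_of_nonneg _ hd1.le,
    ← ENNReal.coe_rpow_of_nonneg _ hd1.le, ← ENNReal.coe_rpow_of_nonneg _ hd, ENNReal.ofReal]
  norm_cast
  rw [← NNReal.coe_le_coe]
  push_cast
  rw [Real.coe_toNNReal _ hd1.le]
  have ha : 0 ≤ (a : ℝ) := a.2
  have hg : 0 ≤ (g : ℝ) := g.2
  generalize (a : ℝ) = a at *
  generalize (g : ℝ) = g at *
  rcases hg.eq_or_lt with rfl | hg'
  · simp
  have hs : 0 < a + g := by positivity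
  have hb := one_add_mul_self_le_rpow_one_add (s := a / (a + g) - 1)
      (by have : 0 ≤ a / (a + g) := by positivity
          linarith) (p := d + 1) (by linarith)
  rw [add_sub_cancel, Real.div_rpow ha hs.le, le_div_iff₀ (Real.rpow_pos_of_pos hs _)] at hb
  have h1 : (a + g) ^ (d + 1) = (a + g) ^ d * (a + g) := Real.rpow_add_one hs.ne' _
  have h2 : (1 + (d + 1) * (a / (a + g) - 1)) * (a + g) ^ (d + 1) =
      (a + g) ^ (d + 1) - (d + 1) * (g * (a + g) ^ d) := by
    rw [h1]; field_simp; ring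
  linarith

/-- Discrete form of `G ^ (d + 1) = (d + 1) ∫ G ^ d dG`. This is how the products `Γ Λ ^ d` of (ii)
control a power of a whole block sum. -/
theorem ENNReal.sum_rpow_succ_le (g : ℕ → ℝ≥0∞) {d : ℝ} (hd : 0 ≤ d) (n : ℕ) :
    (∑ j ∈ Finset.Icc 1 n, g j) ^ (d + 1) ≤ ENNReal.ofReal (d + 1) *
      ∑ j ∈ Finset.Icc 1 n, g j * (∑ i ∈ Finset.Icc 1 j, g i) ^ d := by
  induction n with
  | zero => simp [ENNReal.zero_rpow_of_pos (by linarith : 0 < d + 1)]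
  | succ n ih =>
    rw [Finset.sum_Icc_succ_top (by omega), Finset.sum_Icc_succ_top (by omega), mul_add]
    refine (ENNReal.add_rpow_succ_le _ _ hd).trans ?_
    rw [Finset.sum_Icc_succ_top (by omega)]
    gcongr

/-- The last index at which a sequence lies below a level. -/
def lastBelow (v : ℕ → ℝ) (x : ℝ) : ℕ := sSup {n | v n < x}

/-- Divergence bounds the set and `h0` makes it nonempty, so the supremum in `lastBelow` is attained
and is not a default value. -/
theorem le_lastBelow_iff {v : ℕ → ℝ} (hm : Monotone v) (ht : Tendsto v atTop atTop) {x : ℝ}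
    (h0 : v 0 < x) {n : ℕ} : n ≤ lastBelow v x ↔ v n < x := by
  have hb : BddAbove {n | v n < x} := by
    obtain ⟨M, hM⟩ := (ht.eventually (eventually_ge_atTop x)).exists
    refine ⟨M, fun n hn => ?_⟩
    by_contra hc
    have := hm (le_of_not_ge hc)
    exact absurd (lt_of_le_of_lt (hM.trans this) hn) (lt_irrefl _)
  refine ⟨fun h => ?_, fun h => le_csSup hb h⟩
  exact (hm h).trans_lt (Nat.sSup_mem ⟨0, h0⟩ hb : lastBelow v x ∈ {n | v n < x})

theorem tilt_le_mul {D v : ℝ} (hD : 1 ≤ D) (hv : 0 < v) : tilt v ≤ D * tilt (D * v) := by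
  have h1 : 0 < √v := Real.sqrt_pos.2 hv
  have hsD : 1 ≤ √D := Real.one_le_sqrt.2 hD
  have h2 : √D * √D = D := Real.mul_self_sqrt (by linarith)
  have h3 : √(2 * llog v) ≤ √(2 * llog (D * v)) :=
    Real.sqrt_le_sqrt (by linarith [llog_mono (show v ≤ D * v by nlinarith)])
  rw [tilt, tilt, Real.sqrt_mul (by linarith : 0 ≤ D), ← mul_div_assoc,
    div_le_div_iff₀ h1 (by positivity)]
  have h4 : 0 ≤ √(2 * llog v) := Real.sqrt_nonneg _
  calc √(2 * llog v) * (√D * √v) ≤ √(2 * llog (D * v)) * (√D * √v) := by gcongr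
    _ ≤ √(2 * llog (D * v)) * (√D * √D * √v) := by gcongr; nlinarith
    _ = _ := by rw [h2]; ring

/-- Only levels from that of `v` upwards contribute. There `amp` grows at least like `√(D ^ i)`, and
`r ≥ 2` turns this into geometric decay of ratio `D⁻¹`, so the first contributing level dominates.
-/
theorem tsum_inv_amp_rpow_le {D r v : ℝ} (hD : 1 < D) (hr : 2 ≤ r) (hv : 0 < v) :
    ∑' k : ℕ, (if v < D ^ (k + 1) then (ENNReal.ofReal (amp (D ^ k) ^ r))⁻¹ else 0) ≤
      ENNReal.ofReal (D ^ r * (1 - D⁻¹)⁻¹) * (ENNReal.ofReal (amp v ^ r))⁻¹ := by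
  have hD0 : 0 < D := by linarith
  have hex : ∃ k : ℕ, v < D ^ (k + 1) := by
    obtain ⟨k, hk⟩ := pow_unbounded_of_one_lt v hD
    exact ⟨k, hk.trans_le (pow_le_pow_right₀ hD.le (by omega))⟩
  classical
  set k₀ := Nat.find hex
  have hk₀ : v < D ^ (k₀ + 1) := Nat.find_spec hex
  have hlt : ∀ k < k₀, ¬ v < D ^ (k + 1) := fun k hk => Nat.find_min hex hk
  rw [← (add_left_injective k₀).tsum_eq (f := fun k : ℕ =>
    (if v < D ^ (k + 1) then (ENNReal.ofReal (amp (D ^ k) ^ r))⁻¹ else 0))]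
  swap
  · intro k hk
    by_contra hc
    have : k < k₀ := by
      by_contra h
      exact hc ⟨k - k₀, by simp; omega⟩
    exact hk (if_neg (hlt k this))
  have key : ∀ i : ℕ, (if v < D ^ (i + k₀ + 1) then (ENNReal.ofReal (amp (D ^ (i + k₀)) ^ r))⁻¹
      else 0) ≤ ENNReal.ofReal (D ^ r * D⁻¹ ^ i) * (ENNReal.ofReal (amp v ^ r))⁻¹ := by
    intro i
    refine le_trans (b := (ENNReal.ofReal (amp (D ^ (i + k₀)) ^ r))⁻¹) (by split_ifs <;> simp) ?_
    have h1 : amp v ≤ D * amp (D ^ k₀) := by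
      refine (amp_mono hk₀.le).trans ?_
      rw [pow_succ']
      exact amp_mul_le hD.le (by positivity)
    have h2 : √(D ^ i) * amp (D ^ k₀) ≤ amp (D ^ (i + k₀)) := by
      rw [pow_add]; exact sqrt_mul_amp_le (one_le_pow₀ hD.le) (by positivity)
    have hs : 1 ≤ √(D ^ i) := Real.one_le_sqrt.2 (one_le_pow₀ hD.le)
    have ha : 0 < amp v := amp_pos hv
    have hak : 0 < amp (D ^ (i + k₀)) := amp_pos (by positivity)
    have h3 : √(D ^ i) * amp v ≤ D * amp (D ^ (i + k₀)) := by
      calc _ ≤ √(D ^ i) * (D * amp (D ^ k₀)) := by gcongr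
        _ = D * (√(D ^ i) * amp (D ^ k₀)) := by ring
        _ ≤ _ := by gcongr
    have h4 : D ^ i * amp v ^ r ≤ D ^ r * amp (D ^ (i + k₀)) ^ r := by
      calc D ^ i * amp v ^ r = √(D ^ i) ^ (2 : ℝ) * amp v ^ r := by
            rw [Real.rpow_two, Real.sq_sqrt (by positivity)]
        _ ≤ √(D ^ i) ^ r * amp v ^ r := by
            gcongr
        _ = (√(D ^ i) * amp v) ^ r := (Real.mul_rpow (by positivity) ha.le).symm
        _ ≤ (D * amp (D ^ (i + k₀))) ^ r := Real.rpow_le_rpow (by positivity) h3 (by linarith)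
        _ = _ := Real.mul_rpow hD0.le hak.le
    have hp1 : 0 < amp v ^ r := Real.rpow_pos_of_pos ha r
    have hp2 : 0 < amp (D ^ (i + k₀)) ^ r := Real.rpow_pos_of_pos hak r
    rw [← ENNReal.ofReal_inv_of_pos hp1, ← ENNReal.ofReal_inv_of_pos hp2,
      ← ENNReal.ofReal_mul (by positivity)]
    apply ENNReal.ofReal_le_ofReal
    rw [inv_pow]
    have h5 : 0 < D ^ i := by positivity
    rw [← div_eq_mul_inv, ← div_eq_mul_inv, div_div, inv_eq_one_div, div_le_div_iff₀ hp2 (by positivity)]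
    linarith
  refine (ENNReal.tsum_le_tsum key).trans ?_
  rw [ENNReal.tsum_mul_right, ← ENNReal.ofReal_tsum_of_nonneg (fun i => by positivity)
    ((summable_geometric_of_lt_one (by positivity) (inv_lt_one_of_one_lt₀ hD)).mul_left _),
    tsum_mul_left, tsum_geometric_of_lt_one (by positivity) (inv_lt_one_of_one_lt₀ hD)]

/-! ### The hypotheses, their symmetry, and divergence of the variance. -/

namespace SublinearExpectationSpace

variable {Ω : Type*} [MeasurableSpace Ω] {𝓔 : SublinearExpectationSpace Ω} {X : ℕ → Ω → ℝ}

/-- The hypotheses of the law of the iterated logarithm, with the tail condition in terms of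
`upCap`. -/
structure LILHyp (𝓔 : SublinearExpectationSpace Ω) (X : ℕ → Ω → ℝ) : Prop where
  mem : ∀ n, 1 ≤ n → X n ∈ 𝓔.H
  sq : ∀ n, 1 ≤ n → 𝓔.E (fun ω => X n ω ^ 2) < ⊤
  indep : 𝓔.IndepSeq X
  tail : ∀ ε : ℝ, 0 < ε →
    ∑' n : ℕ, 𝓔.upCap {ω | ε * 𝓔.an X (n + 1) ≤ |X (n + 1) ω|} < ∞
  mom : ∀ α : ℝ, 0 < α → ∃ p d : ℝ, 2 ≤ p ∧ 0 ≤ d ∧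
    ∑' n : ℕ, (if 𝓔.sd X (n + 1) = 0 then 0 else
      𝓔.Gam X p α (n + 1) / ENNReal.ofReal (𝓔.an X (n + 1) ^ p) *
        (𝓔.Lam X p α (n + 1) / ENNReal.ofReal (𝓔.an X (n + 1) ^ p)) ^ d) < ∞
  div : ∀ δ : ℝ, 0 < δ →
    ∑' n : ℕ, ENNReal.ofReal ((𝓔.sSq X (n + 1))⁻¹ * tlog (𝓔.sSq X (n + 1)) ^ (δ - 1) *
      (𝓔.E (fun ω => X (n + 1) ω ^ 2)).toReal) = ∞
  mean : Tendsto (fun n : ℕ =>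
    (∑ j ∈ Finset.Icc 1 n, |(𝓔.E (X j)).toReal| +
      ∑ j ∈ Finset.Icc 1 n, |(𝓔.conjE (X j)).toReal|) / 𝓔.an X n) atTop (𝓝 0)

namespace LILHyp

variable (H : 𝓔.LILHyp X)

include H

/-- Every normalizer and excess sees only `|X|`, the two sums of means trade places, and
independence transfers through `φ ∘ (-·)`. -/
theorem neg : 𝓔.LILHyp (fun n ω => -X n ω) := by
  have hs : 𝓔.sSq (fun n ω => -X n ω) = 𝓔.sSq X := by funext n; simp [sSq]
  have hsd : 𝓔.sd (fun n ω => -X n ω) = 𝓔.sd X := by funext n; simp [sd, hs]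
  have htn : 𝓔.tn (fun n ω => -X n ω) = 𝓔.tn X := by funext n; simp [tn, hs]
  have han : 𝓔.an (fun n ω => -X n ω) = 𝓔.an X := by funext n; simp [an, hsd, htn]
  have hex : 𝓔.excess (fun n ω => -X n ω) = 𝓔.excess X := by
    funext p α n j; simp [excess, hsd, htn]
  have hG : 𝓔.Gam (fun n ω => -X n ω) = 𝓔.Gam X := by funext p α n; simp [Gam, hex]
  have hL : 𝓔.Lam (fun n ω => -X n ω) = 𝓔.Lam X := by funext p α n; simp [Lam, hex]
  refine ⟨fun n hn => 𝓔.H.neg_mem (H.mem n hn), fun n hn => by simpa using H.sq n hn,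
    fun i hi φ hφ h1 h2 h3 h4 => ?_, by simpa [han] using H.tail,
    by simpa [hsd, han, hG, hL] using H.mom, by simpa [hs] using H.div, ?_⟩
  · refine H.indep i hi (fun z => φ (-z)) ?_ (fun x => h1 (-x)) h2 h3 h4
    obtain ⟨C, hC, m, h⟩ := hφ
    refine ⟨C, hC, m, fun x y => ?_⟩
    have := h (-x) (-y)
    rwa [norm_neg, norm_neg, neg_sub_neg, norm_sub_rev] at this
  · refine H.mean.congr fun n => ?_
    rw [han, add_comm]
    congr 2
    · refine Finset.sum_congr rfl fun j _ => ?_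
      simp [conjE]
    · refine Finset.sum_congr rfl fun j _ => ?_
      simp [conjE]

theorem sigma_nonneg (n : ℕ) (hn : 1 ≤ n) : 0 ≤ 𝓔.ex (fun ω => X n ω ^ 2) :=
  ex_nonneg (sq_isL1 (H.mem n hn) (H.sq n hn)) fun _ => sq_nonneg _

theorem sSq_mono : Monotone (𝓔.sSq X) := fun _ _ hmn =>
  Finset.sum_le_sum_of_subset_of_nonneg (Finset.Icc_subset_Icc_right hmn) fun j hj _ =>
    H.sigma_nonneg j (Finset.mem_Icc.1 hj).1

omit H in
theorem sSq_zero : 𝓔.sSq X 0 = 0 := by simp [sSq]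

theorem sSq_nonneg (n : ℕ) : 0 ≤ 𝓔.sSq X n := sSq_zero (X := X) (𝓔 := 𝓔) ▸ H.sSq_mono n.zero_le

omit H in
theorem an_eq (n : ℕ) : 𝓔.an X n = amp (𝓔.sSq X n) := rfl

/-- If `s_n²` stayed bounded, then beyond an index `n₀` with `s_{n₀} > 0` the series (iii) with `δ =
1`, which has no logarithm, would be at most `s_{n₀}⁻² ∑ E[X_n²] < ∞`. -/
theorem sSq_tendsto : Tendsto (𝓔.sSq X) atTop atTop := by
  rcases tendsto_atTop_of_monotone H.sSq_mono with h | ⟨l, hl⟩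
  · exact h
  exfalso
  have hle : ∀ n, 𝓔.sSq X n ≤ l := H.sSq_mono.ge_of_tendsto hl
  have hd := H.div 1 one_pos
  by_cases hz : ∀ n, 𝓔.sSq X n = 0
  · simp [hz] at hd
  push Not at hz
  obtain ⟨n₀, hn₀⟩ := hz
  have hn₀' : 0 < 𝓔.sSq X n₀ := lt_of_le_of_ne (H.sSq_nonneg _) hn₀.symm
  rw [← ENNReal.summable.sum_add_tsum_nat_add' (k := n₀)] at hd
  rw [ENNReal.add_eq_top] at hd
  rcases hd with hd | hd
  · exact absurd hd (by simp [ENNReal.sum_eq_top])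
  have hs : HasSum (fun n => 𝓔.ex (fun ω => X (n + 1) ω ^ 2)) l := by
    rw [hasSum_iff_tendsto_nat_of_nonneg (fun n => H.sigma_nonneg (n + 1) (by omega))]
    refine hl.congr fun n => ?_
    rw [sSq, Finset.range_eq_Ico, Finset.sum_Ico_add' (fun j => 𝓔.ex (fun ω => X j ω ^ 2)) 0 n 1]
    rfl
  have hs2 : Summable (fun n => (𝓔.sSq X n₀)⁻¹ * 𝓔.ex (fun ω => X (n + n₀ + 1) ω ^ 2)) :=
    ((summable_nat_add_iff n₀).2 hs.summable).mul_left _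
  have : ∑' n : ℕ, ENNReal.ofReal ((𝓔.sSq X n₀)⁻¹ * 𝓔.ex (fun ω => X (n + n₀ + 1) ω ^ 2)) = ∞ := by
    rw [← top_le_iff, ← hd]
    refine ENNReal.tsum_le_tsum fun n => ENNReal.ofReal_le_ofReal ?_
    simp only [sub_self, Real.rpow_zero, mul_one]
    refine mul_le_mul_of_nonneg_right ?_ (H.sigma_nonneg _ (by omega))
    exact inv_anti₀ hn₀' (H.sSq_mono (by omega))
  exact hs2.tsum_ofReal_ne_top this

end LILHyp

end SublinearExpectationSpace

/-! ### Exponential moments over variance blocks. -/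

namespace SublinearExpectationSpace

variable {Ω : Type*} [MeasurableSpace Ω] {𝓔 : SublinearExpectationSpace Ω} {X : ℕ → Ω → ℝ}

/-- Second order bounds, up to an error `c`, for the exponential moment at `h` of `Y` truncated
from above at `y`. -/
structure ExpMoment (𝓔 : SublinearExpectationSpace Ω) (Y : Ω → ℝ) (η h y c : ℝ) : Prop where
  upper : 𝓔.ex (fun ω => Real.exp (h * min (Y ω) y)) ≤
    1 + h * 𝓔.ex Y + (1 + η) * (h ^ 2 * 𝓔.ex (fun ω => Y ω ^ 2)) / 2 + c
  lower : η ≤ h * y → 1 - h * 𝓔.ex (fun ω => -Y ω) +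
    (1 - η) * (h ^ 2 * 𝓔.ex (fun ω => Y ω ^ 2)) / 2 - c ≤
      𝓔.ex (fun ω => Real.exp (h * min (Y ω) y))
  abs_le : h * 𝓔.ex (fun ω => |Y ω|) ≤ η + c
  sq_le : h ^ 2 * 𝓔.ex (fun ω => Y ω ^ 2) ≤ η ^ 2 + c

theorem expMoment_of_excess {Y : Ω → ℝ} (hY : Y ∈ 𝓔.H) (hY2 : 𝓔.E (fun ω => Y ω ^ 2) < ⊤)
    {y h b η p : ℝ} (hη : 0 < η) (hη1 : η ≤ 1) (hh : 0 ≤ h) (hy : 0 ≤ y)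
    (hp : 2 ≤ p) (hb : h * b ≤ η / 2) (hW : 𝓔.IsL1 (fun ω => max (|Y ω| - b) 0 ^ p)) :
    𝓔.ExpMoment Y η h y (3 * (2 / η) ^ p * Real.exp (h * y) * h ^ p *
      𝓔.ex (fun ω => max (|Y ω| - b) 0 ^ p)) := by
  have key := fun x => exp_min_bounds (x := x) hη hη1 hh hy hp hb
  set K := 3 * (2 / η) ^ p * Real.exp (h * y) * h ^ p with hK
  have hK0 : 0 ≤ K := by positivity
  have L1 := isL1_of_sq hY hY2
  have L2 := sq_isL1 hY hY2
  have LE : 𝓔.IsL1 (fun ω => Real.exp (h * min (Y ω) y)) := (bddLip_exp_min hh y).isL1 hY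
  have L2' := (L2.const_mul (h ^ 2))
  constructor
  · have a1 := ((L1.const_mul h).add (L2'.const_mul ((1 + η) / 2))).add (hW.const_mul K)
    refine (LE.ex_mono ((IsL1.const 1).add a1) fun ω => ?_).trans ?_
    · linarith [(key (Y ω)).1]
    · rw [ex_const_add a1]
      have i1 := ((L1.const_mul h).add (L2'.const_mul ((1 + η) / 2))).ex_add_le (hW.const_mul K)
      have i2 := (L1.const_mul h).ex_add_le (L2'.const_mul ((1 + η) / 2))
      rw [L1.ex_const_mul hh, L2'.ex_const_mul (by positivity),
        L2.ex_const_mul (by positivity)] at i2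
      rw [hW.ex_const_mul hK0] at i1
      linarith
  · intro hηy
    have a1 := ((L2'.const_mul ((1 - η) / 2)).sub (L1.neg.const_mul h)).sub (hW.const_mul K)
    refine le_trans ?_ (((IsL1.const 1).add a1).ex_mono LE fun ω => ?_)
    · rw [ex_const_add a1]
      have i1 := ((L2'.const_mul ((1 - η) / 2)).sub (L1.neg.const_mul h)).ex_sub_le
        (hW.const_mul K)
      have i2 := (L2'.const_mul ((1 - η) / 2)).ex_sub_le (L1.neg.const_mul h)
      rw [L1.neg.ex_const_mul hh, L2'.ex_const_mul (by linarith),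
        L2.ex_const_mul (by positivity)] at i2
      rw [hW.ex_const_mul hK0] at i1
      linarith
    · linarith [(key (Y ω)).2.1 hηy]
  · rw [← L1.abs.ex_const_mul hh, ← hW.ex_const_mul hK0, ← ex_const_add (hW.const_mul K)]
    exact (L1.abs.const_mul h).ex_mono ((IsL1.const _).add (hW.const_mul K))
      fun ω => (key (Y ω)).2.2.1
  · rw [← L2.ex_const_mul (by positivity), ← hW.ex_const_mul hK0, ← ex_const_add (hW.const_mul K)]
    exact L2'.ex_mono ((IsL1.const _).add (hW.const_mul K)) fun ω => (key (Y ω)).2.2.2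

theorem excess_le_excess {Y : Ω → ℝ} (hY : Y ∈ 𝓔.H) {b b' p : ℝ} (hp : 2 ≤ p) (hb : b ≤ b') :
    𝓔.E (fun ω => max (|Y ω| - b') 0 ^ p) ≤ 𝓔.E (fun ω => max (|Y ω| - b) 0 ^ p) :=
  𝓔.mono _ (comp_mem_one hY (isLocLip_excess_rpow (by linarith) b)) _
    (comp_mem_one hY (isLocLip_excess_rpow (by linarith) b')) fun ω => by
      have : max (|Y ω| - b') 0 ≤ max (|Y ω| - b) 0 := max_le_max_right _ (by linarith)
      have h0 : 0 ≤ max (|Y ω| - b') 0 := le_max_right _ _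
      exact Real.rpow_le_rpow h0 this (by linarith)

/-- Truncated excess moments, at the level `b`, of the variables that are not trivial. -/
def excessAt (𝓔 : SublinearExpectationSpace Ω) (X : ℕ → Ω → ℝ) (p b : ℝ) (j : ℕ) : ℝ≥0∞ :=
  if 𝓔.sSq X j = 0 then 0 else (𝓔.E (fun ω => max (|X j ω| - b) 0 ^ p)).toENNReal

namespace LILHyp

variable (H : 𝓔.LILHyp X)

include H

/-- The last index of the blocks up to the `k`-th one. -/
theorem le_blockEnd_iff {D : ℝ} (hD : 0 < D) (k n : ℕ) :
    n ≤ lastBelow (𝓔.sSq X) (D ^ (k + 1)) ↔ 𝓔.sSq X n < D ^ (k + 1) :=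
  le_lastBelow_iff H.sSq_mono H.sSq_tendsto (by rw [sSq_zero]; positivity)

/-- The level `α s_n / t_n` equals `α / tilt (s_n²)`, which increases with the variance. The level
taken at `D ^ (k + 1)` is thus the highest up to the end of block `k` and gives the smallest excess.
-/
theorem excessAt_le {D α p : ℝ} (hα : 0 ≤ α) (hp : 2 ≤ p) {k j n : ℕ}
    (hj : 1 ≤ j) (hn : 𝓔.sSq X n < D ^ (k + 1)) (hn0 : 0 < 𝓔.sSq X n) :
    𝓔.excessAt X p (α / tilt (D ^ (k + 1))) j ≤ 𝓔.excess X p α n j := by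
  unfold excessAt
  split_ifs with h
  · exact zero_le
  · refine EReal.toENNReal_le_toENNReal (excess_le_excess (H.mem j hj) hp ?_)
    have h1 : α * 𝓔.sd X n / 𝓔.tn X n = α / tilt (𝓔.sSq X n) := by
      rw [tilt, sd, tn, div_div_eq_mul_div]; rfl
    rw [h1]
    exact div_le_div_of_nonneg_left hα (tilt_pos (hn0.trans hn)) (tilt_anti hn0 hn.le)

/-- Expand the power `d + 1` of the sum for block `k` by `ENNReal.sum_rpow_succ_le`, compare with
`Γ_n Λ_n ^ d`, and sum over `k` first. By `tsum_inv_amp_rpow_le` with `r = p (d + 1)`, the weights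
then add up to a multiple of `a_n ^ (-r)`, which recovers (ii). -/
theorem tsum_excess_lt_top {D α p d : ℝ} (hD : 1 < D) (hα : 0 ≤ α) (hp : 2 ≤ p) (hd : 0 ≤ d)
    (hfin : ∑' n : ℕ, (if 𝓔.sd X (n + 1) = 0 then 0 else
      𝓔.Gam X p α (n + 1) / ENNReal.ofReal (𝓔.an X (n + 1) ^ p) *
        (𝓔.Lam X p α (n + 1) / ENNReal.ofReal (𝓔.an X (n + 1) ^ p)) ^ d) < ∞) :
    ∑' k : ℕ, ((∑ j ∈ Finset.Icc 1 (lastBelow (𝓔.sSq X) (D ^ (k + 1))),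
      𝓔.excessAt X p (α / tilt (D ^ (k + 1))) j) / ENNReal.ofReal (amp (D ^ k) ^ p)) ^ (d + 1)
        < ∞ := by
  have hD0 : 0 < D := by linarith
  set T : ℕ → ℝ≥0∞ := fun j => if 𝓔.sSq X j = 0 then 0 else 𝓔.Gam X p α j * 𝓔.Lam X p α j ^ d
    with hT
  set r := p * (d + 1) with hr
  have hr2 : 2 ≤ r := by nlinarith
  have hpow : ∀ a : ℝ, 0 < a → ENNReal.ofReal (a ^ p) ^ (d + 1) = ENNReal.ofReal (a ^ r) := by
    intro a ha
    rw [ENNReal.ofReal_rpow_of_pos (Real.rpow_pos_of_pos ha p), ← Real.rpow_mul ha.le]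
  have h1 : ∀ k : ℕ, ((∑ j ∈ Finset.Icc 1 (lastBelow (𝓔.sSq X) (D ^ (k + 1))),
      𝓔.excessAt X p (α / tilt (D ^ (k + 1))) j) / ENNReal.ofReal (amp (D ^ k) ^ p)) ^ (d + 1) ≤
      ENNReal.ofReal (d + 1) * ∑' n : ℕ, T (n + 1) * (if 𝓔.sSq X (n + 1) < D ^ (k + 1) then
        (ENNReal.ofReal (amp (D ^ k) ^ r))⁻¹ else 0) := by
    intro k
    rw [ENNReal.div_rpow_of_nonneg _ _ (by linarith), hpow _ (amp_pos (by positivity)),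
      div_eq_mul_inv]
    refine (mul_le_mul_left (ENNReal.sum_rpow_succ_le _ hd _) _).trans ?_
    rw [mul_assoc, Finset.sum_mul]
    refine mul_le_mul_right ?_ _
    have hsum : ∀ (g : ℕ → ℝ≥0∞) (N : ℕ), ∑ j ∈ Finset.Icc 1 N, g j =
        ∑ n ∈ Finset.range N, g (n + 1) := fun g N => by
      rw [Finset.range_eq_Ico, Finset.sum_Ico_add' g 0 N 1]; rfl
    rw [hsum]
    refine le_trans (Finset.sum_le_sum fun n hn => ?_) (ENNReal.sum_le_tsum _)
    rw [Finset.mem_range] at hn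
    have hlt := (H.le_blockEnd_iff hD0 k (n + 1)).1 (by omega)
    rw [if_pos hlt]
    refine mul_le_mul_left ?_ _
    simp only [hT]
    split_ifs with hz
    · simp [excessAt, hz]
    · have hpos := lt_of_le_of_ne (H.sSq_nonneg (n + 1)) (Ne.symm hz)
      have e1 := H.excessAt_le hα hp (by omega : 1 ≤ n + 1) hlt hpos
      refine mul_le_mul' e1 (ENNReal.rpow_le_rpow (Finset.sum_le_sum fun i hi => ?_) hd)
      exact H.excessAt_le hα hp (Finset.mem_Icc.1 hi).1 hlt hpos
  refine (ENNReal.tsum_le_tsum h1).trans_lt ?_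
  rw [ENNReal.tsum_mul_left, ENNReal.tsum_comm]
  refine ENNReal.mul_lt_top ENNReal.ofReal_lt_top ?_
  have h2 : ∀ n : ℕ, ∑' k : ℕ, T (n + 1) * (if 𝓔.sSq X (n + 1) < D ^ (k + 1) then
        (ENNReal.ofReal (amp (D ^ k) ^ r))⁻¹ else 0) ≤ ENNReal.ofReal (D ^ r * (1 - D⁻¹)⁻¹) *
      (if 𝓔.sd X (n + 1) = 0 then 0 else
      𝓔.Gam X p α (n + 1) / ENNReal.ofReal (𝓔.an X (n + 1) ^ p) *
        (𝓔.Lam X p α (n + 1) / ENNReal.ofReal (𝓔.an X (n + 1) ^ p)) ^ d) := by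
    intro n
    rw [ENNReal.tsum_mul_left]
    by_cases hz : 𝓔.sSq X (n + 1) = 0
    · simp [hT, hz]
    have hpos := lt_of_le_of_ne (H.sSq_nonneg (n + 1)) (Ne.symm hz)
    have hsd : 𝓔.sd X (n + 1) ≠ 0 := (Real.sqrt_pos.2 hpos).ne'
    rw [if_neg hsd]
    simp only [hT, if_neg hz]
    refine (mul_le_mul_right (tsum_inv_amp_rpow_le hD hr2 hpos) _).trans (le_of_eq ?_)
    have ha : 0 < 𝓔.an X (n + 1) := amp_pos hpos
    rw [ENNReal.div_rpow_of_nonneg _ _ hd, div_eq_mul_inv, div_eq_mul_inv, ← an_eq, ← hpow _ ha,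
      ENNReal.rpow_add_of_nonneg _ _ hd zero_le_one, ENNReal.rpow_one,
      ENNReal.mul_inv (Or.inr ENNReal.ofReal_ne_top)
        (Or.inr (by simpa using Real.rpow_pos_of_pos ha p))]
    ring
  refine (ENNReal.tsum_le_tsum h2).trans_lt ?_
  rw [ENNReal.tsum_mul_left]
  exact ENNReal.mul_lt_top ENNReal.ofReal_lt_top hfin

/-- Exponential moments over blocks: below the variance level `D ^ (k + 1)`, the errors of the
second order bounds add up to a multiple of `q k`, where a power of `q` is summable. -/
theorem exists_expMoment {η D : ℝ} (hη : 0 < η) (hη1 : η ≤ 1) (hD : 1 < D) :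
    ∃ (p d C : ℝ) (q : ℕ → ℝ), 2 ≤ p ∧ 0 ≤ d ∧ 0 ≤ C ∧ (∀ k, 0 ≤ q k) ∧
      Summable (fun k => q k ^ (d + 1)) ∧
      ∀ (k : ℕ) (h y : ℝ), 0 ≤ h → h ≤ tilt (D ^ k) → 0 ≤ y → ∃ c : ℕ → ℝ, (∀ j, 0 ≤ c j) ∧
        (∀ j ∈ Finset.Icc 1 (lastBelow (𝓔.sSq X) (D ^ (k + 1))),
          𝓔.ExpMoment (X j) η h y (c j)) ∧
        ∑ j ∈ Finset.Icc 1 (lastBelow (𝓔.sSq X) (D ^ (k + 1))), c j ≤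
          C * Real.exp (h * y) * (h * amp (D ^ k)) ^ p * q k := by
  have hD0 : 0 < D := by linarith
  -- Chosen so that `h b_k ≤ α tilt (D ^ k) / tilt (D ^ (k + 1)) ≤ α D = η / 2` for every admissible
  -- `h`.
  set α := η / (2 * D) with hα
  have hα0 : 0 < α := by positivity
  obtain ⟨p, d, hp, hd, hfin⟩ := H.mom α hα0
  set b : ℕ → ℝ := fun k => α / tilt (D ^ (k + 1)) with hb
  set N : ℕ → ℕ := fun k => lastBelow (𝓔.sSq X) (D ^ (k + 1)) with hN
  set g : ℕ → ℕ → ℝ := fun k j => (𝓔.excessAt X p (b k) j).toReal with hg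
  have hlt := H.tsum_excess_lt_top hD hα0.le hp hd hfin
  have hterm := ENNReal.ne_top_of_tsum_ne_top hlt.ne
  have hampp : ∀ k : ℕ, 0 < amp (D ^ k) ^ p := fun k =>
    Real.rpow_pos_of_pos (amp_pos (by positivity)) p
  have hsumfin : ∀ k, ∑ j ∈ Finset.Icc 1 (N k), 𝓔.excessAt X p (b k) j ≠ ⊤ := by
    intro k hk
    refine hterm k ?_
    change ((∑ j ∈ Finset.Icc 1 (N k), 𝓔.excessAt X p (b k) j) / _) ^ (d + 1) = ⊤
    rw [hk, ENNReal.top_div_of_ne_top ENNReal.ofReal_ne_top,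
      ENNReal.top_rpow_of_pos (by linarith)]
  refine ⟨p, d, 3 * (2 / η) ^ p, fun k => (∑ j ∈ Finset.Icc 1 (N k), g k j) / amp (D ^ k) ^ p,
    hp, hd, by positivity, fun k => ?_, ?_, ?_⟩
  · exact div_nonneg (Finset.sum_nonneg fun j _ => ENNReal.toReal_nonneg) (hampp k).le
  · refine (ENNReal.summable_toReal hlt.ne).congr fun k => ?_
    rw [← ENNReal.toReal_rpow, ENNReal.toReal_div, ENNReal.toReal_sum,
      ENNReal.toReal_ofReal (hampp k).le]
    intro j hj
    exact ENNReal.sum_ne_top.1 (hsumfin k) j hj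
  · intro k h y hh hhk hy
    have hbk : h * b k ≤ η / 2 := by
      have h1 : tilt (D ^ k) ≤ D * tilt (D ^ (k + 1)) := by
        rw [pow_succ']; exact tilt_le_mul hD.le (by positivity)
      have h2 : 0 < tilt (D ^ (k + 1)) := tilt_pos (by positivity)
      rw [hb, hα]
      simp only
      rw [← mul_div_assoc, div_le_iff₀ h2, ← mul_div_assoc, div_le_iff₀ (by positivity)]
      nlinarith [mul_le_mul_of_nonneg_right (hhk.trans h1) hη.le]
    refine ⟨fun j => 3 * (2 / η) ^ p * Real.exp (h * y) * h ^ p * g k j, fun j => ?_,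
      fun j hj => ?_, ?_⟩
    · have : 0 ≤ g k j := ENNReal.toReal_nonneg
      positivity
    · have hj1 := (Finset.mem_Icc.1 hj).1
      have hmem := H.mem j hj1
      -- While the variance is still zero, (ii) may carry no information on the `p`-th excess of `X
      -- j`. The expansion is then used with exponent `2`, where the excess is dominated by `X j ^
      -- 2` and the error vanishes.
      by_cases hz : 𝓔.sSq X j = 0
      · have hg0 : g k j = 0 := by simp [hg, excessAt, hz]
        have hσ : 𝓔.ex (fun ω => X j ω ^ 2) = 0 := by
          refine le_antisymm ?_ (H.sigma_nonneg j hj1)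
          rw [← hz]
          exact Finset.single_le_sum (f := fun j => 𝓔.ex (fun ω => X j ω ^ 2))
            (fun i hi => H.sigma_nonneg i (Finset.mem_Icc.1 hi).1) (by simp [hj1])
        have hb0 : 0 ≤ b k := div_nonneg hα0.le (tilt_pos (by positivity)).le
        have hW := comp_mem_one hmem (isLocLip_excess_rpow (p := 2) (by norm_num) (b k))
        have hle : ∀ ω, max (|X j ω| - b k) 0 ^ (2 : ℝ) ≤ X j ω ^ 2 := fun ω => by
          rw [Real.rpow_two, ← sq_abs (X j ω)]
          exact pow_le_pow_left₀ (le_max_right _ _)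
            (max_le (by linarith) (abs_nonneg _)) 2
        have hW0 : ∀ ω, 0 ≤ max (|X j ω| - b k) 0 ^ (2 : ℝ) := fun ω => by positivity
        have L2 := sq_isL1 hmem (H.sq j hj1)
        have hWL : 𝓔.IsL1 (fun ω => max (|X j ω| - b k) 0 ^ (2 : ℝ)) :=
          IsL1.of_le hW L2.1 L2.lt_top fun ω => by rw [abs_of_nonneg (hW0 ω)]; exact hle ω
        have hWe : 𝓔.ex (fun ω => max (|X j ω| - b k) 0 ^ (2 : ℝ)) = 0 :=
          le_antisymm ((hWL.ex_mono L2 hle).trans hσ.le) (ex_nonneg hWL hW0)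
        have := expMoment_of_excess hmem (H.sq j hj1) hη hη1 hh hy le_rfl hbk hWL
        rw [hWe, mul_zero] at this
        simpa [hg0] using this
      · have hne := ENNReal.sum_ne_top.1 (hsumfin k) j hj
        rw [excessAt, if_neg hz] at hne
        have hmemW := comp_mem_one hmem (isLocLip_excess_rpow (p := p) (by linarith) (b k))
        have hW0 : ∀ ω, 0 ≤ max (|X j ω| - b k) 0 ^ p := fun ω => by positivity
        have hWL : 𝓔.IsL1 (fun ω => max (|X j ω| - b k) 0 ^ p) := by
          refine IsL1.of_le hmemW hmemW ?_ fun ω => (abs_of_nonneg (hW0 ω)).le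
          rw [lt_top_iff_ne_top]
          intro hc
          exact hne (by rw [hc, EReal.toENNReal_top])
        have hgk : g k j = 𝓔.ex (fun ω => max (|X j ω| - b k) 0 ^ p) := by
          simp only [hg]
          rw [excessAt, if_neg hz, ← hWL.coe_ex, EReal.toENNReal_of_ne_top (EReal.coe_ne_top _), EReal.toReal_coe,
            ENNReal.toReal_ofReal (ex_nonneg hWL hW0)]
        simp only [hgk]
        exact expMoment_of_excess hmem (H.sq j hj1) hη hη1 hh hy hp hbk hWL
    · have ha : 0 < amp (D ^ k) := amp_pos (by positivity)
      rw [← Finset.mul_sum, Real.mul_rpow hh ha.le]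
      have := (hampp k).ne'
      apply le_of_eq
      field_simp
      rfl

end LILHyp

end SublinearExpectationSpace

/-! ### Summable Chernoff bounds for block maxima. -/

/-- `log (D ^ k)` is linear in `k`, so `exp (-s llog (D ^ k))` is comparable to `k ^ (-s)` from
above. -/
theorem exists_mul_le_exp_llog {D : ℝ} (hD : 1 < D) :
    ∃ c : ℝ, 0 < c ∧ ∀ k : ℕ, c * (k + 1) ≤ Real.exp (llog (D ^ k)) := by
  have hl : 0 < Real.log D := Real.log_pos hD
  refine ⟨Real.log D / (1 + Real.log D), by positivity, fun k => ?_⟩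
  refine le_trans ?_ (tlog_le_exp_llog _)
  have h1 := one_le_tlog (D ^ k)
  have h2 : k * Real.log D ≤ tlog (D ^ k) := by
    rw [← Real.log_pow]; exact log_le_tlog (by positivity)
  rw [div_mul_eq_mul_div, div_le_iff₀ (by positivity)]
  nlinarith

theorem summable_exp_neg_llog {D s : ℝ} (hD : 1 < D) (hs : 1 < s) :
    Summable (fun k : ℕ => Real.exp (-(s * llog (D ^ k)))) := by
  obtain ⟨c, hc, h⟩ := exists_mul_le_exp_llog hD
  have h1 : Summable (fun k : ℕ => c ^ (-s) * ((k + 1 : ℕ) : ℝ) ^ (-s)) :=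
    ((summable_nat_add_iff 1).2 (Real.summable_nat_rpow.2 (by linarith))).mul_left _
  refine Summable.of_nonneg_of_le (fun k => (Real.exp_pos _).le) (fun k => ?_) h1
  rw [← Real.mul_rpow hc.le (by positivity)]
  have h2 : Real.exp (-(s * llog (D ^ k))) = Real.exp (llog (D ^ k)) ^ (-s) := by
    rw [← Real.exp_mul]; ring_nf
  rw [h2]
  refine Real.rpow_le_rpow_of_nonpos (by positivity) ?_ (by linarith)
  have := h k
  push_cast; linarith

theorem rpow_mul_exp_neg_le {p s z : ℝ} (hp : 0 < p) (hs : 0 < s) (hz : 0 ≤ z) :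
    z ^ p * Real.exp (-(s * z)) ≤ (p / s) ^ p := by
  have h1 : s / p * z ≤ Real.exp (s / p * z) := by
    linarith [Real.add_one_le_exp (s / p * z)]
  have h2 := Real.rpow_le_rpow (by positivity) h1 hp.le
  rw [← Real.exp_mul, Real.mul_rpow (by positivity) hz] at h2
  have h3 : s / p * z * p = s * z := by field_simp
  rw [h3] at h2
  rw [Real.exp_neg, ← div_eq_mul_inv, div_le_iff₀ (Real.exp_pos _)]
  have h4 : (p / s) ^ p * (s / p) ^ p = 1 := by
    rw [← Real.mul_rpow (by positivity) (by positivity)]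
    have : p / s * (s / p) = 1 := by field_simp
    rw [this, Real.one_rpow]
  have h5 : 0 < (p / s) ^ p := by positivity
  calc z ^ p = (p / s) ^ p * ((s / p) ^ p * z ^ p) := by rw [← mul_assoc, h4, one_mul]
    _ ≤ _ := by gcongr

namespace SublinearExpectationSpace

variable {Ω : Type*} [MeasurableSpace Ω] {𝓔 : SublinearExpectationSpace Ω} {X : ℕ → Ω → ℝ}

/-- The event that a partial sum up to `n`, of the variables truncated from above at `y`,
reaches `x`. -/
def truncMaxEvent (X : ℕ → Ω → ℝ) (n : ℕ) (y x : ℝ) : Set Ω :=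
  {ω | ∃ m, 1 ≤ m ∧ m ≤ n ∧ x ≤ ∑ j ∈ Finset.Icc 1 m, min (X j ω) y}

namespace LILHyp

variable (H : 𝓔.LILHyp X)

include H

theorem measurable (n : ℕ) (hn : 1 ≤ n) : Measurable (X n) :=
  𝓔.measurable_of_mem _ (H.mem n hn)

theorem measurable_partialSum (n : ℕ) : Measurable (partialSum X n) := by
  unfold partialSum
  exact Finset.measurable_fun_sum _ fun j hj => H.measurable j (Finset.mem_Icc.1 hj).1

theorem measurableSet_truncMaxEvent (n : ℕ) (y x : ℝ) :
    MeasurableSet (truncMaxEvent X n y x) := by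
  unfold truncMaxEvent
  simp only [Set.ofPred_exists, Set.ofPred_and]
  refine MeasurableSet.iUnion fun m => (MeasurableSet.const _).inter
    ((MeasurableSet.const _).inter (measurableSet_le measurable_const ?_))
  exact Finset.measurable_fun_sum _ fun j hj =>
    (H.measurable j (Finset.mem_Icc.1 hj).1).min measurable_const

/-- Chernoff's bound for maxima: the factors `exp (h (X j ∧ y) - z j)` have expectation at most one,
so the maximal inequality applies. Since `z j ≥ 0`, the total compensator may replace the running
one. -/
theorem upCap_truncMax_le {n : ℕ} {h y x : ℝ} (hh : 0 ≤ h) {z : ℕ → ℝ} (hz : ∀ j, 0 ≤ z j)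
    (hexp : ∀ j ∈ Finset.Icc 1 n, 𝓔.ex (fun ω => Real.exp (h * min (X j ω) y)) ≤
      Real.exp (z j)) :
    𝓔.upCap (truncMaxEvent X n y x) ≤
      ENNReal.ofReal (2 * Real.exp (∑ j ∈ Finset.Icc 1 n, z j - h * x)) := by
  have hbl : ∀ j, BddLip (fun u => Real.exp (-z j) * Real.exp (h * min u y)) := by
    intro j
    obtain ⟨C, hC, hb, hl⟩ := bddLip_exp_min hh y
    refine ⟨Real.exp (-z j) * C, by positivity, fun u => ?_, fun u v => ?_⟩
    · rw [abs_mul, abs_of_pos (Real.exp_pos _)]; gcongr; exact hb u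
    · rw [← mul_sub, abs_mul, abs_of_pos (Real.exp_pos _), mul_assoc]; gcongr; exact hl u v
  have key := H.indep.upCap_max_prod_le H.mem (n := n)
    (ξ := fun j u => Real.exp (-z j) * Real.exp (h * min u y)) (fun j _ => hbl j)
    (fun j _ u => by positivity) (fun j hj => ?_)
    (l := Real.exp (h * x - ∑ j ∈ Finset.Icc 1 n, z j)) (Real.exp_pos _)
  · refine (upCap_mono ?_).trans (key.trans (le_of_eq ?_))
    · rintro ω ⟨m, h1, h2, h3⟩
      refine ⟨m, h1, h2, ?_⟩
      simp only [← Real.exp_add]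
      rw [← Real.exp_sum, Real.exp_le_exp, Finset.sum_add_distrib, ← Finset.mul_sum,
        Finset.sum_neg_distrib]
      have := mul_le_mul_of_nonneg_left h3 hh
      have h4 : ∑ j ∈ Finset.Icc 1 m, z j ≤ ∑ j ∈ Finset.Icc 1 n, z j :=
        Finset.sum_le_sum_of_subset_of_nonneg (Finset.Icc_subset_Icc_right h2) fun j _ _ => hz j
      linarith
    · rw [div_eq_mul_inv, ← Real.exp_neg, neg_sub]
  · have hL := (bddLip_exp_min hh y).isL1 (H.mem j (Finset.mem_Icc.1 hj).1)
    rw [hL.ex_const_mul (Real.exp_pos _).le]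
    calc _ ≤ Real.exp (-z j) * Real.exp (z j) := by gcongr; exact hexp j hj
      _ = 1 := by rw [← Real.exp_add]; simp

theorem amp_tendsto : Tendsto (fun n => 𝓔.an X n) atTop atTop := by
  refine tendsto_atTop_mono (fun n => ?_) (Real.tendsto_sqrt_atTop.comp H.sSq_tendsto)
  rw [an_eq, amp]
  have h1 : 1 ≤ √(2 * llog (𝓔.sSq X n)) :=
    Real.one_le_sqrt.2 (by linarith [one_le_llog (𝓔.sSq X n)])
  exact le_mul_of_one_le_right (Real.sqrt_nonneg _) h1

theorem an_mono : Monotone (𝓔.an X) := fun _ _ h => amp_mono (H.sSq_mono h)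

theorem eventually_mean_le {κ : ℝ} (hκ : 0 < κ) : ∀ᶠ n in atTop,
    ∑ j ∈ Finset.Icc 1 n, |𝓔.ex (X j)| + ∑ j ∈ Finset.Icc 1 n, |𝓔.ex (fun ω => -X j ω)| ≤
      κ * 𝓔.an X n := by
  filter_upwards [H.mean.eventually (gt_mem_nhds hκ), H.amp_tendsto.eventually_gt_atTop 0]
    with n h1 h2
  rw [div_lt_iff₀ h2] at h1
  refine le_of_eq_of_le ?_ h1.le
  congr 1
  refine Finset.sum_congr rfl fun j _ => ?_
  simp [conjE, ex]

theorem tendsto_blockEnd {D : ℝ} (hD : 1 < D) :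
    Tendsto (fun k => lastBelow (𝓔.sSq X) (D ^ (k + 1))) atTop atTop := by
  rw [tendsto_atTop]
  intro n
  have h := (tendsto_pow_atTop_atTop_of_one_lt hD).comp (tendsto_add_atTop_nat 1)
  filter_upwards [h.eventually_gt_atTop (𝓔.sSq X n)] with k hk
  exact (H.le_blockEnd_iff (by linarith) k n).2 hk

theorem blockEnd_lt {D : ℝ} (hD : 0 < D) (k : ℕ) :
    𝓔.sSq X (lastBelow (𝓔.sSq X) (D ^ (k + 1))) < D ^ (k + 1) :=
  (H.le_blockEnd_iff hD k _).1 le_rfl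

theorem eventually_block_mean_le {κ D : ℝ} (hκ : 0 < κ) (hD : 1 < D) : ∀ᶠ k : ℕ in atTop,
    ∑ j ∈ Finset.Icc 1 (lastBelow (𝓔.sSq X) (D ^ (k + 1))), |𝓔.ex (X j)| +
      ∑ j ∈ Finset.Icc 1 (lastBelow (𝓔.sSq X) (D ^ (k + 1))), |𝓔.ex (fun ω => -X j ω)| ≤
      κ * 𝓔.an X (lastBelow (𝓔.sSq X) (D ^ (k + 1))) :=
  (H.tendsto_blockEnd hD).eventually (H.eventually_mean_le hκ)

/-- Summable bounds for the maximal truncated partial sums over blocks. -/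
theorem exists_summable_block_bound {ε : ℝ} (hε : 0 < ε) (hε1 : ε ≤ 1) :
    ∃ (D τ : ℝ) (B : ℕ → ℝ) (K : ℕ), 1 < D ∧ 0 < τ ∧ (∀ k, 0 ≤ B k) ∧ Summable B ∧ ∀ k ≥ K,
      𝓔.upCap (truncMaxEvent X (lastBelow (𝓔.sSq X) (D ^ (k + 1))) (τ * amp (D ^ k))
        ((1 + ε) * amp (D ^ k))) ≤ ENNReal.ofReal (B k) := by
  set η := ε / 8 with hη
  set D := 1 + ε / 8 with hDdef
  have hD : 1 < D := by rw [hDdef]; linarith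
  have hD0 : 0 < D := by linarith
  obtain ⟨p, d, C, q, hp, hd, hC, hq, hqs, hmom⟩ :=
    H.exists_expMoment (η := η) (by positivity) (by linarith) hD
  set τ := 1 / (4 * (d + 1)) with hτ
  have hτ0 : 0 < τ := by positivity
  obtain ⟨K, hK⟩ := eventually_atTop.1 (H.eventually_block_mean_le (κ := ε / 8) (by positivity) hD)
  set C' := Real.exp (C * (p / τ) ^ p) with hC'
  have hC'1 : 1 ≤ C' := Real.one_le_exp (by positivity)
  set F : ℕ → Set Ω := fun k => truncMaxEvent X (lastBelow (𝓔.sSq X) (D ^ (k + 1)))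
    (τ * amp (D ^ k)) ((1 + ε) * amp (D ^ k)) with hF
  -- Here `z = h amp (D ^ k)` is the free Chernoff parameter. The bound by `2 llog` keeps `h` below
  -- `tilt (D ^ k)`, and the last condition keeps the accumulated moment error below the constant `C
  -- (p / τ) ^ p`.
  have main : ∀ k ≥ K, ∀ z, 0 ≤ z → z ≤ 2 * llog (D ^ k) → Real.exp (τ * z) * q k ≤
      Real.exp (-(τ * z)) → 𝓔.upCap (F k) ≤
        ENNReal.ofReal (2 * C' * Real.exp (-((1 + ε) / 2 * z))) := by
    intro k hk z hz hzl hzq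
    set A := amp (D ^ k) with hA
    have hDk : 0 < D ^ k := by positivity
    have hA0 : 0 < A := amp_pos hDk
    set h := z / A with hh
    have hh0 : 0 ≤ h := by positivity
    have hhA : h * A = z := div_mul_cancel₀ _ hA0.ne'
    have hht : h ≤ tilt (D ^ k) := by
      rw [hh, div_le_iff₀ hA0, tilt_mul_amp hDk]; exact hzl
    obtain ⟨c, hc0, hcE, hcs⟩ := hmom k h (τ * A) hh0 hht (by positivity)
    set N := lastBelow (𝓔.sSq X) (D ^ (k + 1)) with hN
    set w : ℕ → ℝ := fun j => h * |𝓔.ex (X j)| +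
      (1 + η) * (h ^ 2 * |𝓔.ex (fun ω => X j ω ^ 2)|) / 2 + c j with hw
    have hw0 : ∀ j, 0 ≤ w j := fun j => by have := hc0 j; positivity
    refine (H.upCap_truncMax_le hh0 hw0 (fun j hj => ?_)).trans (ENNReal.ofReal_le_ofReal ?_)
    · refine (hcE j hj).upper.trans (le_trans ?_ (Real.add_one_le_exp _))
      have h1 := mul_le_mul_of_nonneg_left (le_abs_self (𝓔.ex (X j))) hh0
      have h2 := mul_le_mul_of_nonneg_left
        (mul_le_mul_of_nonneg_left (le_abs_self (𝓔.ex (fun ω => X j ω ^ 2))) (sq_nonneg h))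
        (show 0 ≤ 1 + η by positivity)
      simp only [hw]
      linarith
    · have hμ := hK k hk
      have hsum : ∑ j ∈ Finset.Icc 1 N, w j = h * ∑ j ∈ Finset.Icc 1 N, |𝓔.ex (X j)| +
          (1 + η) * (h ^ 2 * 𝓔.sSq X N) / 2 + ∑ j ∈ Finset.Icc 1 N, c j := by
        simp only [hw, Finset.sum_add_distrib, ← Finset.mul_sum, ← Finset.sum_div]
        congr 5
        refine Finset.sum_congr rfl fun j hj => abs_of_nonneg ?_
        exact H.sigma_nonneg j (Finset.mem_Icc.1 hj).1
      have hsN : 𝓔.sSq X N ≤ D * D ^ k := by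
        rw [← pow_succ']; exact (H.blockEnd_lt hD0 k).le
      have haN : 𝓔.an X N ≤ D * A :=
        (amp_mono hsN).trans (amp_mul_le hD.le hDk.le)
      have hmean : h * ∑ j ∈ Finset.Icc 1 N, |𝓔.ex (X j)| ≤ ε / 8 * D * z := by
        have h0 : 0 ≤ ∑ j ∈ Finset.Icc 1 N, |𝓔.ex (fun ω => -X j ω)| :=
          Finset.sum_nonneg fun _ _ => abs_nonneg _
        calc _ ≤ h * (ε / 8 * (D * A)) := by
              gcongr
              refine le_trans ?_ (hμ.trans (mul_le_mul_of_nonneg_left haN (by positivity)))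
              linarith
          _ = ε / 8 * D * (h * A) := by ring
          _ = _ := by rw [hhA]
      have hvar : h ^ 2 * 𝓔.sSq X N ≤ D * z := by
        calc h ^ 2 * 𝓔.sSq X N ≤ h ^ 2 * (D * D ^ k) := by gcongr
          _ = D * h * (h * D ^ k) := by ring
          _ ≤ D * h * (tilt (D ^ k) * D ^ k) := by gcongr
          _ = D * (h * A) := by rw [tilt_mul_self hDk]; ring
          _ = _ := by rw [hhA]
      have herr : ∑ j ∈ Finset.Icc 1 N, c j ≤ C * (p / τ) ^ p := by
        have e1 : h * (τ * A) = τ * z := by rw [← hhA]; ring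
        rw [e1, hhA] at hcs
        calc _ ≤ C * Real.exp (τ * z) * z ^ p * q k := hcs
          _ = C * (z ^ p * (Real.exp (τ * z) * q k)) := by ring
          _ ≤ C * (z ^ p * Real.exp (-(τ * z))) := by gcongr
          _ ≤ _ := by gcongr; exact rpow_mul_exp_neg_le (by linarith) hτ0 hz
      rw [hsum, hC', mul_assoc 2 (Real.exp _), ← Real.exp_add]
      refine mul_le_mul_of_nonneg_left (Real.exp_le_exp.2 ?_) zero_le_two
      have e2 : h * ((1 + ε) * A) = (1 + ε) * z := by rw [← hhA]; ring
      rw [e2]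
      have e3 : (1 + η) * (h ^ 2 * 𝓔.sSq X N) ≤ (1 + η) * (D * z) := by gcongr
      have e4 : (1 + η) * (D * z) = (1 + ε / 8) ^ 2 * z := by rw [hη, hDdef]; ring
      have e5 : ε / 8 * D * z = (ε / 8 + ε ^ 2 / 64) * z := by rw [hDdef]; ring
      have e6 : ε ^ 2 * z ≤ ε * z := by
        have : ε ^ 2 ≤ ε := by nlinarith
        gcongr
      nlinarith [mul_nonneg hε.le hz]
  refine ⟨D, τ, fun k => 2 * C' * (Real.exp (-((1 + ε) * llog (D ^ k))) + q k ^ (d + 1)), K, hD,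
    hτ0, fun k => ?_, ?_, fun k hk => ?_⟩
  · have := Real.rpow_nonneg (hq k) (d + 1)
    positivity
  · exact ((summable_exp_neg_llog hD (by linarith)).add hqs).mul_left _
  · have hqp := Real.rpow_nonneg (hq k) (d + 1)
    have hep := Real.exp_pos (-((1 + ε) * llog (D ^ k)))
    have hl0 := llog_pos (D ^ k)
    -- For small `q k` the full value `z = 2 llog` is allowed. For intermediate `q k`, take the
    -- largest `z` with `exp (2 τ z) q k ≤ 1`; the choice `τ = 1 / (4 (d + 1))` turns the bound into
    -- `q k ^ ((1 + ε) (d + 1))`. For `q k > 1` the trivial bound suffices.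
    rcases le_or_gt (q k) (Real.exp (-(4 * τ * llog (D ^ k)))) with h1 | h1
    · refine (main k hk (2 * llog (D ^ k)) (by positivity) le_rfl ?_).trans
        (ENNReal.ofReal_le_ofReal ?_)
      · calc _ ≤ Real.exp (τ * (2 * llog (D ^ k))) * Real.exp (-(4 * τ * llog (D ^ k))) := by gcongr
          _ = _ := by rw [← Real.exp_add]; ring_nf
      · have e1 : (1 + ε) / 2 * (2 * llog (D ^ k)) = (1 + ε) * llog (D ^ k) := by ring
        rw [e1]
        exact mul_le_mul_of_nonneg_left (by linarith) (by positivity)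
    have hq0 : 0 < q k := (Real.exp_pos _).trans h1
    rcases le_or_gt (q k) 1 with h2 | h2
    · have hlog : Real.log (q k) ≤ 0 := Real.log_nonpos hq0.le h2
      have hlog2 : -(4 * τ * llog (D ^ k)) ≤ Real.log (q k) := (Real.le_log_iff_exp_le hq0).2 h1.le
      have e0 : τ * (-Real.log (q k) / (2 * τ)) = -Real.log (q k) / 2 := by field_simp
      refine (main k hk (-Real.log (q k) / (2 * τ)) (div_nonneg (by linarith) (by positivity)) ?_
        ?_).trans (ENNReal.ofReal_le_ofReal ?_)
      · rw [div_le_iff₀ (by positivity)]; linarith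
      · rw [e0]
        nth_rewrite 2 [← Real.exp_log hq0]
        rw [← Real.exp_add]
        apply le_of_eq; ring_nf
      · have e1 : Real.exp (-((1 + ε) / 2 * (-Real.log (q k) / (2 * τ)))) ≤ q k ^ (d + 1) := by
          rw [Real.rpow_def_of_pos hq0, Real.exp_le_exp]
          have e2 : -Real.log (q k) / (2 * τ) = 2 * (d + 1) * -Real.log (q k) := by
            rw [hτ]; field_simp; ring
          rw [e2]
          have : 0 ≤ ε * (d + 1) * -Real.log (q k) := by
            have : 0 ≤ -Real.log (q k) := by linarith
            positivity
          nlinarith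
        exact mul_le_mul_of_nonneg_left (by linarith) (by positivity)
    · refine (upCap_le_one _).trans ?_
      rw [← ENNReal.ofReal_one]
      apply ENNReal.ofReal_le_ofReal
      have : 1 ≤ q k ^ (d + 1) := Real.one_le_rpow h2.le (by linarith)
      exact one_le_mul_of_one_le_of_one_le (by linarith) (by linarith)

end LILHyp

end SublinearExpectationSpace

/-! ### Covering the upper deviations, and the upper half of the law. -/

namespace SublinearExpectationSpace

variable {Ω : Type*} [MeasurableSpace Ω] {𝓔 : SublinearExpectationSpace Ω} {X : ℕ → Ω → ℝ}

namespace LILHyp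

variable (H : 𝓔.LILHyp X)

include H

theorem upCap_le_div_sq {n : ℕ} (hn : 1 ≤ n) {c : ℝ} (hc : 0 < c) :
    𝓔.upCap {ω | c ≤ |X n ω|} ≤
      ENNReal.ofReal ((c ^ 2)⁻¹ * 𝓔.ex (fun ω => X n ω ^ 2)) := by
  have L2 := sq_isL1 (H.mem n hn) (H.sq n hn)
  rw [← L2.ex_const_mul (by positivity)]
  refine upCap_le_ofReal (L2.const_mul _) (fun ω => by positivity) fun ω hω => ?_
  rw [← div_eq_inv_mul, one_le_div (by positivity), ← sq_abs (X n ω)]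
  exact pow_le_pow_left₀ hc.le hω 2

/-- The upper deviations are covered by measurable sets of small total capacity. -/
theorem exists_cover {ε δ : ℝ} (hε : 0 < ε) (hε1 : ε ≤ 1) (hδ : 0 < δ) :
    ∃ (n₁ : ℕ) (B : ℕ → Set Ω), (∀ i, MeasurableSet (B i)) ∧
      ∑' i, 𝓔.upCap (B i) ≤ ENNReal.ofReal δ ∧
      ∀ m ≥ n₁, ∃ i, ∀ ω, (1 + ε) * 𝓔.an X m < partialSum X m ω → ∃ i' < i, ω ∈ B i' := by
  obtain ⟨D, τ, b, K, hD, hτ, hb, hbs, hF⟩ := H.exists_summable_block_bound hε hε1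
  have hD0 : 0 < D := by linarith
  set F : ℕ → Set Ω := fun k => truncMaxEvent X (lastBelow (𝓔.sSq X) (D ^ (k + 1)))
    (τ * amp (D ^ k)) ((1 + ε) * amp (D ^ k)) with hFdef
  have hδ3 : 0 < ENNReal.ofReal (δ / 3) := by simpa using hδ
  obtain ⟨K₁, hK₁⟩ : ∃ K₁, ∑' i, 𝓔.upCap (F (i + K₁)) ≤ ENNReal.ofReal (δ / 3) := by
    have h := ENNReal.tendsto_sum_nat_add _ hbs.tsum_ofReal_ne_top
    obtain ⟨K₁, h1, h2⟩ := ((h.eventually (gt_mem_nhds hδ3)).and (eventually_ge_atTop K)).exists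
    exact ⟨K₁, (ENNReal.tsum_le_tsum fun i => hF _ (by omega)).trans h1.le⟩
  -- In block `k` one has `a_m ≤ D amp (D ^ k)`, so variables below `ε' a_m` are below the
  -- truncation level.
  set ε' := τ / D with hε'
  have hε'0 : 0 < ε' := by positivity
  obtain ⟨n₀, hn₀⟩ : ∃ n₀, ∑' i, 𝓔.upCap {ω | ε' * 𝓔.an X (i + n₀ + 1) ≤ |X (i + n₀ + 1) ω|} ≤
      ENNReal.ofReal (δ / 3) := by
    have h := ENNReal.tendsto_sum_nat_add _ (H.tail ε' hε'0).ne
    obtain ⟨n₀, h1⟩ := (h.eventually (gt_mem_nhds hδ3)).exists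
    exact ⟨n₀, h1.le⟩
  -- The tail series handles only indices beyond `n₀`. The first `n₀` variables are compared with
  -- the much larger `a_{n₁}` by Chebyshev's inequality.
  obtain ⟨n₁, hn1a, hn1b, hn1c⟩ : ∃ n₁, 0 < 𝓔.an X n₁ ∧
      ((ε' * 𝓔.an X n₁) ^ 2)⁻¹ * 𝓔.sSq X n₀ ≤ δ / 3 ∧ D ^ K₁ ≤ 𝓔.sSq X n₁ := by
    have h1 : Tendsto (fun n => ((ε' * 𝓔.an X n) ^ 2)⁻¹ * 𝓔.sSq X n₀) atTop (𝓝 0) := by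
      have := (((tendsto_pow_atTop (two_ne_zero)).comp
        (H.amp_tendsto.const_mul_atTop hε'0)).inv_tendsto_atTop).mul_const (𝓔.sSq X n₀)
      simpa using this
    obtain ⟨n₁, ⟨h2, h3⟩, h4⟩ := (((H.amp_tendsto.eventually_gt_atTop 0).and
      (h1.eventually (gt_mem_nhds (show 0 < δ / 3 by positivity)))).and
      (H.sSq_tendsto.eventually_ge_atTop (D ^ K₁))).exists
    exact ⟨n₁, h2, h3.le, h4⟩
  set G : Set Ω := ⋃ j ∈ Finset.Icc 1 n₀, {ω | ε' * 𝓔.an X n₁ ≤ |X j ω|} with hG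
  have hGc : 𝓔.upCap G ≤ ENNReal.ofReal (δ / 3) := by
    refine (upCap_biUnion_le _ _).trans ?_
    refine (Finset.sum_le_sum fun j hj => H.upCap_le_div_sq (Finset.mem_Icc.1 hj).1
      (show 0 < ε' * 𝓔.an X n₁ by positivity)).trans ?_
    rw [← ENNReal.ofReal_sum_of_nonneg, ← Finset.mul_sum]
    · exact ENNReal.ofReal_le_ofReal hn1b
    · intro j hj
      have := H.sigma_nonneg j (Finset.mem_Icc.1 hj).1
      positivity
  have hms : ∀ (c : ℝ) (j : ℕ), 1 ≤ j → MeasurableSet {ω | c ≤ |X j ω|} := fun c j hj =>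
    measurableSet_le measurable_const (H.measurable j hj).abs
  refine ⟨max n₁ 1, fun i => (F (i + K₁) ∪
    {ω | ε' * 𝓔.an X (i + n₀ + 1) ≤ |X (i + n₀ + 1) ω|}) ∪ (if i = 0 then G else ∅),
    fun i => ?_, ?_, ?_⟩
  · refine ((H.measurableSet_truncMaxEvent _ _ _).union (hms _ _ (by omega))).union ?_
    split_ifs
    · exact Finset.measurableSet_biUnion _ fun j hj => hms _ _ (Finset.mem_Icc.1 hj).1
    · exact MeasurableSet.empty
  · refine (ENNReal.tsum_le_tsum fun i => (upCap_union_le _ _).trans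
      (add_le_add (upCap_union_le _ _) le_rfl)).trans ?_
    rw [ENNReal.tsum_add, ENNReal.tsum_add]
    have h3 : ∑' i : ℕ, 𝓔.upCap (if i = 0 then G else ∅) = 𝓔.upCap G := by
      rw [tsum_eq_single 0]
      · simp
      · intro i hi; simp [hi, upCap_empty]
    rw [h3]
    refine (add_le_add (add_le_add hK₁ hn₀) hGc).trans ?_
    rw [← ENNReal.ofReal_add (by positivity) (by positivity),
      ← ENNReal.ofReal_add (by positivity) (by positivity)]
    exact ENNReal.ofReal_le_ofReal (by linarith)
  · intro m hm
    have hm1 : 1 ≤ m := (le_max_right _ _).trans hm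
    have hmn : n₁ ≤ m := (le_max_left _ _).trans hm
    have hsm : D ^ K₁ ≤ 𝓔.sSq X m := hn1c.trans (H.sSq_mono hmn)
    obtain ⟨k, hk1, hk2⟩ : ∃ k : ℕ, D ^ k ≤ 𝓔.sSq X m ∧ 𝓔.sSq X m < D ^ (k + 1) :=
      exists_nat_pow_near ((one_le_pow₀ hD.le).trans hsm) hD
    have hkK : K₁ ≤ k := by
      have := (pow_lt_pow_iff_right₀ hD).1 (hsm.trans_lt hk2)
      omega
    -- The index bound depends on `m` but not on `ω`. Over a finite time window finitely many sets
    -- therefore suffice, as finite sub-additivity requires.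
    refine ⟨max k m + 1, fun ω hω => ?_⟩
    by_contra hcon
    push Not at hcon
    have hDk : 0 < D ^ k := by positivity
    have ham : 𝓔.an X m ≤ D * amp (D ^ k) :=
      (amp_mono hk2.le).trans (by rw [pow_succ']; exact amp_mul_le hD.le hDk.le)
    have hle : ε' * 𝓔.an X m ≤ τ * amp (D ^ k) := by
      rw [hε', div_mul_eq_mul_div, div_le_iff₀ hD0]
      nlinarith
    have hX : ∀ j ∈ Finset.Icc 1 m, X j ω ≤ τ * amp (D ^ k) := by
      intro j hj
      obtain ⟨hj1, hjm⟩ := Finset.mem_Icc.1 hj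
      refine (le_abs_self _).trans (le_trans ?_ hle)
      by_contra hc
      push Not at hc
      by_cases hjn : j ≤ n₀
      · refine hcon 0 (by omega) (Or.inr ?_)
        simp only [if_true, hG, Set.mem_iUnion]
        refine ⟨j, Finset.mem_Icc.2 ⟨hj1, hjn⟩, ?_⟩
        exact (mul_le_mul_of_nonneg_left (H.an_mono hmn) hε'0.le).trans hc.le
      · have hji : j - 1 - n₀ + n₀ + 1 = j := by omega
        refine hcon (j - 1 - n₀) (by omega) (Or.inl (Or.inr ?_))
        rw [hji]
        exact (mul_le_mul_of_nonneg_left (H.an_mono hjm) hε'0.le).trans hc.le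
    refine hcon (k - K₁) (by omega) (Or.inl (Or.inl ?_))
    rw [Nat.sub_add_cancel hkK]
    refine ⟨m, hm1, (H.le_blockEnd_iff hD0 k m).2 hk2, ?_⟩
    rw [Finset.sum_congr rfl fun j hj => min_eq_left (hX j hj)]
    refine le_trans ?_ hω.le
    exact mul_le_mul_of_nonneg_left (amp_mono hk1) (by linarith)

/-- Two-sided version of the covering. -/
theorem exists_cover_abs {ε δ : ℝ} (hε : 0 < ε) (hδ : 0 < δ) :
    ∃ (n₁ : ℕ) (B : ℕ → Set Ω), (∀ i, MeasurableSet (B i)) ∧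
      ∑' i, 𝓔.upCap (B i) ≤ ENNReal.ofReal δ ∧
      ∀ m ≥ n₁, ∃ i, ∀ ω, 1 + ε < |partialSum X m ω| / 𝓔.an X m → ∃ i' < i, ω ∈ B i' := by
  have hm : 0 < min ε 1 := lt_min hε one_pos
  obtain ⟨n₁, B, hB, hBs, hBc⟩ := H.exists_cover hm (min_le_right _ _) (half_pos hδ)
  obtain ⟨n₂, B', hB', hBs', hBc'⟩ := H.neg.exists_cover hm (min_le_right _ _) (half_pos hδ)
  have han : 𝓔.an (fun n ω => -X n ω) = 𝓔.an X := by
    funext n; simp [an, sd, tn, sSq]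
  have hps : ∀ m ω, partialSum (fun n ω => -X n ω) m ω = -partialSum X m ω := fun m ω => by
    simp [partialSum]
  refine ⟨max n₁ n₂, fun i => B i ∪ B' i, fun i => (hB i).union (hB' i), ?_, fun m hm' => ?_⟩
  · refine (ENNReal.tsum_le_tsum fun i => upCap_union_le _ _).trans ?_
    rw [ENNReal.tsum_add]
    refine (add_le_add hBs hBs').trans ?_
    rw [← ENNReal.ofReal_add (by positivity) (by positivity), add_halves]
  · obtain ⟨i, hi⟩ := hBc m ((le_max_left _ _).trans hm')
    obtain ⟨i', hi'⟩ := hBc' m ((le_max_right _ _).trans hm')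
    refine ⟨max i i', fun ω hω => ?_⟩
    -- If `a_m = 0`, the quotient is `0` by convention and cannot exceed `1 + ε`.
    have ha : 0 < 𝓔.an X m := by
      refine lt_of_le_of_ne (amp_nonneg _) fun h0 => ?_
      rw [← h0] at hω
      simp at hω; linarith
    rw [lt_div_iff₀ ha] at hω
    have h2 : (1 + min ε 1) * 𝓔.an X m < |partialSum X m ω| := by
      refine lt_of_le_of_lt ?_ hω
      have := min_le_left ε 1
      gcongr
    rcases lt_abs.1 h2 with h3 | h3
    · obtain ⟨j, hj, hj'⟩ := hi ω h3
      exact ⟨j, by omega, Or.inl hj'⟩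
    · obtain ⟨j, hj, hj'⟩ := hi' ω (by rw [han, hps]; exact h3)
      exact ⟨j, by omega, Or.inr hj'⟩

/-- A limsup above `1` exceeds some `1 + 1 / (r + 1)` infinitely often, hence the point lies in the
`r`-th cover. These covers, of capacities at most `δ / 2 ^ (r + 1)`, are merged into one sequence by
the pairing function. -/
theorem outCap_limsup_eq_zero :
    𝓔.outCap {ω | 1 < limsup (fun n : ℕ => ((|partialSum X n ω| / 𝓔.an X n : ℝ) : EReal)) atTop}
      = 0 := by
  refine le_antisymm (ENNReal.le_of_forall_pos_le_add fun δ hδ _ => ?_) zero_le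
  rw [zero_add]
  have hpos : ∀ r : ℕ, 0 < (δ : ℝ) / 2 / 2 ^ r := fun r => by positivity
  choose n₁ B hB hBs hBc using fun r : ℕ =>
    H.exists_cover_abs (ε := 1 / ((r : ℝ) + 1)) (by positivity) (hpos r)
  refine iInf₂_le_of_le (fun i => B i.unpair.1 i.unpair.2) (fun i => hB _ _)
    (iInf_le_of_le ?_ ?_)
  · intro ω hω
    obtain ⟨x, hx1, hx2⟩ := EReal.lt_iff_exists_real_btwn.1 hω
    have hx1' : (1 : ℝ) < x := by exact_mod_cast hx1
    obtain ⟨r, hr⟩ := exists_nat_one_div_lt (sub_pos.2 hx1')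
    have hfreq := frequently_lt_of_lt_limsup (by isBoundedDefault) hx2
    obtain ⟨m, hm, hmn⟩ := (hfreq.and_eventually (eventually_ge_atTop (n₁ r))).exists
    obtain ⟨i, hi⟩ := hBc r m hmn
    obtain ⟨i', -, hi'⟩ := hi ω (by
      have : x < |partialSum X m ω| / 𝓔.an X m := by exact_mod_cast hm
      linarith)
    exact Set.mem_iUnion.2 ⟨Nat.pair r i', by simpa using hi'⟩
  · have e := Nat.pairEquiv.symm.tsum_eq (fun z : ℕ × ℕ => 𝓔.upCap (B z.1 z.2))
    change ∑' i : ℕ, (fun z : ℕ × ℕ => 𝓔.upCap (B z.1 z.2)) (Nat.pairEquiv.symm i) ≤ _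
    rw [e, ENNReal.tsum_prod (f := fun r i => 𝓔.upCap (B r i))]
    refine (ENNReal.tsum_le_tsum hBs).trans ?_
    rw [← ENNReal.ofReal_tsum_of_nonneg (fun r => (hpos r).le) (summable_geometric_two' _),
      tsum_geometric_two']
    simp

theorem tendsto_upper {V : Set Ω → ℝ} (hV : 𝓔.IsUpperCapacity V) {ε : ℝ} (hε : 0 < ε) :
    Tendsto (fun n : ℕ => ⨆ N : ℕ,
        V {ω | ∃ m, n ≤ m ∧ m ≤ N ∧ 1 + ε < |partialSum X m ω| / 𝓔.an X m}) atTop (𝓝 0) := by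
  have hmeas : ∀ n N, MeasurableSet
      {ω | ∃ m, n ≤ m ∧ m ≤ N ∧ 1 + ε < |partialSum X m ω| / 𝓔.an X m} := by
    intro n N
    simp only [Set.ofPred_exists, Set.ofPred_and]
    refine MeasurableSet.iUnion fun m => (MeasurableSet.const _).inter
      ((MeasurableSet.const _).inter (measurableSet_lt measurable_const ?_))
    exact (H.measurable_partialSum m).abs.div_const _
  have hV0 : ∀ A, MeasurableSet A → 0 ≤ V A := fun A hA => by
    rw [← hV.empty]; exact hV.mono _ _ MeasurableSet.empty hA (Set.empty_subset _)
  rw [Metric.tendsto_atTop]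
  intro δ hδ
  obtain ⟨n₁, B, hB, hBs, hBc⟩ := H.exists_cover_abs hε (half_pos hδ)
  refine ⟨n₁, fun n hn => ?_⟩
  rw [Real.dist_eq, sub_zero, abs_of_nonneg (Real.iSup_nonneg fun N => hV0 _ (hmeas n N))]
  refine lt_of_le_of_lt (ciSup_le fun N => ?_) (half_lt_self hδ)
  have h1 : 𝓔.upCap {ω | ∃ m, n ≤ m ∧ m ≤ N ∧ 1 + ε < |partialSum X m ω| / 𝓔.an X m} ≤
      ENNReal.ofReal (δ / 2) := by
    choose! i hi using hBc
    refine (upCap_mono (B := ⋃ j ∈ Finset.range ((Finset.range (N + 1)).sup i), B j) ?_).trans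
      ((upCap_biUnion_le _ _).trans ((ENNReal.sum_le_tsum _).trans hBs))
    rintro ω ⟨m, hm1, hm2, hm3⟩
    obtain ⟨j, hj, hj'⟩ := hi m (hn.trans hm1) ω hm3
    simp only [Set.mem_iUnion, Finset.mem_range]
    exact ⟨j, hj.trans_le (Finset.le_sup (f := i) (by simp; omega)), hj'⟩
  have h2 := (hV.le_upCap (hmeas n N)).trans h1
  exact (ENNReal.ofReal_le_ofReal_iff (by positivity)).1 h2

end LILHyp

end SublinearExpectationSpace

/-! ### The converse exponential inequality. -/

theorem tlog_mul_le_log_add {c : ℝ} (hc : 1 ≤ c) (x : ℝ) : tlog (c * x) ≤ Real.log c + tlog x := by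
  have h0 : 0 < max (Real.exp 1) x := lt_of_lt_of_le (Real.exp_pos 1) (le_max_left _ _)
  have h1 : max (Real.exp 1) (c * x) ≤ c * max (Real.exp 1) x := by
    refine max_le ?_ (mul_le_mul_of_nonneg_left (le_max_right _ _) (by linarith))
    exact (le_max_left _ x).trans (le_mul_of_one_le_left h0.le hc)
  have h2 : tlog (c * x) ≤ Real.log (c * max (Real.exp 1) x) :=
    Real.log_le_log (lt_of_lt_of_le (Real.exp_pos 1) (le_max_left _ _)) h1
  rwa [Real.log_mul (by positivity) h0.ne'] at h2

theorem llog_mul_le_log_add {c : ℝ} (hc : 1 ≤ c) (x : ℝ) : llog (c * x) ≤ Real.log c + llog x :=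
  (tlog_mono (tlog_mul_le hc x)).trans (tlog_mul_le_log_add hc _)

theorem tendsto_llog_pow {D : ℝ} (hD : 1 < D) : Tendsto (fun k : ℕ => llog (D ^ k)) atTop atTop := by
  obtain ⟨c, hc, h⟩ := exists_mul_le_exp_llog hD
  have h1 : Tendsto (fun k : ℕ => c * ((k : ℝ) + 1)) atTop atTop :=
    ((tendsto_natCast_atTop_atTop).atTop_add tendsto_const_nhds).const_mul_atTop hc
  have h2 := Real.tendsto_log_atTop.comp h1
  refine tendsto_atTop_mono (fun k => ?_) h2
  rw [Function.comp, Real.log_le_iff_le_exp (by positivity)]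
  exact h k

/-- `(1 - η) A ≤ log (1 + A)`, `-2 B ≤ log (1 - B)` and `(1 + A) (1 - B) ≤ 1 + A - B`. It turns
lower moment bounds into exponentials that multiply. -/
theorem exp_le_one_add_sub {A B η : ℝ} (hA : 0 ≤ A) (hAη : A ≤ η) (hB : 0 ≤ B)
    (hB1 : B ≤ 1 / 2) : Real.exp ((1 - η) * A - 2 * B) ≤ 1 + A - B := by
  have h1 : (1 - η) * A ≤ Real.log (1 + A) := by
    refine le_trans ?_ (Real.one_sub_inv_le_log_of_pos (by linarith))
    have : 1 - (1 + A)⁻¹ = A / (1 + A) := by field_simp; ring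
    rw [this, le_div_iff₀ (by linarith)]
    nlinarith [mul_nonneg hA (sub_nonneg.2 hAη), mul_nonneg (mul_nonneg hA hA) (hA.trans hAη)]
  have h2 : -(2 * B) ≤ Real.log (1 - B) := by
    refine le_trans ?_ (Real.one_sub_inv_le_log_of_pos (by linarith))
    have hpos : 0 < 1 - B := by linarith
    have : 1 - (1 - B)⁻¹ = -B / (1 - B) := by field_simp; ring
    rw [this, le_div_iff₀ hpos]
    nlinarith
  have h3 : Real.exp ((1 - η) * A - 2 * B) ≤ (1 + A) * (1 - B) := by
    rw [← Real.exp_log (show 0 < (1 + A) * (1 - B) by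
      have : 0 < 1 - B := by linarith
      positivity), Real.exp_le_exp,
      Real.log_mul (by linarith) (by linarith)]
    linarith
  nlinarith [mul_nonneg hA hB]

theorem sum_Ioc_le_sum_Icc {m n : ℕ} {g : ℕ → ℝ} (hg : ∀ j, 0 ≤ g j) :
    ∑ j ∈ Finset.Ioc m n, g j ≤ ∑ j ∈ Finset.Icc 1 n, g j :=
  Finset.sum_le_sum_of_subset_of_nonneg
    (fun j hj => by rw [Finset.mem_Ioc] at hj; rw [Finset.mem_Icc]; omega) fun j _ _ => hg j

/-- The exponents differ by `γ² T / 4 ≥ 4`; after the additive constants, each subtracted term is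
still smaller by `e ^ (-2)`, and `1 - 2 e ^ (-2) ≥ e ^ (-1)`. -/
theorem converse_arith {γ T a b c : ℝ} (hbig : 16 ≤ γ ^ 2 * T) (hγT : γ ^ 2 * T ≤ γ * T)
    (ha : Real.exp ((1 / 2 - γ ^ 2 / 8) * T - 1) ≤ a)
    (hb : b ≤ Real.exp ((1 / 2 - 3 * γ ^ 2 / 8) * T + 1))
    (hc : c ≤ Real.exp ((1 / 2 - 3 * γ ^ 2 / 8) * T + 1)) :
    Real.exp (-2 - T * (1 / 2 + 2 * γ)) ≤ Real.exp (-((1 + γ) * T)) * (a - b - c) := by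
  have g4 : Real.exp ((1 / 2 - 3 * γ ^ 2 / 8) * T + 1) ≤
      Real.exp ((1 / 2 - γ ^ 2 / 8) * T - 1) * Real.exp (-2) := by
    rw [← Real.exp_add, Real.exp_le_exp]
    linarith
  have g5 : Real.exp (-1) ≤ 1 - 2 * Real.exp (-2) := by
    have e1 : Real.exp (-2) = Real.exp (-1) * Real.exp (-1) := by rw [← Real.exp_add]; norm_num
    have e2 : Real.exp (-1) ≤ 1 / 2 := by
      rw [Real.exp_neg, inv_eq_one_div]
      apply one_div_le_one_div_of_le (by norm_num)
      linarith [Real.add_one_le_exp 1]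
    have e3 := Real.exp_pos (-1)
    rw [e1]; nlinarith
  calc Real.exp (-2 - T * (1 / 2 + 2 * γ))
      ≤ Real.exp (-((1 + γ) * T)) *
        (Real.exp ((1 / 2 - γ ^ 2 / 8) * T - 1) * Real.exp (-1)) := by
        rw [← Real.exp_add, ← Real.exp_add, Real.exp_le_exp]
        linarith
    _ ≤ _ := by
        refine mul_le_mul_of_nonneg_left ?_ (Real.exp_pos _).le
        have := mul_le_mul_of_nonneg_left g5
          (Real.exp_pos ((1 / 2 - γ ^ 2 / 8) * T - 1)).le
        linarith

namespace SublinearExpectationSpace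

variable {Ω : Type*} [MeasurableSpace Ω] {𝓔 : SublinearExpectationSpace Ω} {X : ℕ → Ω → ℝ}

theorem abs_ex_le {f : Ω → ℝ} (hf : 𝓔.IsL1 f) : |𝓔.ex f| ≤ 𝓔.ex (fun ω => |f ω|) := by
  rw [abs_le]
  constructor
  · have h1 := (IsL1.const 0).ex_sub_le hf.abs
    have h2 := ((IsL1.const 0).sub hf.abs).ex_mono hf fun ω => by
      linarith [neg_abs_le (f ω)]
    rw [ex_const] at h1
    linarith
  · exact hf.ex_mono hf.abs fun ω => le_abs_self _

theorem sum_sigma_Ioc {m n : ℕ} (hmn : m ≤ n) :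
    ∑ j ∈ Finset.Ioc m n, 𝓔.ex (fun ω => X j ω ^ 2) = 𝓔.sSq X n - 𝓔.sSq X m := by
  have h := Finset.sum_Ioc_consecutive (fun j => 𝓔.ex (fun ω => X j ω ^ 2)) m.zero_le hmn
  exact eq_sub_of_add_eq' h

namespace LILHyp

variable (H : 𝓔.LILHyp X)

include H

theorem prod_expMoment_le {m n : ℕ} (hmn : m ≤ n) {η h y M : ℝ} (hη : 0 ≤ η) (hh : 0 ≤ h)
    {c : ℕ → ℝ} (hc : ∀ j, 0 ≤ c j) (hE : ∀ j ∈ Finset.Icc 1 n, 𝓔.ExpMoment (X j) η h y (c j))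
    (hcs : ∑ j ∈ Finset.Icc 1 n, c j ≤ η)
    (hM : ∑ j ∈ Finset.Icc 1 n, |𝓔.ex (X j)| ≤ M) :
    ∏ j ∈ Finset.Ioc m n, 𝓔.ex (fun ω => Real.exp (h * min (X j ω) y)) ≤
      Real.exp (h * M + (1 + η) * (h ^ 2 * 𝓔.sSq X n) / 2 + η) := by
  have hsub : ∀ j ∈ Finset.Ioc m n, j ∈ Finset.Icc 1 n := fun j hj => by
    rw [Finset.mem_Ioc] at hj; rw [Finset.mem_Icc]; omega
  refine (Finset.prod_le_prod (fun j hj => ?_) (fun j hj => ((hE j (hsub j hj)).upper.trans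
    (le_trans ?_ (Real.add_one_le_exp (h * |𝓔.ex (X j)| +
      (1 + η) * h ^ 2 / 2 * 𝓔.ex (fun ω => X j ω ^ 2) + c j)))))).trans ?_
  · exact ex_nonneg ((bddLip_exp_min hh y).isL1 (H.mem j (Finset.mem_Icc.1 (hsub j hj)).1))
      fun ω => (Real.exp_pos _).le
  · have := mul_le_mul_of_nonneg_left (le_abs_self (𝓔.ex (X j))) hh
    linarith
  · rw [← Real.exp_sum, Real.exp_le_exp, Finset.sum_add_distrib, Finset.sum_add_distrib,
      ← Finset.mul_sum, ← Finset.mul_sum, sum_sigma_Ioc hmn]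
    have h1 := sum_Ioc_le_sum_Icc (m := m) (n := n) (g := fun j => |𝓔.ex (X j)|)
      fun j => abs_nonneg _
    have h2 := sum_Ioc_le_sum_Icc (m := m) (n := n) hc
    have h3 := mul_le_mul_of_nonneg_left (h1.trans hM) hh
    have h4 : 0 ≤ (1 + η) * h ^ 2 / 2 * 𝓔.sSq X m := by
      have := H.sSq_nonneg m
      positivity
    linarith

/-- The smallness required by `exp_le_one_add_sub` comes from the moment data: the negative part of
each factor is at most `η + 2 c j ≤ 3 η ≤ 3 / 8`. -/
theorem le_prod_expMoment {m n : ℕ} (hmn : m ≤ n) {η h y M : ℝ} (hη : 0 < η) (hη1 : η ≤ 1 / 8)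
    (hh : 0 ≤ h) (hy : η ≤ h * y) {c : ℕ → ℝ} (hc : ∀ j, 0 ≤ c j)
    (hE : ∀ j ∈ Finset.Icc 1 n, 𝓔.ExpMoment (X j) η h y (c j))
    (hcs : ∑ j ∈ Finset.Icc 1 n, c j ≤ η)
    (hM : ∑ j ∈ Finset.Icc 1 n, |𝓔.ex (fun ω => -X j ω)| ≤ M) :
    Real.exp ((1 - η) ^ 2 * (h ^ 2 * (𝓔.sSq X n - 𝓔.sSq X m)) / 2 - 2 * (h * M) - 2 * η) ≤
      ∏ j ∈ Finset.Ioc m n, 𝓔.ex (fun ω => Real.exp (h * min (X j ω) y)) := by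
  have hsub : ∀ j ∈ Finset.Ioc m n, j ∈ Finset.Icc 1 n := fun j hj => by
    rw [Finset.mem_Ioc] at hj; rw [Finset.mem_Icc]; omega
  have hterm : ∀ j ∈ Finset.Ioc m n, Real.exp ((1 - η) * ((1 - η) * h ^ 2 / 2 *
      𝓔.ex (fun ω => X j ω ^ 2)) - 2 * (h * |𝓔.ex (fun ω => -X j ω)| + c j)) ≤
      𝓔.ex (fun ω => Real.exp (h * min (X j ω) y)) := by
    intro j hj
    have hj1 := (Finset.mem_Icc.1 (hsub j hj)).1
    have hEj := hE j (hsub j hj)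
    have hcj : c j ≤ η := (Finset.single_le_sum (fun i _ => hc i) (hsub j hj)).trans hcs
    have hσ := H.sigma_nonneg j hj1
    have L1 := isL1_of_sq (H.mem j hj1) (H.sq j hj1)
    have habs : |𝓔.ex (fun ω => -X j ω)| ≤ 𝓔.ex (fun ω => |X j ω|) := by
      simpa using abs_ex_le L1.neg
    have hB : h * |𝓔.ex (fun ω => -X j ω)| ≤ η + c j :=
      (mul_le_mul_of_nonneg_left habs hh).trans hEj.abs_le
    refine (exp_le_one_add_sub ?_ ?_ ?_ ?_).trans (le_trans ?_ (hEj.lower hy))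
    · have : 0 ≤ 1 - η := by linarith
      positivity
    · have h1 := hEj.sq_le
      have h2 : 0 ≤ h ^ 2 * 𝓔.ex (fun ω => X j ω ^ 2) := by positivity
      nlinarith [mul_nonneg hη.le h2]
    · have := hc j
      positivity
    · linarith
    · have := mul_le_mul_of_nonneg_left (le_abs_self (𝓔.ex (fun ω => -X j ω))) hh
      linarith
  refine le_trans ?_ (Finset.prod_le_prod (fun j _ => (Real.exp_pos _).le) hterm)
  rw [← Real.exp_sum, Real.exp_le_exp, Finset.sum_sub_distrib, ← Finset.mul_sum,
    ← Finset.mul_sum, ← Finset.mul_sum, Finset.sum_add_distrib, ← Finset.mul_sum,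
    sum_sigma_Ioc hmn]
  have h1 := sum_Ioc_le_sum_Icc (m := m) (n := n) (g := fun j => |𝓔.ex (fun ω => -X j ω)|)
    fun j => abs_nonneg _
  have h2 := sum_Ioc_le_sum_Icc (m := m) (n := n) hc
  have h3 := mul_le_mul_of_nonneg_left (h1.trans hM) hh
  linarith

set_option maxHeartbeats 1000000 in
/-- The converse exponential inequality: the truncated block sum exceeds `(1 - 2γ) h v` with
expectation at least `exp (-2 - h² v (1/2 + 2γ))`, where `v` is the variance at the end of the
block. -/
theorem exists_blockLower {m n : ℕ} (hmn : m ≤ n) {γ h y M : ℝ} (hγ : 0 < γ) (hγ1 : γ ≤ 1 / 32)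
    (hh : 0 < h) (hm : 𝓔.sSq X m ≤ γ ^ 2 / 32 * 𝓔.sSq X n) (hy : γ ^ 2 / 32 ≤ h * y)
    (hM : ∑ j ∈ Finset.Icc 1 n, |𝓔.ex (X j)| ≤ M)
    (hM' : ∑ j ∈ Finset.Icc 1 n, |𝓔.ex (fun ω => -X j ω)| ≤ M)
    (hMh : h * M ≤ γ ^ 2 / 64 * (h ^ 2 * 𝓔.sSq X n))
    (hbig : 16 ≤ γ ^ 2 * (h ^ 2 * 𝓔.sSq X n))
    (hmom : ∀ r ∈ Set.Icc (0 : ℝ) (1 + γ), ∃ c : ℕ → ℝ, (∀ j, 0 ≤ c j) ∧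
      (∀ j ∈ Finset.Icc 1 n, 𝓔.ExpMoment (X j) (γ ^ 2 / 32) (r * h) y (c j)) ∧
      ∑ j ∈ Finset.Icc 1 n, c j ≤ γ ^ 2 / 32) :
    ∃ f : (ℕ → ℝ) → ℝ, CylBL n f ∧ (∀ x, 0 ≤ f x) ∧ (∀ x, f x ≤ 1) ∧
      (∀ x, f x ≠ 0 → (1 - 2 * γ) * (h * 𝓔.sSq X n) ≤ ∑ j ∈ Finset.Ioc m n, x j) ∧
      𝓔.BlockLower X m f (Real.exp (-2 - h ^ 2 * 𝓔.sSq X n * (1 / 2 + 2 * γ))) := by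
  set v := 𝓔.sSq X n with hv
  set T := h ^ 2 * v with hT
  set η := γ ^ 2 / 32 with hη
  have hη0 : 0 < η := by positivity
  have hγ2 : γ ^ 2 ≤ 1 / 32 * γ := by nlinarith
  have hT0 : 0 ≤ T := mul_nonneg (sq_nonneg h) (H.sSq_nonneg n)
  have hlT : 0 < Real.exp ((1 - γ) * T) := Real.exp_pos _
  have hsub : ∀ j ∈ Finset.Ioc m n, j ∈ Finset.Icc 1 n := fun j hj => by
    rw [Finset.mem_Ioc] at hj; rw [Finset.mem_Icc]; omega
  have hprod : ∀ (r : ℝ) (x : ℕ → ℝ), ∏ j ∈ Finset.Ioc m n, Real.exp (r * h * min (x j) y) =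
      Real.exp (r * (h * ∑ j ∈ Finset.Ioc m n, min (x j) y)) := fun r x => by
    rw [← Real.exp_sum, ← Finset.mul_sum, mul_assoc]
  set f : (ℕ → ℝ) → ℝ := fun x =>
    ramp (Real.exp ((1 - γ) * T)) (∏ j ∈ Finset.Ioc m n, Real.exp (1 * h * min (x j) y)) with hf
  have hbl : ∀ r : ℝ, 0 ≤ r → ∀ j ∈ Finset.Ioc m n,
      BddLip (fun u => Real.exp (r * h * min u y)) ∧ ∀ u, 0 ≤ Real.exp (r * h * min u y) :=
    fun r hr j _ => ⟨bddLip_exp_min (by positivity) y, fun u => (Real.exp_pos _).le⟩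
  have hfc : CylBL n f := (CylBL.prod _ fun j hj =>
    CylBL.coord (hbl 1 zero_le_one j hj).1 (hsub j hj)).comp (bddLip_ramp hlT)
  refine ⟨f, hfc, fun x => ramp_nonneg _ _, fun x => ramp_le_one _ _, fun x hx => ?_, ?_⟩
  · have h1 : 1 < 2 * (∏ j ∈ Finset.Ioc m n, Real.exp (1 * h * min (x j) y)) /
        Real.exp ((1 - γ) * T) := by
      by_contra hc
      exact hx (ramp_eq_zero (not_lt.1 hc))
    rw [hprod, one_mul, one_lt_div hlT] at h1
    have h2 : (2 : ℝ) ≤ Real.exp 1 := by linarith [Real.add_one_le_exp 1]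
    have h3 : Real.exp ((1 - γ) * T) < Real.exp (1 + h * ∑ j ∈ Finset.Ioc m n, min (x j) y) := by
      rw [Real.exp_add]
      exact h1.trans_le (mul_le_mul_of_nonneg_right h2 (Real.exp_pos _).le)
    rw [Real.exp_lt_exp] at h3
    have h4 : ∑ j ∈ Finset.Ioc m n, min (x j) y ≤ ∑ j ∈ Finset.Ioc m n, x j :=
      Finset.sum_le_sum fun j _ => min_le_left _ _
    have h5 : h * ((1 - 2 * γ) * (h * v)) ≤ h * ∑ j ∈ Finset.Ioc m n, x j := by
      have h6 := mul_le_mul_of_nonneg_left h4 hh.le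
      have h7 : 1 ≤ γ * T := by nlinarith
      have h8 : h * ((1 - 2 * γ) * (h * v)) = (1 - 2 * γ) * T := by rw [hT]; ring
      rw [h8]
      linarith
    exact le_of_mul_le_mul_left h5 hh
  obtain ⟨c, hc, hcE, hcs⟩ := hmom 1 ⟨zero_le_one, by linarith⟩
  obtain ⟨c', hc', hcE', hcs'⟩ := hmom (1 - γ) ⟨by linarith, by linarith⟩
  obtain ⟨c'', hc'', hcE'', hcs''⟩ := hmom (1 + γ) ⟨by linarith, le_rfl⟩
  -- Below `(1 - γ) T` the term with rate `1 - γ` exceeds `e ^ s`, and above `(1 + γ) T` the one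
  -- with rate `1 + γ` does, so outside the window the combination is nonpositive. Inside, `κ e ^ s
  -- ≤ 1 = f`. To leading order both subtracted terms have expectation `e ^ ((1 - γ²) T / 2)`,
  -- against `e ^ (T / 2)`.
  refine H.indep.blockLower H.mem hmn hfc (hbl 1 zero_le_one) (hbl (1 - γ) (by linarith))
    (hbl (1 + γ) (by linarith)) (κ := Real.exp (-((1 + γ) * T)))
    (c₁ := Real.exp (γ * ((1 - γ) * T))) (c₂ := Real.exp (-(γ * ((1 + γ) * T))))
    (Real.exp_pos _).le (Real.exp_pos _).le (Real.exp_pos _).le (fun x => ?_) ?_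
  · have hfx : f x = ramp (Real.exp ((1 - γ) * T))
        (Real.exp (1 * (h * ∑ j ∈ Finset.Ioc m n, min (x j) y))) := by
      rw [← hprod]
    rw [hprod, hprod, hprod, hfx, one_mul]
    set s := h * ∑ j ∈ Finset.Ioc m n, min (x j) y
    have hr0 := ramp_nonneg (Real.exp ((1 - γ) * T)) (Real.exp s)
    rw [← Real.exp_add, ← Real.exp_add]
    have p1 := Real.exp_pos (γ * ((1 - γ) * T) + (1 - γ) * s)
    have p2 := Real.exp_pos (-(γ * ((1 + γ) * T)) + (1 + γ) * s)
    have p3 := Real.exp_pos (-((1 + γ) * T))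
    rcases lt_or_ge s ((1 - γ) * T) with h1 | h1
    · have h2 : Real.exp s ≤ Real.exp (γ * ((1 - γ) * T) + (1 - γ) * s) :=
        Real.exp_le_exp.2 (by nlinarith)
      exact (mul_nonpos_of_nonneg_of_nonpos p3.le (by linarith)).trans hr0
    rcases lt_or_ge ((1 + γ) * T) s with h3 | h3
    · have h2 : Real.exp s ≤ Real.exp (-(γ * ((1 + γ) * T)) + (1 + γ) * s) :=
        Real.exp_le_exp.2 (by nlinarith)
      exact (mul_nonpos_of_nonneg_of_nonpos p3.le (by linarith)).trans hr0
    · rw [ramp_eq_one hlT (Real.exp_le_exp.2 h1)]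
      have h4 : Real.exp (-((1 + γ) * T)) * Real.exp s ≤ 1 := by
        rw [← Real.exp_add, Real.exp_le_one_iff]; linarith
      nlinarith
  · have b1 := H.le_prod_expMoment hmn hη0 (by rw [hη]; nlinarith) (by positivity)
      (by rw [one_mul]; exact hy) hc hcE hcs hM'
    have b2 := H.prod_expMoment_le hmn hη0.le (mul_nonneg (by linarith) hh.le) hc' hcE' hcs' hM
    have b3 := H.prod_expMoment_le hmn hη0.le (mul_nonneg (by linarith) hh.le) hc'' hcE'' hcs'' hM
    have hγT := mul_nonneg (sq_nonneg γ) hT0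
    have hηT : η * T = γ ^ 2 * T / 32 := by rw [hη]; ring
    have hη1 : η ≤ 1 / 4 := by rw [hη]; nlinarith
    have g1 : Real.exp ((1 / 2 - γ ^ 2 / 8) * T - 1) ≤
        ∏ j ∈ Finset.Ioc m n, 𝓔.ex (fun ω => Real.exp (1 * h * min (X j ω) y)) := by
      refine le_trans (Real.exp_le_exp.2 ?_) b1
      rw [one_mul]
      have e1 : (1 - η) * T ≤ h ^ 2 * (v - 𝓔.sSq X m) := by
        have := mul_le_mul_of_nonneg_left hm (sq_nonneg h)
        rw [hT]; linarith
      have e2 : (1 - 2 * η) ≤ (1 - η) ^ 2 := by nlinarith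
      have e3 : (1 - 2 * η) * ((1 - η) * T) ≤ (1 - η) ^ 2 * (h ^ 2 * (v - 𝓔.sSq X m)) :=
        mul_le_mul e2 e1 (mul_nonneg (by linarith) hT0) (sq_nonneg _)
      have e4 : 0 ≤ η * (η * T) := by positivity
      linarith
    have g2 : Real.exp (γ * ((1 - γ) * T)) *
        ∏ j ∈ Finset.Ioc m n, 𝓔.ex (fun ω => Real.exp ((1 - γ) * h * min (X j ω) y)) ≤
        Real.exp ((1 / 2 - 3 * γ ^ 2 / 8) * T + 1) := by
      refine (mul_le_mul_of_nonneg_left b2 (Real.exp_pos _).le).trans ?_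
      rw [← Real.exp_add, Real.exp_le_exp]
      have e1 : (1 - γ) * h * M ≤ 1 * (γ ^ 2 / 64 * T) := by
        rw [mul_assoc]
        exact mul_le_mul (by linarith) hMh (mul_nonneg hh.le
          ((Finset.sum_nonneg fun _ _ => abs_nonneg _).trans hM)) zero_le_one
      have e2 : ((1 - γ) * h) ^ 2 * v = (1 - γ) ^ 2 * T := by rw [hT]; ring
      have e3 : (1 - γ) ^ 2 * (η * T) ≤ 1 * (η * T) := by
        gcongr
        nlinarith
      rw [e2]
      linarith
    have g3 : Real.exp (-(γ * ((1 + γ) * T))) *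
        ∏ j ∈ Finset.Ioc m n, 𝓔.ex (fun ω => Real.exp ((1 + γ) * h * min (X j ω) y)) ≤
        Real.exp ((1 / 2 - 3 * γ ^ 2 / 8) * T + 1) := by
      refine (mul_le_mul_of_nonneg_left b3 (Real.exp_pos _).le).trans ?_
      rw [← Real.exp_add, Real.exp_le_exp]
      have e1 : (1 + γ) * h * M ≤ 2 * (γ ^ 2 / 64 * T) := by
        rw [mul_assoc]
        exact mul_le_mul (by linarith) hMh (mul_nonneg hh.le
          ((Finset.sum_nonneg fun _ _ => abs_nonneg _).trans hM)) zero_le_two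
      have e2 : ((1 + γ) * h) ^ 2 * v = (1 + γ) ^ 2 * T := by rw [hT]; ring
      have e3 : (1 + γ) ^ 2 * (η * T) ≤ 2 * (η * T) := by
        gcongr
        nlinarith
      rw [e2]
      linarith
    exact converse_arith hbig (by nlinarith) g1 g2 g3

end LILHyp

end SublinearExpectationSpace

/-! ### Blocks whose success bounds have a divergent sum. -/

namespace SublinearExpectationSpace

variable {Ω : Type*} [MeasurableSpace Ω] {𝓔 : SublinearExpectationSpace Ω} {X : ℕ → Ω → ℝ}

namespace LILHyp

variable (H : 𝓔.LILHyp X)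

include H

/-- The blocks that contain an index carry a divergent series. -/
theorem not_summable_nonempty_blocks {D δ : ℝ} (hD : 1 < D) (hδ : 0 < δ) (hδ1 : δ ≤ 1) :
    ¬ Summable (fun k : ℕ => if D ^ k ≤ 𝓔.sSq X (lastBelow (𝓔.sSq X) (D ^ (k + 1)))
      then Real.exp (-((1 - δ) * llog (D ^ k))) else 0) := by
  classical
  intro hs
  have hD0 : 0 < D := by linarith
  set N : ℕ → ℕ := fun k => lastBelow (𝓔.sSq X) (D ^ (k + 1)) with hN
  set u : ℕ → ℝ := fun k => if D ^ k ≤ 𝓔.sSq X (N k)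
      then Real.exp (-((1 - δ) * llog (D ^ k))) else 0 with hu
  have hu0 : ∀ k, 0 ≤ u k := fun k => by
    simp only [hu]; split_ifs <;> positivity
  set σ : ℕ → ℝ := fun n => 𝓔.ex (fun ω => X (n + 1) ω ^ 2) with hσ
  have hσ0 : ∀ n, 0 ≤ σ n := fun n => H.sigma_nonneg (n + 1) (by omega)
  set term : ℕ → ℝ≥0∞ := fun n => ENNReal.ofReal ((𝓔.sSq X (n + 1))⁻¹ *
    tlog (𝓔.sSq X (n + 1)) ^ (δ - 1) * σ n) with hterm
  -- Inside level `k` a term of (iii) is at most `e u_k D ^ (-k) E[X²]`, the factor `e` coming from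
  -- the truncation in `llog`. The variance up to the end of the level is below `D ^ (k + 1)`, so
  -- the level contributes at most `D e u_k`.
  set blk : ℕ → ℕ → ℝ≥0∞ := fun n k => if D ^ k ≤ 𝓔.sSq X (n + 1) ∧ 𝓔.sSq X (n + 1) < D ^ (k + 1)
    then ENNReal.ofReal (((D ^ k)⁻¹ * Real.exp 1 * u k) * σ n) else 0 with hblk
  have h1 : ∀ n, term n ≤ (if 𝓔.sSq X (n + 1) < 1 then term n else 0) + ∑' k, blk n k := by
    intro n
    by_cases hn : 𝓔.sSq X (n + 1) < 1
    · rw [if_pos hn]; exact le_self_add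
    rw [if_neg hn, zero_add]
    obtain ⟨k, hk1, hk2⟩ := exists_nat_pow_near (not_lt.1 hn) hD
    refine le_trans ?_ (ENNReal.le_tsum k)
    simp only [hblk, hterm]
    rw [if_pos ⟨hk1, hk2⟩]
    refine ENNReal.ofReal_le_ofReal (mul_le_mul_of_nonneg_right ?_ (hσ0 n))
    have hNk : D ^ k ≤ 𝓔.sSq X (N k) :=
      hk1.trans (H.sSq_mono ((H.le_blockEnd_iff hD0 k (n + 1)).2 hk2))
    simp only [hu]
    rw [if_pos hNk, mul_assoc]
    have hDk : 0 < D ^ k := by positivity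
    refine mul_le_mul (inv_anti₀ hDk hk1) ?_ (Real.rpow_nonneg (tlog_pos _).le _) (by positivity)
    have e1 : Real.exp (llog (D ^ k) - 1) ≤ tlog (𝓔.sSq X (n + 1)) := by
      rw [Real.exp_sub, div_le_iff₀ (Real.exp_pos 1), mul_comm]
      exact (exp_llog_le _).trans
        (mul_le_mul_of_nonneg_left (tlog_mono hk1) (Real.exp_pos 1).le)
    refine (Real.rpow_le_rpow_of_nonpos (Real.exp_pos _) e1 (by linarith)).trans ?_
    rw [← Real.exp_mul, ← Real.exp_add, Real.exp_le_exp]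
    linarith
  have h2 : ∀ k, ∑' n, blk n k ≤ ENNReal.ofReal (D * Real.exp 1 * u k) := by
    intro k
    by_cases hNk : D ^ k ≤ 𝓔.sSq X (N k)
    · have hz : 0 ≤ (D ^ k)⁻¹ * Real.exp 1 * u k := by
        have := hu0 k
        positivity
      rw [tsum_eq_sum (s := Finset.range (N k))]
      · refine (Finset.sum_le_sum (g := fun n => ENNReal.ofReal
          (((D ^ k)⁻¹ * Real.exp 1 * u k) * σ n)) fun n _ => ?_).trans ?_
        · simp only [hblk]; split_ifs <;> simp
        rw [← ENNReal.ofReal_sum_of_nonneg fun n _ => mul_nonneg hz (hσ0 n), ← Finset.mul_sum]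
        apply ENNReal.ofReal_le_ofReal
        have e1 : ∑ n ∈ Finset.range (N k), σ n = 𝓔.sSq X (N k) := by
          rw [Finset.range_eq_Ico, hσ,
            Finset.sum_Ico_add' (fun j => 𝓔.ex (fun ω => X j ω ^ 2)) 0 (N k) 1]
          rfl
        rw [e1]
        have e2 : 𝓔.sSq X (N k) ≤ D * D ^ k := by
          rw [← pow_succ']; exact (H.blockEnd_lt hD0 k).le
        have hDk : D ^ k ≠ 0 := by positivity
        calc _ ≤ ((D ^ k)⁻¹ * Real.exp 1 * u k) * (D * D ^ k) :=
              mul_le_mul_of_nonneg_left e2 hz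
          _ = _ := by field_simp
      · intro n hn
        rw [Finset.mem_range, not_lt] at hn
        simp only [hblk]
        rw [if_neg]
        rintro ⟨-, hc⟩
        have : n + 1 ≤ N k := (H.le_blockEnd_iff hD0 k (n + 1)).2 hc
        omega
    · have : ∀ n, blk n k = 0 := by
        intro n
        simp only [hblk]
        rw [if_neg]
        rintro ⟨ha, hb⟩
        exact hNk (ha.trans (H.sSq_mono ((H.le_blockEnd_iff hD0 k (n + 1)).2 hb)))
      simp [this]
  have h3 : ∑' n, (if 𝓔.sSq X (n + 1) < 1 then term n else 0) ≠ ∞ := by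
    obtain ⟨M, hM⟩ := eventually_atTop.1 (H.sSq_tendsto.eventually_ge_atTop 1)
    rw [tsum_eq_sum (s := Finset.range M)]
    · refine ENNReal.sum_ne_top.2 fun n _ => ?_
      split_ifs
      · exact ENNReal.ofReal_ne_top
      · simp
    · intro n hn
      rw [Finset.mem_range, not_lt] at hn
      exact if_neg (not_lt.2 (hM (n + 1) (by omega)))
  have h4 : ∑' n, term n ≠ ∞ := by
    refine ne_top_of_le_ne_top ?_ (ENNReal.tsum_le_tsum h1)
    rw [ENNReal.tsum_add, ENNReal.tsum_comm]
    refine ENNReal.add_ne_top.2 ⟨h3, ne_top_of_le_ne_top ?_ (ENNReal.tsum_le_tsum h2)⟩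
    exact (hs.mul_left (D * Real.exp 1)).tsum_ofReal_ne_top
  exact h4 (H.div δ hδ)

set_option maxHeartbeats 1000000 in
/-- Blocks whose success probabilities have a divergent sum; success means that the block sum
reaches almost the normalizer at the end of the block. -/
theorem exists_blocks {ε : ℝ} (hε : 0 < ε) (hε1 : ε ≤ 1) :
    ∃ (D : ℝ) (w : ℕ → ℝ) (K : ℕ), 1 < D ∧ 16 / ε ^ 2 ≤ D ∧ (∀ k, 0 ≤ w k) ∧ (∀ k, w k ≤ 1) ∧
      ¬ Summable w ∧ ∀ k ≥ K, ∀ m ≤ lastBelow (𝓔.sSq X) (D ^ (k + 1)), D * 𝓔.sSq X m ≤ D ^ k →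
        ∃ f : (ℕ → ℝ) → ℝ, CylBL (lastBelow (𝓔.sSq X) (D ^ (k + 1))) f ∧ (∀ x, 0 ≤ f x) ∧
          (∀ x, f x ≤ 1) ∧ (∀ x, f x ≠ 0 →
            D ^ k ≤ 𝓔.sSq X (lastBelow (𝓔.sSq X) (D ^ (k + 1))) ∧
            (1 - ε / 2) * 𝓔.an X (lastBelow (𝓔.sSq X) (D ^ (k + 1))) ≤
              ∑ j ∈ Finset.Ioc m (lastBelow (𝓔.sSq X) (D ^ (k + 1))), x j) ∧
          𝓔.BlockLower X m f (w k) := by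
  classical
  set γ := ε / 32 with hγ
  have hγ0 : 0 < γ := by positivity
  have hγ1 : γ ≤ 1 / 32 := by rw [hγ]; linarith
  set η := γ ^ 2 / 32 with hη
  have hη0 : 0 < η := by positivity
  have hη1 : η ≤ 1 / 32 := by rw [hη]; nlinarith
  -- Makes the variance before the block at most the fraction `η` of that at its end.
  set D := 1 / η with hDdef
  have hD1 : 32 ≤ D := by
    rw [hDdef, le_div_iff₀ hη0]; linarith
  have hD : 1 < D := by linarith
  have hD0 : 0 < D := by linarith
  have hηD : η * D = 1 := by rw [hDdef]; field_simp
  -- Tilting by slightly less than `tilt v` still reaches `(1 - 2 γ) lam a_n ≥ (1 - ε / 2) a_n`, at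
  -- the cost `lam² (1 + 4 γ) llog v ≤ (1 - ε / 4) llog v`. A coefficient below one is what
  -- divergence needs.
  set lam := 1 - ε / 4 with hlam
  have hlam0 : 3 / 4 ≤ lam := by rw [hlam]; linarith
  have arith₁ : (1 + γ) * lam ≤ 1 := by rw [hγ, hlam]; nlinarith
  have arith₂ : 1 / 2 * lam ≤ lam ^ 2 := by nlinarith
  have arith₃ : (1 - ε / 2) ≤ (1 - 2 * γ) * lam := by rw [hγ, hlam]; nlinarith
  have arith₄ : lam ^ 2 * (1 + 4 * γ) ≤ 1 - ε / 4 := by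
    rw [hlam, hγ]; nlinarith [mul_nonneg hε.le (sub_nonneg.2 hε1), mul_nonneg hε.le (sq_nonneg ε),
      mul_nonneg (mul_nonneg hε.le hε.le) (sub_nonneg.2 hε1)]
  have arith₅ : 1 / 2 ≤ lam ^ 2 := by nlinarith
  set δ := ε / 4 with hδ
  obtain ⟨p, d, C, q, hp, hd, hC, hq, hqs, hmom⟩ := H.exists_expMoment hη0 (by linarith) hD
  set ζ := (1 - δ) / (d + 1) with hζ
  have hδ1 : 0 < 1 - δ := by rw [hδ]; linarith
  have hζ0 : 0 < ζ := by positivity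
  set τ := ζ / 4 with hτ
  have hτ0 : 0 < τ := by positivity
  set N : ℕ → ℕ := fun k => lastBelow (𝓔.sSq X) (D ^ (k + 1)) with hN
  -- Blocks with larger `q k` may be dropped: there `exp (-(1 - δ) llog (D ^ k)) < q k ^ (d + 1)`,
  -- by the choice of `ζ`, and these powers are summable. On the others, `τ = ζ / 4` makes the
  -- moment errors tend to zero.
  set good : ℕ → Prop := fun k => D ^ k ≤ 𝓔.sSq X (N k) ∧ q k ≤ Real.exp (-(ζ * llog (D ^ k)))
    with hgood
  set c₀ := Real.exp (-2 - Real.log D) with hc₀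
  have hlogD : 0 < Real.log D := Real.log_pos hD
  have hc₀1 : c₀ ≤ 1 := by rw [hc₀, Real.exp_le_one_iff]; linarith
  have hc₀0 : 0 < c₀ := Real.exp_pos _
  have hL := tendsto_llog_pow hD
  have hlim : Tendsto (fun k : ℕ => C * ((2 * llog (D ^ k)) ^ p *
      Real.exp (-(τ * (2 * llog (D ^ k)))))) atTop (𝓝 0) := by
    have h1 := (tendsto_rpow_mul_exp_neg_mul_atTop_nhds_zero p τ hτ0).comp
      (hL.const_mul_atTop zero_lt_two)
    simpa [Function.comp_def] using h1.const_mul C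
  obtain ⟨K, hK⟩ := eventually_atTop.1 (((hlim.eventually (gt_mem_nhds hη0)).and
    (H.eventually_block_mean_le (κ := γ ^ 2 / 128) (by positivity) hD)).and
    ((hL.eventually_ge_atTop (D * η / (lam * τ))).and (hL.eventually_ge_atTop (16 / γ ^ 2))))
  refine ⟨D, fun k => if good k then c₀ * Real.exp (-((1 - δ) * llog (D ^ k))) else 0, K, hD, ?_,
    fun k => ?_, fun k => ?_, ?_, ?_⟩
  · rw [hDdef, hη, hγ, div_le_div_iff₀ (by positivity) (by positivity)]
    nlinarith [sq_nonneg ε]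
  · simp only; split_ifs <;> positivity
  · simp only
    split_ifs
    · have h1 : Real.exp (-((1 - δ) * llog (D ^ k))) ≤ 1 := by
        rw [Real.exp_le_one_iff]
        have := mul_pos hδ1 (llog_pos (D ^ k))
        linarith
      exact mul_le_one₀ hc₀1 (Real.exp_pos _).le h1
    · exact zero_le_one
  · intro hs
    refine H.not_summable_nonempty_blocks hD (δ := δ) (by positivity) (by linarith) ?_
    refine Summable.of_nonneg_of_le (fun k => ?_) (fun k => ?_) ((hs.mul_left c₀⁻¹).add hqs)
    · split_ifs <;> positivity
    · have hqk := Real.rpow_nonneg (hq k) (d + 1)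
      have hw : 0 ≤ c₀⁻¹ * (if good k then c₀ * Real.exp (-((1 - δ) * llog (D ^ k))) else 0) := by
        split_ifs <;> positivity
      by_cases h1 : D ^ k ≤ 𝓔.sSq X (lastBelow (𝓔.sSq X) (D ^ (k + 1)))
      · rw [if_pos h1]
        by_cases h2 : q k ≤ Real.exp (-(ζ * llog (D ^ k)))
        · rw [if_pos (show good k from ⟨h1, h2⟩), inv_mul_cancel_left₀ hc₀0.ne']
          linarith
        · push Not at h2
          have h3 := Real.rpow_le_rpow (Real.exp_pos _).le h2.le (show 0 ≤ d + 1 by positivity)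
          rw [← Real.exp_mul] at h3
          have h4 : -(ζ * llog (D ^ k)) * (d + 1) = -((1 - δ) * llog (D ^ k)) := by
            rw [hζ]; field_simp
          rw [h4] at h3
          linarith
      · rw [if_neg h1]
        linarith
  · intro k hk m hm hDm
    by_cases hg : good k
    swap
    · refine ⟨fun _ => 0, CylBL.const _ 0, fun _ => le_rfl, fun _ => zero_le_one,
        fun x hx => absurd rfl hx, ?_⟩
      simp only [if_neg hg]
      exact blockLower_zero
    obtain ⟨hg1, hg2⟩ := hg
    obtain ⟨⟨hk1, hk2⟩, hk3, hk4⟩ := hK k hk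
    set n := lastBelow (𝓔.sSq X) (D ^ (k + 1)) with hn
    set v := 𝓔.sSq X n with hv
    change D ^ k ≤ v at hg1
    have hDk : 0 < D ^ k := by positivity
    have hv0 : 0 < v := hDk.trans_le hg1
    have hvD : v < D ^ (k + 1) := H.blockEnd_lt hD0 k
    set h := lam * tilt v with hh
    have htv := tilt_pos hv0
    have hh0 : 0 < h := by positivity
    have htk : tilt v ≤ tilt (D ^ k) := tilt_anti hDk hg1
    have hlk := llog_pos (D ^ k)
    have hlv : llog (D ^ k) ≤ llog v := llog_mono hg1
    have hhv : h * v = lam * 𝓔.an X n := by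
      rw [hh, mul_assoc, tilt_mul_self hv0]; rfl
    have hT : h ^ 2 * v = lam ^ 2 * (2 * llog v) := by
      have : h ^ 2 * v = lam ^ 2 * (tilt v * (tilt v * v)) := by rw [hh]; ring
      rw [this, tilt_mul_self hv0, tilt_mul_amp hv0]
    have hha : h * 𝓔.an X n = lam * (2 * llog v) := by
      rw [hh, an_eq, mul_assoc, tilt_mul_amp hv0]
    have hM : ∑ j ∈ Finset.Icc 1 n, |𝓔.ex (X j)| ≤ γ ^ 2 / 128 * 𝓔.an X n := by
      refine le_trans ?_ hk2
      have : 0 ≤ ∑ j ∈ Finset.Icc 1 n, |𝓔.ex (fun ω => -X j ω)| :=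
        Finset.sum_nonneg fun _ _ => abs_nonneg _
      linarith
    have hM' : ∑ j ∈ Finset.Icc 1 n, |𝓔.ex (fun ω => -X j ω)| ≤ γ ^ 2 / 128 * 𝓔.an X n := by
      refine le_trans ?_ hk2
      have : 0 ≤ ∑ j ∈ Finset.Icc 1 n, |𝓔.ex (X j)| := Finset.sum_nonneg fun _ _ => abs_nonneg _
      linarith
    have hbd : (1 + γ) * lam ≤ 1 := arith₁
    have hll : 1 / 2 * lam ≤ lam ^ 2 := arith₂
    have o1 : 𝓔.sSq X m ≤ γ ^ 2 / 32 * 𝓔.sSq X n := by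
      rw [← hη, ← hv]
      calc 𝓔.sSq X m = η * (D * 𝓔.sSq X m) := by rw [← mul_assoc, hηD, one_mul]
        _ ≤ η * D ^ k := by gcongr
        _ ≤ _ := by gcongr
    have o2 : γ ^ 2 / 32 ≤ h * (τ * amp (D ^ k)) := by
      rw [← hη]
      have e1 : tilt (D ^ k) ≤ D * tilt v := (tilt_le_mul hD.le hDk).trans
        (mul_le_mul_of_nonneg_left (tilt_anti hv0 (by rw [← pow_succ']; exact hvD.le)) hD0.le)
      have e2 : D * η ≤ lam * τ * llog (D ^ k) := by
        rw [div_le_iff₀ (by positivity)] at hk3; linarith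
      have e3 : 2 * llog (D ^ k) ≤ D * (tilt v * amp (D ^ k)) := by
        rw [← tilt_mul_amp hDk, ← mul_assoc]
        exact mul_le_mul_of_nonneg_right e1 (amp_nonneg _)
      have e4 : lam * τ * (2 * llog (D ^ k)) ≤ lam * τ * (D * (tilt v * amp (D ^ k))) :=
        mul_le_mul_of_nonneg_left e3 (by positivity)
      have e5 : 0 ≤ lam * τ * llog (D ^ k) := by positivity
      have e6 : D * η ≤ D * (h * (τ * amp (D ^ k))) := by
        rw [hh]; linarith
      exact le_of_mul_le_mul_left e6 hD0
    have o3 : h * (γ ^ 2 / 128 * 𝓔.an X n) ≤ γ ^ 2 / 64 * (h ^ 2 * 𝓔.sSq X n) := by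
      rw [← hv, hT]
      have e1 : h * (γ ^ 2 / 128 * 𝓔.an X n) = γ ^ 2 / 128 * (h * 𝓔.an X n) := by ring
      rw [e1, hha]
      have e2 := mul_le_mul_of_nonneg_right hll (show 0 ≤ γ ^ 2 / 64 * (2 * llog v) by
        have := llog_pos v
        positivity)
      linarith
    have o4 : 16 ≤ γ ^ 2 * (h ^ 2 * 𝓔.sSq X n) := by
      rw [← hv, hT]
      rw [div_le_iff₀ (by positivity)] at hk4
      have e2 : 1 / 2 * (2 * llog v) ≤ lam ^ 2 * (2 * llog v) :=
        mul_le_mul_of_nonneg_right arith₅ (by linarith [llog_pos v])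
      have e3 := mul_le_mul_of_nonneg_left
        (hlv.trans (show llog v ≤ lam ^ 2 * (2 * llog v) by linarith)) (sq_nonneg γ)
      linarith
    have o5 : ∀ r ∈ Set.Icc (0 : ℝ) (1 + γ), ∃ c : ℕ → ℝ, (∀ j, 0 ≤ c j) ∧
        (∀ j ∈ Finset.Icc 1 n, 𝓔.ExpMoment (X j) (γ ^ 2 / 32) (r * h) (τ * amp (D ^ k)) (c j)) ∧
        ∑ j ∈ Finset.Icc 1 n, c j ≤ γ ^ 2 / 32 := by
      intro r hr
      have hr0 : 0 ≤ r := hr.1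
      have hrt : r * h ≤ tilt (D ^ k) := by
        calc r * h ≤ (1 + γ) * h := mul_le_mul_of_nonneg_right hr.2 hh0.le
          _ = (1 + γ) * lam * tilt v := by rw [hh]; ring
          _ ≤ 1 * tilt v := mul_le_mul_of_nonneg_right hbd htv.le
          _ ≤ _ := by rw [one_mul]; exact htk
      have ha := amp_pos hDk
      obtain ⟨c, hc1, hc2, hc3⟩ := hmom k (r * h) (τ * amp (D ^ k)) (by positivity) hrt
        (by positivity)
      refine ⟨c, hc1, hc2, hc3.trans (le_trans ?_ hk1.le)⟩
      have e1 : r * h * amp (D ^ k) ≤ 2 * llog (D ^ k) := by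
        rw [← tilt_mul_amp hDk]; exact mul_le_mul_of_nonneg_right hrt ha.le
      have e2 : Real.exp (r * h * (τ * amp (D ^ k))) ≤ Real.exp (τ * (2 * llog (D ^ k))) := by
        rw [Real.exp_le_exp]
        have := mul_le_mul_of_nonneg_left e1 hτ0.le
        linarith
      have e3 : (r * h * amp (D ^ k)) ^ p ≤ (2 * llog (D ^ k)) ^ p :=
        Real.rpow_le_rpow (by positivity) e1 (by linarith)
      have e4 : Real.exp (τ * (2 * llog (D ^ k))) * Real.exp (-(ζ * llog (D ^ k))) =
          Real.exp (-(τ * (2 * llog (D ^ k)))) := by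
        rw [← Real.exp_add, hτ]; ring_nf
      have e5 : 0 ≤ (r * h * amp (D ^ k)) ^ p := by positivity
      calc _ ≤ C * Real.exp (τ * (2 * llog (D ^ k))) * (2 * llog (D ^ k)) ^ p *
            Real.exp (-(ζ * llog (D ^ k))) := by
              have := hq k
              gcongr
        _ = C * ((2 * llog (D ^ k)) ^ p * (Real.exp (τ * (2 * llog (D ^ k))) *
            Real.exp (-(ζ * llog (D ^ k))))) := by ring
        _ = _ := by rw [e4]
    obtain ⟨f, hf1, hf2, hf3, hf4, hf5⟩ := H.exists_blockLower hm hγ0 hγ1 hh0 o1 o2 hM hM' o3 o4 o5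
    refine ⟨f, hf1, hf2, hf3, fun x hx => ⟨hg1, le_trans ?_ (hf4 x hx)⟩, ?_⟩
    · rw [← hv, hhv, ← mul_assoc]
      exact mul_le_mul_of_nonneg_right arith₃ (amp_nonneg _)
    · refine hf5.mono H.mem ?_
      beta_reduce
      rw [if_pos (show good k from ⟨hg1, hg2⟩), hc₀, ← Real.exp_add, Real.exp_le_exp, ← hv, hT]
      have e1 : llog v ≤ Real.log D + llog (D ^ k) := by
        refine (llog_mono hvD.le).trans ?_
        rw [pow_succ']; exact llog_mul_le_log_add hD.le _
      have e3 := mul_le_mul_of_nonneg_right arith₄ (llog_pos v).le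
      have e4 := mul_le_mul_of_nonneg_left e1 hδ1.le
      have e5 : 0 ≤ δ * Real.log D := by positivity
      linarith

end LILHyp

end SublinearExpectationSpace

/-! ### The lower half of the law. -/

theorem exists_not_summable_two_mul_add {w : ℕ → ℝ} (h : ¬ Summable w) (K : ℕ) :
    ∃ r, ¬ Summable (fun i => w (2 * i + r + K)) := by
  by_contra! hc
  refine h ((summable_nat_add_iff K).1 ?_)
  obtain ⟨a, ha⟩ := hc 0
  obtain ⟨b, hb⟩ := hc 1
  exact (HasSum.even_add_odd (f := fun k => w (k + K)) ha hb).summable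

theorem partialSum_add_sum_Ioc {Ω : Type*} (X : ℕ → Ω → ℝ) {m n : ℕ} (h : m ≤ n) (ω : Ω) :
    partialSum X n ω = partialSum X m ω + ∑ j ∈ Finset.Ioc m n, X j ω := by
  have hd : Disjoint (Finset.Icc 1 m) (Finset.Ioc m n) :=
    Finset.disjoint_left.2 fun j hj hj' => by
      have := (Finset.mem_Icc.1 hj).2
      have := (Finset.mem_Ioc.1 hj').1
      omega
  rw [partialSum, partialSum, ← Finset.sum_union hd]
  congr 1
  ext j
  simp only [Finset.mem_Icc, Finset.mem_union, Finset.mem_Ioc]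
  omega

namespace SublinearExpectationSpace

variable {Ω : Type*} [MeasurableSpace Ω] {𝓔 : SublinearExpectationSpace Ω} {X : ℕ → Ω → ℝ}

namespace LILHyp

variable (H : 𝓔.LILHyp X)

include H

/-- Infinitely many blocks give a lower deviation, unless an earlier sum is exceptionally large. -/
theorem exists_lower_prob {ε δ : ℝ} (hε : 0 < ε) (hε1 : ε ≤ 1) (hδ : 0 < δ) (n : ℕ) :
    ∃ N : ℕ, ∃ g : Ω → ℝ, 𝓔.IsL1 g ∧ 1 - δ ≤ 𝓔.ex g ∧ (∀ ω, g ω ≤ 1) ∧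
      ∀ ω, g ω ≤ 0 ∨ (∃ m, n ≤ m ∧ m ≤ N ∧ 1 - ε ≤ partialSum X m ω / 𝓔.an X m) ∨
        ∃ m, n ≤ m ∧ m ≤ N ∧ 1 + 1 < |partialSum X m ω| / 𝓔.an X m := by
  obtain ⟨D, w, K, hD, hDε, hw0, hw1, hws, hb⟩ := H.exists_blocks hε hε1
  have hD0 : 0 < D := by linarith
  set L : ℕ → ℕ := fun k => lastBelow (𝓔.sSq X) (D ^ (k + 1)) with hL
  have hLlt : ∀ k, 𝓔.sSq X (L k) < D ^ (k + 1) := H.blockEnd_lt hD0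
  have hLm : Monotone L := fun a b hab => (H.le_blockEnd_iff hD0 b _).2
    ((hLlt a).trans_le (pow_le_pow_right₀ hD.le (by omega)))
  obtain ⟨K₁, hK₁n, hK₁a, hK₁K⟩ : ∃ K₁, n ≤ L K₁ ∧ 0 < 𝓔.an X (L K₁) ∧ K ≤ K₁ := by
    obtain ⟨K₁, ⟨h1, h2⟩, h3⟩ := (((H.tendsto_blockEnd hD).eventually_ge_atTop n).and
      ((H.amp_tendsto.comp (H.tendsto_blockEnd hD)).eventually_gt_atTop 0)).and
      (eventually_ge_atTop K) |>.exists
    exact ⟨K₁, h1, h2, h3⟩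
  obtain ⟨r, hr⟩ := exists_not_summable_two_mul_add hws (K₁ + 2)
  -- Each stretch `(N i, N (i + 1)]` spans two levels, so a nonempty final level puts a factor `D`
  -- between the variances at its ends. One of the two parity classes keeps a divergent sum.
  set N : ℕ → ℕ := fun i => L (2 * i + r + K₁) with hN
  have hNm : Monotone N := fun a b hab => hLm (by omega)
  have hNs : ∀ i, N (i + 1) = L (2 * i + r + (K₁ + 2)) := fun i => by
    simp only [hN]; congr 1; ring
  have hNn : ∀ i, n ≤ N i := fun i => hK₁n.trans (hLm (by omega))
  have hNa : ∀ i, 0 < 𝓔.an X (N i) := fun i => hK₁a.trans_le (H.an_mono (hLm (by omega)))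
  have hNlt : ∀ i, 𝓔.sSq X (N i) < D ^ (2 * i + r + K₁ + 1) := fun i => hLlt _
  choose f hf hf0 hf1 hfx hfb using fun i => hb (2 * i + r + (K₁ + 2)) (by omega) (N i)
    (hLm (by omega)) (by
      calc D * 𝓔.sSq X (N i) ≤ D * D ^ (2 * i + r + K₁ + 1) :=
            mul_le_mul_of_nonneg_left (hNlt i).le hD0.le
        _ = _ := by ring)
  have hprod := BlockLower.prod hNm (fun i => by rw [hNs]; exact hf i) hf1
    (fun i => hw1 _) hfb
  obtain ⟨I, hI⟩ : ∃ I, Real.exp (-∑ i ∈ Finset.range I, w (2 * i + r + (K₁ + 2))) < δ := by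
    have h1 := (not_summable_iff_tendsto_nat_atTop_of_nonneg fun i => hw0 _).1 hr
    have h2 := Real.tendsto_exp_neg_atTop_nhds_zero.comp h1
    exact (h2.eventually (gt_mem_nhds hδ)).exists
  have hcyl : CylBL (N I) (fun x => 1 - ∏ i ∈ Finset.range I, (1 - f i x)) :=
    (CylBL.prod _ fun i hi => (((hf i).mono (by
      change L _ ≤ _
      rw [← hNs]; exact hNm (Finset.mem_range.1 hi))).one_sub)).one_sub
  refine ⟨N I, _, hcyl.isL1 H.mem, le_trans ?_ (hprod I), fun ω => ?_, fun ω => ?_⟩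
  · have : ∏ i ∈ Finset.range I, (1 - w (2 * i + r + (K₁ + 2))) ≤
        Real.exp (-∑ i ∈ Finset.range I, w (2 * i + r + (K₁ + 2))) := by
      rw [← Finset.sum_neg_distrib, Real.exp_sum]
      refine Finset.prod_le_prod (fun i _ => sub_nonneg.2 (hw1 _)) fun i _ => ?_
      linarith [Real.add_one_le_exp (-w (2 * i + r + (K₁ + 2)))]
    linarith
  · have : 0 ≤ ∏ i ∈ Finset.range I, (1 - f i (fun j => X j ω)) :=
      Finset.prod_nonneg fun i _ => sub_nonneg.2 (hf1 _ _)
    linarith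
  · by_cases h0 : ∀ i ∈ Finset.range I, f i (fun j => X j ω) = 0
    · left
      rw [Finset.prod_eq_one fun i hi => by rw [h0 i hi, sub_zero], sub_self]
    right
    push Not at h0
    obtain ⟨i, hi, hne⟩ := h0
    have hiI : i + 1 ≤ I := Finset.mem_range.1 hi
    obtain ⟨h1, h2⟩ := hfx i _ hne
    change _ ≤ 𝓔.sSq X (L _) at h1
    change _ * 𝓔.an X (L _) ≤ ∑ j ∈ Finset.Ioc (N i) (L _), X j ω at h2
    rw [← hNs] at h1 h2
    by_cases hC : 1 + 1 < |partialSum X (N i) ω| / 𝓔.an X (N i)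
    · exact Or.inr ⟨N i, hNn i, hNm (by omega), hC⟩
    refine Or.inl ⟨N (i + 1), hNn _, hNm hiI, ?_⟩
    rw [not_lt, div_le_iff₀ (hNa i)] at hC
    rw [le_div_iff₀ (hNa _), partialSum_add_sum_Ioc X (hNm (Nat.le_succ i))]
    have h3 := neg_abs_le (partialSum X (N i) ω)
    -- With `|S| ≤ 2 a` at `N i`, the earlier sum then costs at most `ε / 2` of the normalizer at `N
    -- (i + 1)`, the same as the loss within the block.
    have h4 : 4 / ε ≤ √D := Real.le_sqrt_of_sq_le (by rw [div_pow]; norm_num; exact hDε)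
    have h5 : √D * 𝓔.an X (N i) ≤ 𝓔.an X (N (i + 1)) := by
      calc √D * 𝓔.an X (N i) ≤ √D * amp (D ^ (2 * i + r + K₁ + 1)) :=
            mul_le_mul_of_nonneg_left (amp_mono (hNlt i).le) (Real.sqrt_nonneg _)
        _ ≤ amp (D * D ^ (2 * i + r + K₁ + 1)) := sqrt_mul_amp_le hD.le (by positivity)
        _ ≤ _ := amp_mono (le_trans (le_of_eq (by ring)) h1)
    have h6 : 4 * 𝓔.an X (N i) ≤ ε * 𝓔.an X (N (i + 1)) := by
      have := mul_le_mul_of_nonneg_left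
        ((mul_le_mul_of_nonneg_right h4 (hNa i).le).trans h5) hε.le
      calc 4 * 𝓔.an X (N i) = ε * (4 / ε * 𝓔.an X (N i)) := by field_simp
        _ ≤ _ := this
    linarith

/-- The supremum over `N` is exactly `1` for every `n`. Starting from a later `n₀`, success or an
exceptional earlier sum has capacity at least `1 - δ / 2`; the upper half bounds the exceptional
event by `δ / 2`. -/
theorem tendsto_lower {V : Set Ω → ℝ} (hV : 𝓔.IsUpperCapacity V) {ε : ℝ} (hε : 0 < ε) :
    Tendsto (fun n : ℕ => ⨆ N : ℕ,
        V {ω | ∃ m, n ≤ m ∧ m ≤ N ∧ 1 - ε ≤ partialSum X m ω / 𝓔.an X m}) atTop (𝓝 1) := by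
  have hmeas : ∀ n N (c : ℝ), MeasurableSet
      {ω | ∃ m, n ≤ m ∧ m ≤ N ∧ c ≤ partialSum X m ω / 𝓔.an X m} := by
    intro n N c
    simp only [Set.ofPred_exists, Set.ofPred_and]
    refine MeasurableSet.iUnion fun m => (MeasurableSet.const _).inter
      ((MeasurableSet.const _).inter (measurableSet_le measurable_const ?_))
    exact (H.measurable_partialSum m).div_const _
  have hmeas' : ∀ n N, MeasurableSet
      {ω | ∃ m, n ≤ m ∧ m ≤ N ∧ 1 + 1 < |partialSum X m ω| / 𝓔.an X m} := by
    intro n N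
    simp only [Set.ofPred_exists, Set.ofPred_and]
    refine MeasurableSet.iUnion fun m => (MeasurableSet.const _).inter
      ((MeasurableSet.const _).inter (measurableSet_lt measurable_const ?_))
    exact (H.measurable_partialSum m).abs.div_const _
  have hV1 : ∀ A, MeasurableSet A → V A ≤ 1 := fun A hA => by
    rw [← hV.univ]; exact hV.mono _ _ hA MeasurableSet.univ (Set.subset_univ _)
  have hbdd : ∀ n, BddAbove (Set.range fun N : ℕ =>
      V {ω | ∃ m, n ≤ m ∧ m ≤ N ∧ 1 - ε ≤ partialSum X m ω / 𝓔.an X m}) := fun n =>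
    ⟨1, by rintro _ ⟨N, rfl⟩; exact hV1 _ (hmeas _ _ _)⟩
  suffices h : ∀ n, ⨆ N : ℕ,
      V {ω | ∃ m, n ≤ m ∧ m ≤ N ∧ 1 - ε ≤ partialSum X m ω / 𝓔.an X m} = 1 by
    simp only [h, tendsto_const_nhds]
  intro n
  refine le_antisymm (ciSup_le fun N => hV1 _ (hmeas _ _ _)) (le_of_forall_pos_le_add fun δ hδ => ?_)
  have hm : 0 < min ε 1 := lt_min hε one_pos
  obtain ⟨n₀, hn₀, hn₀n⟩ := (((H.tendsto_upper hV one_pos).eventually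
    (gt_mem_nhds (half_pos hδ))).and (eventually_ge_atTop n)).exists
  obtain ⟨N, g, hg, hg1, hg2, hg3⟩ := H.exists_lower_prob hm (min_le_right _ _) (half_pos hδ) n₀
  set A := {ω | ∃ m, n₀ ≤ m ∧ m ≤ N ∧ 1 - min ε 1 ≤ partialSum X m ω / 𝓔.an X m} with hA
  set C := {ω | ∃ m, n₀ ≤ m ∧ m ≤ N ∧ 1 + 1 < |partialSum X m ω| / 𝓔.an X m} with hC
  have hgV : 𝓔.ex g ≤ V (A ∪ C) := by
    have := hV.le_of_le_indicator _ ((hmeas _ _ _).union (hmeas' _ _)) g hg.mem fun ω => by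
      by_cases hω : ω ∈ A ∪ C
      · rw [Set.indicator_of_mem hω]; exact hg2 ω
      · rw [Set.indicator_of_notMem hω]
        rcases hg3 ω with h | h
        · exact h
        · exact absurd h hω
    rw [← hg.coe_ex] at this
    exact EReal.coe_le_coe_iff.1 this
  have hCV : V C ≤ δ / 2 := by
    refine le_trans ?_ hn₀.le
    exact le_ciSup (f := fun N : ℕ =>
      V {ω | ∃ m, n₀ ≤ m ∧ m ≤ N ∧ 1 + 1 < |partialSum X m ω| / 𝓔.an X m})
      ⟨1, by rintro _ ⟨N, rfl⟩; exact hV1 _ (hmeas' _ _)⟩ N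
  have hAV : V A ≤ V {ω | ∃ m, n ≤ m ∧ m ≤ N ∧ 1 - ε ≤ partialSum X m ω / 𝓔.an X m} := by
    refine hV.mono _ _ (hmeas _ _ _) (hmeas _ _ _) ?_
    rintro ω ⟨m, h1, h2, h3⟩
    exact ⟨m, hn₀n.trans h1, h2, le_trans (by linarith [min_le_left ε 1]) h3⟩
  have := hV.subadd A C (hmeas _ _ _) (hmeas' _ _)
  have := le_ciSup (hbdd n) N
  linarith

end LILHyp

/-- A ramp fits between the indicators at `l` and `l / 2`. Condition (i), stated for `V`, thus
passes to `upCap` at the price of halving `ε`. -/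
theorem upCap_tail_le {V : Set Ω → ℝ} (hV : 𝓔.IsUpperCapacity V) {Y : Ω → ℝ} (hY : Y ∈ 𝓔.H)
    {l : ℝ} (hl : 0 < l) : 𝓔.upCap {ω | l ≤ |Y ω|} ≤ ENNReal.ofReal (V {ω | l / 2 ≤ |Y ω|}) := by
  have hg : (fun ω => ramp l |Y ω|) ∈ 𝓔.H := by
    obtain ⟨C, hC, -, h⟩ := bddLip_ramp hl
    refine comp_mem_one hY (φ := fun y => ramp l |y|)
      (isLocLip_of_lipschitz hC fun x y => (h _ _).trans ?_)
    exact mul_le_mul_of_nonneg_left (abs_abs_sub_abs_le_abs_sub x y) hC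
  have hg1 : 𝓔.IsL1 (fun ω => ramp l |Y ω|) := IsL1.of_bdd hg (C := 1) fun ω => by
    rw [abs_of_nonneg (ramp_nonneg _ _)]; exact ramp_le_one _ _
  refine (upCap_le_ofReal hg1 (fun _ => ramp_nonneg _ _)
    fun ω hω => (ramp_eq_one hl hω).ge).trans (ENNReal.ofReal_le_ofReal ?_)
  have := hV.le_of_le_indicator _
    (measurableSet_le (measurable_const (a := l / 2)) (𝓔.measurable_of_mem _ hY).abs) _ hg
    fun ω => by
      by_cases hω : l / 2 ≤ |Y ω|
      · rw [Set.indicator_of_mem (by exact hω)]; exact ramp_le_one _ _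
      · rw [Set.indicator_of_notMem (by exact hω), ramp_eq_zero]
        rw [div_le_one hl]; linarith
  rw [← hg1.coe_ex] at this
  exact_mod_cast this

end SublinearExpectationSpace

end

/-! ### Assembly. -/

theorem mainTheorem2 {Ω : Type*} [MeasurableSpace Ω] (𝓔 : SublinearExpectationSpace Ω)
    (V : Set Ω → ℝ) (hV : 𝓔.IsUpperCapacity V)
    (X : ℕ → Ω → ℝ) (hX : ∀ n, 1 ≤ n → X n ∈ 𝓔.H)
    (hX2 : ∀ n, 1 ≤ n → 𝓔.E (fun ω => X n ω ^ 2) < ⊤)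
    (hind : 𝓔.IndepSeq X)
    (htail : ∀ ε : ℝ, 0 < ε →
      Summable (fun n : ℕ => V {ω | ε * 𝓔.an X (n + 1) ≤ |X (n + 1) ω|}))
    (hmom : ∀ α : ℝ, 0 < α → ∃ p d : ℝ, 2 ≤ p ∧ 0 ≤ d ∧
      ∑' n : ℕ, (if 𝓔.sd X (n + 1) = 0 then 0 else
        𝓔.Gam X p α (n + 1) / ENNReal.ofReal (𝓔.an X (n + 1) ^ p) *
          (𝓔.Lam X p α (n + 1) / ENNReal.ofReal (𝓔.an X (n + 1) ^ p)) ^ d) < ∞)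
    (hdiv : ∀ δ : ℝ, 0 < δ →
      ∑' n : ℕ, ENNReal.ofReal ((𝓔.sSq X (n + 1))⁻¹ * tlog (𝓔.sSq X (n + 1)) ^ (δ - 1) *
        (𝓔.E (fun ω => X (n + 1) ω ^ 2)).toReal) = ∞)
    (hmean : Tendsto (fun n : ℕ =>
      (∑ j ∈ Finset.Icc 1 n, |(𝓔.E (X j)).toReal| +
        ∑ j ∈ Finset.Icc 1 n, |(𝓔.conjE (X j)).toReal|) / 𝓔.an X n) atTop (𝓝 0)) :
    (∀ ε : ℝ, 0 < ε →
      Tendsto (fun n : ℕ => ⨆ N : ℕ,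
        V {ω | ∃ m, n ≤ m ∧ m ≤ N ∧ 1 + ε < |partialSum X m ω| / 𝓔.an X m}) atTop (𝓝 0) ∧
      Tendsto (fun n : ℕ => ⨆ N : ℕ,
        V {ω | ∃ m, n ≤ m ∧ m ≤ N ∧ 1 - ε ≤ -partialSum X m ω / 𝓔.an X m}) atTop (𝓝 1) ∧
      Tendsto (fun n : ℕ => ⨆ N : ℕ,
        V {ω | ∃ m, n ≤ m ∧ m ≤ N ∧ 1 - ε ≤ partialSum X m ω / 𝓔.an X m}) atTop (𝓝 1)) ∧
    𝓔.outCap {ω | 1 < limsup (fun n : ℕ => ((|partialSum X n ω| / 𝓔.an X n : ℝ) : EReal)) atTop}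
      = 0 := by
  have H : 𝓔.LILHyp X := by
    refine ⟨hX, hX2, hind, fun ε hε => ?_, hmom, hdiv, hmean⟩
    have hm : ∀ n, MeasurableSet {ω | ε / 2 * 𝓔.an X (n + 1) ≤ |X (n + 1) ω|} := fun n =>
      measurableSet_le measurable_const (𝓔.measurable_of_mem _ (hX _ (by omega))).abs
    refine (ENNReal.tsum_le_tsum fun n => ?_).trans_lt
      (htail (ε / 2) (half_pos hε)).tsum_ofReal_lt_top
    have h0 : 0 ≤ 𝓔.an X (n + 1) := mul_nonneg (Real.sqrt_nonneg _) (Real.sqrt_nonneg _)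
    -- If `a_{n+1} = 0`, the event is the whole space; its `V` is `1`, which bounds any `upCap`.
    rcases h0.eq_or_lt with h | h
    · refine (SublinearExpectationSpace.upCap_le_one _).trans ?_
      simp [← h, hV.univ]
    · refine (SublinearExpectationSpace.upCap_tail_le hV (hX _ (by omega))
        (mul_pos hε h)).trans (le_of_eq ?_)
      rw [mul_div_right_comm]
  refine ⟨fun ε hε => ⟨H.tendsto_upper hV hε, ?_, H.tendsto_lower hV hε⟩,
    H.outCap_limsup_eq_zero⟩
  have han : 𝓔.an (fun n ω => -X n ω) = 𝓔.an X := by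
    funext n
    simp [SublinearExpectationSpace.an, SublinearExpectationSpace.sd,
      SublinearExpectationSpace.tn, SublinearExpectationSpace.sSq]
  have hps : ∀ m ω, partialSum (fun n ω => -X n ω) m ω = -partialSum X m ω := fun m ω => by
    simp [partialSum]
  simpa only [han, hps] using H.neg.tendsto_lower hV hε
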